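/- Let $k$ be a field of characteristic $0$ and $H$ a cocommutative Hopf algebra over $k$. For a left $H$-module $M$ and $n\ge 0$ let $H^{\otimes n}\otimes_H M$ be formed with the iterated coproduct $\Delta^{(n)}:H\to H^{\otimes n}$ (the counit if $n=0$), so $a\,\Delta^{(n)}(h)\otimes_H x=a\otimes_H hx$. For a permutation $\sigma$ of the positions, $\sigma\otimes_H\mathrm{id}$ moves the tensor factor in position $i$ to position $\sigma(i)$. Pseudo-operations are $H^{\otimes p}$-linear maps $f:L^{\otimes p}\to H^{\otimes p}\otimes_H M$. They are composed as usual: if $f(y,\dots)=\sum_l b_l\otimes_H m_l$, then $f\big((a\otimes_H y),\dots\big)=\sum_l (a\otimes 1)\,(\Delta^{(q)}\otimes \mathrm{id})(b_l)\otimes_H m_l$ for $a\in H^{\otimes q}$, and similarly for other arguments; $H$-linear maps $T$ act on values by $\mathrm{id}\otimes_H T$. Let $C^p(L,M)$ be the space of such $f$ that are skew-symmetric, $(\sigma\otimes_H\mathrm{id})f(x_{\sigma(1)},\dots,x_{\sigma(p)})=\operatorname{sgn}(\sigma)f(x_1,\dots,x_p)$; in particular $C^0(L,M)=k\otimes_H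 M$. A Lie $H$-pseudoalgebra is an $H$-module $L$ with an $H^{\otimes2}$-linear $\Omega:L\otimes L\to H^{\otimes 2}\otimes_H L$ such that $\Omega(x,y)=-((12)\otimes_H\mathrm{id})\Omega(y,x)$ and $\Omega(x,\Omega(y,z))=\Omega(\Omega(x,y),z)+((12)\otimes_H\mathrm{id})\Omega(y,\Omega(x,z))$; a representation on $M$ is an $H^{\otimes 2}$-linear $\zeta:L\otimes M\to H^{\otimes2}\otimes_H M$ with $\zeta(\Omega(u,v),x)=\zeta(u,\zeta(v,x))-((12)\otimes_H\mathrm{id})\zeta(v,\zeta(u,x))$. Let $\mathfrak g,\mathfrak h$ be $H$-modules and let $\Omega$ be a Lie pseudobracket on $\mathfrak G=\mathfrak g\oplus\mathfrak h$ for which $\mathfrak h$ is a subalgebra (a quasi-twilled Lie pseudoalgebra). Write $\Omega(x,y)=(\pi(x,y),\theta(x,y))$, $\Omega(x,v)=(\eta(x,v),\rho(x,v))$ and $\Omega(u,v)=(0,\mu(u,v))$ for $x,y\in\mathfrak g$, $u,v\in\mathfrak h$. Let $T:\mathfrak h\to\mathfrak g$ be a deformation map of type II, i.e. an $H$-linear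 map such that for all $u,v\in\mathfrak h$ $$\pi(Tu,Tv)+\eta(Tu,v)-((12)\otimes_H\mathrm{id})\eta(Tv,u)=T\Big(\rho(Tu,v)-((12)\otimes_H\mathrm{id})\rho(Tv,u)+\mu(u,v)+\theta(Tu,Tv)\Big).$$ Define $\mu^T:\mathfrak h\otimes\mathfrak h\to H^{\otimes 2}\otimes_H\mathfrak h$ and $\zeta:\mathfrak h\otimes\mathfrak g\to H^{\otimes 2}\otimes_H\mathfrak g$ by $$\mu^T(u,v)=\mu(u,v)+\rho(Tu,v)-((12)\otimes_H\mathrm{id})\rho(Tv,u)+\theta(Tu,Tv),$$ $$\zeta(v,x)=((12)\otimes_H\mathrm{id})\Big(-\eta(x,v)-\pi(x,Tv)+T\rho(x,v)-T\big(((12)\otimes_H\mathrm{id})\theta(Tv,x)\big)\Big).$$ For $f\in C^p(\mathfrak h,\mathfrak g)$, $p\ge0$, let $$d^T_{CE}f(u_1,\dots,u_{p+1})=\sum_i(-1)^{i+1}(\sigma_i\otimes_H\mathrm{id})\,\zeta(u_i,f(u_1,\dots,\widehat{u_i},\dots,u_{p+1}))+\sum_{i<j}(-1)^{i+j}(\sigma_{ij}\otimes_H\mathrm{id})\,f(\mu^T(u_i,u_j),u_1,\dots,\widehat{u_i},\dots,\widehat{u_j},\dots,u_{p+1}),$$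 where $\sigma_i,\sigma_{ij}$ put the tensor factors back into the order $u_1,\dots,u_{p+1}$ (the second sum is absent for $p=0$). Regard $\pi,\rho,\mu,\eta,\theta$ as maps $\mathfrak G^{\otimes 2}\to H^{\otimes 2}\otimes_H\mathfrak G$, extended by zero and, for $\rho$ and $\eta$, skew-symmetrically; and regard $f\in C^p(\mathfrak h,\mathfrak g)$ (and $T$, as the map $u\mapsto 1\otimes_H Tu$ of one argument) as maps $\mathfrak G^{\otimes p}\to H^{\otimes p}\otimes_H\mathfrak G$, extended by zero. For $f,g$ of $m+1$ and $n+1$ arguments let $[f,g]=f\circ g-(-1)^{mn}g\circ f$ be the Nijenhuis–Richardson bracket, where $$(f\circ g)(x_1,\dots,x_{m+n+1})=\sum_{\sigma\in \mathrm{Sh}(n+1,m)}\operatorname{sgn}(\sigma)(\sigma\otimes_H\mathrm{id})f\big(g(x_{\sigma(1)},\dots,x_{\sigma(n+1)}),x_{\sigma(n+2)},\dots,x_{\sigma(m+n+1)}\big).$$ Let $l_1(f)=[\mu+\eta,f]$, $l_2(f,g)=[[\pi+\rho,f],g]$, $l_3(f,g,h)=[[[\theta,f],g],h]$ and $l_1^T(f)=l_1(f)+l_2(T,f)+\tfrac12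 l_3(T,T,f)$. Then: 1. $(\mathfrak h,\mu^T)$ is a Lie pseudoalgebra, and $\zeta$ is a representation of it on $\mathfrak g$. 2. $d^T_{CE}$ maps $C^p(\mathfrak h,\mathfrak g)$ to $C^{p+1}(\mathfrak h,\mathfrak g)$ and $d^T_{CE}\circ d^T_{CE}=0$, for all $p\ge 0$. (The cohomology of this complex, up to a shift of the degree by one, is by definition the cohomology of $T$.) 3. For all $p\ge1$ and $f\in C^p(\mathfrak h,\mathfrak g)$, $\; l_1^T(f)=(-1)^{p-1}d^T_{CE}f$. 4. Hence the complexes $\big(\bigoplus_{p\ge1}C^p(\mathfrak h,\mathfrak g),l_1^T\big)$ and $(C^\bullet(\mathfrak h,\mathfrak g),d^T_{CE})$ have the same cocycles in $C^p$ for all $p\ge1$ and the same coboundaries in $C^p$ for all $p\ge2$, so that for $p\ge 2$ the cohomology of $l_1^T$ at $C^p(\mathfrak h,\mathfrak g)$ is the Chevalley–Eilenberg cohomology $H^p$ of $(\mathfrak h,\mu^T)$ with coefficients in $(\mathfrak g,\zeta)$, the isomorphism sending the class of $f$ to the class of $f$. -/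

import Mathlib

namespace LiePseudo

open scoped TensorProduct
open WithConv

noncomputable section

set_option linter.unusedSectionVars false

section TensorPowers

variable (k H : Type*) [Field k] [Ring H] [HopfAlgebra k H]

/-- The algebra `H^{⊗ n}`. -/
abbrev Tn (n : ℕ) : Type _ := PiTensorProduct k (fun _ : Fin n => H)

variable {H}

/-- `slot k i h = 1 ⊗ ⋯ ⊗ h ⊗ ⋯ ⊗ 1`, with `h` in position `i`. -/
def slot {n : ℕ} (i : Fin n) : H →ₐ[k] Tn k H n :=
  PiTensorProduct.singleAlgHom (R := k) (A := fun _ : Fin n => H) i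

variable {k}

theorem slot_commute {n : ℕ} {i j : Fin n} (hij : i ≠ j) (x y : H) :
    Commute (slot k i x) (slot k j y) := by
  simp only [slot, PiTensorProduct.singleAlgHom_apply]
  exact (Pi.mulSingle_commute (f := fun _ : Fin n => H) hij x y).tprod

section TnLift

variable {A : Type*} [Ring A] [Algebra k A] {m : ℕ}

theorem prod_ofFn_mul {A : Type*} [Monoid A] : ∀ {m : ℕ} (a b : Fin m → A)
    (_ : Pairwise fun i j => Commute (b i) (a j)),
    (List.ofFn (a * b)).prod = (List.ofFn a).prod * (List.ofFn b).prod := by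
  intro m
  induction m with
  | zero => intro a b _; simp
  | succ m ih =>
    intro a b hc
    have h1 := ih (fun i => a i.succ) (fun i => b i.succ)
      (fun i j hij => hc (fun h => hij (Fin.succ_injective _ h)))
    have h2 : (List.ofFn fun i : Fin m => (a * b) i.succ).prod
        = (List.ofFn fun i : Fin m => a i.succ).prod
          * (List.ofFn fun i : Fin m => b i.succ).prod := h1
    have h3 : Commute (b 0) (List.ofFn fun i : Fin m => a i.succ).prod := by
      apply Commute.list_prod_right
      intro x hx
      obtain ⟨i, rfl⟩ := (List.mem_ofFn' _ _).1 hx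
      exact hc (Fin.succ_ne_zero i).symm
    rw [List.ofFn_succ, List.prod_cons, h2, List.ofFn_succ, List.prod_cons, List.ofFn_succ,
      List.prod_cons, Pi.mul_apply]
    simp only [mul_assoc]
    rw [← mul_assoc (b 0), h3.eq, mul_assoc]

/-- The algebra map out of `H^{⊗ m}` determined by algebra maps with commuting images:
`h₀ ⊗ ⋯ ⊗ hₘ₋₁ ↦ F₀ h₀ ⋯ Fₘ₋₁ hₘ₋₁`. -/
def tnLift (F : Fin m → (H →ₐ[k] A))
    (hF : ∀ i j, i ≠ j → ∀ x y, Commute (F i x) (F j y)) : Tn k H m →ₐ[k] A :=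
  PiTensorProduct.liftAlgHom
    ((MultilinearMap.mkPiAlgebraFin k m A).compLinearMap fun i => (F i).toLinearMap)
    (by simp [MultilinearMap.mkPiAlgebraFin_apply])
    (fun x y => by
      simp only [MultilinearMap.compLinearMap_apply, MultilinearMap.mkPiAlgebraFin_apply,
        AlgHom.toLinearMap_apply, Pi.mul_apply, map_mul]
      exact prod_ofFn_mul (fun i => F i (x i)) (fun i => F i (y i)) (fun i j hij => hF _ _ hij _ _))

theorem tnLift_tprod (F : Fin m → (H →ₐ[k] A)) (hF) (x : Fin m → H) :
    tnLift F hF (PiTensorProduct.tprod k x) = (List.ofFn fun i => F i (x i)).prod := by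
  simp [tnLift, MultilinearMap.mkPiAlgebraFin_apply]

theorem prod_ofFn_single {A : Type*} [Monoid A] : ∀ {m : ℕ} (a : Fin m → A) (i : Fin m)
    (_ : ∀ j, j ≠ i → a j = 1), (List.ofFn a).prod = a i := by
  intro m
  induction m with
  | zero => intro a i; exact i.elim0
  | succ m ih =>
    intro a i ha
    rw [List.ofFn_succ, List.prod_cons]
    refine Fin.cases (fun ha => ?_) (fun i ha => ?_) i ha
    · have : (fun i : Fin m => a i.succ) = fun _ => 1 :=
        funext fun j => ha _ (Fin.succ_ne_zero j)
      rw [this]; simp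
    · rw [ih (fun i => a i.succ) i (fun j hj => ha _ (fun h => hj (Fin.succ_injective _ h))),
        ha 0 (Fin.succ_ne_zero i).symm, one_mul]

theorem tnLift_slot (F : Fin m → (H →ₐ[k] A)) (hF) (i : Fin m) (h : H) :
    tnLift F hF (slot k i h) = F i h := by
  simp only [slot, PiTensorProduct.singleAlgHom_apply, tnLift_tprod]
  rw [prod_ofFn_single _ i]
  · simp
  · intro j hj
    simp [Pi.mulSingle_eq_of_ne hj]

end TnLift

/-- The iterated coproduct `h ↦ h₍₁₎ ⊗ ⋯ ⊗ h₍ᵣ₎` spread over the positions listed in `l`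
(the unit being placed in all other positions; the counit if `l` is empty).  It is the
convolution product of the embeddings `slot k j`, `j ∈ l`. -/
def cop {n : ℕ} (l : List (Fin n)) : H →ₗ[k] Tn k H n :=
  (l.map fun j => toConv (slot k (H := H) j).toLinearMap).prod.ofConv

theorem cop_nil {n : ℕ} (h : H) :
    cop (k := k) ([] : List (Fin n)) h = algebraMap k _ (Coalgebra.counit h) := by
  simp [cop]

theorem cop_cons {n : ℕ} (j : Fin n) (l : List (Fin n)) (h : H) :
    cop (k := k) (j :: l) h = LinearMap.mul' k _
      (TensorProduct.map (slot k j).toLinearMap (cop l) (Coalgebra.comul h)) := by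
  simp [cop]

theorem cop_singleton {n : ℕ} (j : Fin n) (h : H) : cop (k := k) [j] h = slot k j h := by
  simp [cop]

theorem cop_append {n : ℕ} (l l' : List (Fin n)) :
    toConv (cop (k := k) (H := H) (l ++ l')) = toConv (cop l) * toConv (cop l') := by
  simp [cop]

theorem commute_mul'_map {A : Type*} [Ring A] [Algebra k A] (f g : H →ₗ[k] A) (a : A)
    (hf : ∀ x, Commute a (f x)) (hg : ∀ x, Commute a (g x)) (z : H ⊗[k] H) :
    Commute a (LinearMap.mul' k A (TensorProduct.map f g z)) := by
  induction z using TensorProduct.induction_on with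
  | zero => simp
  | tmul x y => simpa using (hf x).mul_right (hg y)
  | add x y hx hy => simpa using hx.add_right hy

theorem commute_cop {n : ℕ} (l : List (Fin n)) (a : Tn k H n)
    (ha : ∀ j ∈ l, ∀ h : H, Commute a (slot k j h)) (h : H) : Commute a (cop l h) := by
  induction l generalizing h with
  | nil => rw [cop_nil]; exact (Algebra.commutes _ _).symm
  | cons j l ih =>
    rw [cop_cons]
    refine commute_mul'_map _ _ _ (fun x => ha j (by simp) x) (fun x => ?_) _
    exact ih (fun i hi => ha i (by simp [hi])) x

theorem cop_commute_cop {n : ℕ} (l l' : List (Fin n)) (hl : ∀ j ∈ l, j ∉ l') (x y : H) :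
    Commute (cop (k := k) l x) (cop (k := k) l' y) := by
  refine commute_cop _ _ (fun j hj h => ?_) _
  refine (commute_cop _ _ (fun i hi h' => ?_) _).symm
  refine slot_commute ?_ _ _
  rintro rfl
  exact hl _ hi hj

theorem cop_algHom {n : ℕ} (l : List (Fin n)) (hl : l.Nodup) :
    ∃ g : H →ₐ[k] Tn k H n, g.toLinearMap = cop l := by
  induction l with
  | nil =>
    refine ⟨(Algebra.ofId k _).comp (Bialgebra.counitAlgHom k H), ?_⟩
    ext h
    simp [cop_nil, Algebra.ofId_apply]
  | cons j l ih =>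
    obtain ⟨g, hg⟩ := ih (List.nodup_cons.1 hl).2
    have hc : ∀ x y, Commute (slot k j x) (g y) := fun x y => by
      have : g y = cop l y := by rw [← hg]; rfl
      rw [this, ← cop_singleton]
      refine cop_commute_cop _ _ (fun i hi => ?_) _ _
      rw [List.mem_singleton.1 hi]
      exact (List.nodup_cons.1 hl).1
    refine ⟨(Algebra.TensorProduct.lift (slot k j) g hc).comp (Bialgebra.comulAlgHom k H), ?_⟩
    ext h
    rw [cop_cons, ← hg]
    simp only [AlgHom.toLinearMap_apply, AlgHom.comp_apply, Bialgebra.comulAlgHom_apply]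
    generalize (Coalgebra.comul h : H ⊗[k] H) = z
    induction z using TensorProduct.induction_on with
    | zero => simp
    | tmul x y => simp
    | add x y hx hy => rw [map_add, map_add, map_add, hx, hy]

/-- `cop l` as an algebra map, for a list `l` of distinct positions. -/
def copA {n : ℕ} (l : List (Fin n)) (hl : l.Nodup) : H →ₐ[k] Tn k H n :=
  AlgHom.ofLinearMap (cop l)
    (by obtain ⟨g, hg⟩ := cop_algHom (k := k) (H := H) l hl; rw [← hg]; simp)
    (by obtain ⟨g, hg⟩ := cop_algHom (k := k) (H := H) l hl; rw [← hg]; simp)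

@[simp] theorem copA_apply {n : ℕ} (l : List (Fin n)) (hl : l.Nodup) (h : H) :
    copA (k := k) l hl h = cop l h := rfl

/-- The positions lying over `i` under `φ`, in increasing order. -/
def fib {m n : ℕ} (φ : Fin n → Fin m) (i : Fin m) : List (Fin n) :=
  (List.finRange n).filter fun j => φ j = i

theorem mem_fib {m n : ℕ} (φ : Fin n → Fin m) (i : Fin m) (j : Fin n) :
    j ∈ fib φ i ↔ φ j = i := by simp [fib]

theorem fib_nodup {m n : ℕ} (φ : Fin n → Fin m) (i : Fin m) : (fib φ i).Nodup :=
  (List.nodup_finRange n).filter _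

theorem flatMap_fib_nodup {m n : ℕ} (φ : Fin n → Fin m) :
    ((List.finRange m).flatMap (fib φ)).Nodup := by
  rw [List.nodup_flatMap]
  refine ⟨fun i _ => fib_nodup φ i, (List.nodup_finRange m).imp fun hij j hj hj' => ?_⟩
  rw [mem_fib] at hj hj'
  exact hij (hj.symm.trans hj')

/-- The algebra map `Δ^φ : H^{⊗ m} → H^{⊗ n}` attached to `φ : {0,…,n-1} → {0,…,m-1}`:
the `i`-th tensor factor is spread by the iterated coproduct over the positions in `φ⁻¹(i)`. -/
def delta {m n : ℕ} (φ : Fin n → Fin m) : Tn k H m →ₐ[k] Tn k H n :=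
  tnLift (fun i => copA (fib φ i) (fib_nodup φ i)) fun i i' hii' x y =>
    cop_commute_cop _ _ (fun j hj hj' => hii' (by
      rw [mem_fib] at hj hj'; exact hj.symm.trans hj')) x y

theorem delta_slot {m n : ℕ} (φ : Fin n → Fin m) (i : Fin m) (h : H) :
    delta (k := k) φ (slot k i h) = cop (fib φ i) h := by
  exact tnLift_slot _ _ _ _

/-- The embedding `H^{⊗ q} → H^{⊗ n}` placing the `j`-th tensor factor in position `e j`. -/
def emb {q n : ℕ} (e : Fin q → Fin n) (he : Function.Injective e) : Tn k H q →ₐ[k] Tn k H n :=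
  tnLift (fun j => slot k (e j)) fun _ _ hij x y =>
    slot_commute (fun h => hij (he h)) x y

theorem emb_slot {q n : ℕ} (e : Fin q → Fin n) (he) (j : Fin q) (h : H) :
    emb (k := k) e he (slot k j h) = slot k (e j) h := by
  exact tnLift_slot _ _ _ _

theorem commute_emb {q n : ℕ} (e : Fin q → Fin n) (he) (b : Tn k H n)
    (hb : ∀ j h, Commute b (slot k (e j) h)) (a : Tn k H q) : Commute b (emb e he a) := by
  induction a using PiTensorProduct.induction_on with
  | smul_tprod r x =>
    rw [map_smul]
    refine Commute.smul_right ?_ _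
    have h1 : emb (k := k) e he (PiTensorProduct.tprod k x)
        = (List.ofFn fun i => slot k (e i) (x i)).prod := tnLift_tprod _ _ _
    rw [h1]
    refine Commute.list_prod_right _ _ fun y hy => ?_
    obtain ⟨i, rfl⟩ := (List.mem_ofFn' _ _).1 hy
    exact hb _ _
  | add x y hx hy => rw [map_add]; exact hx.add_right hy

theorem algHom_cop {m n : ℕ} (G : Tn k H m →ₐ[k] Tn k H n) (F : Fin m → List (Fin n))
    (hG : ∀ i h, G (slot k i h) = cop (F i) h) (l : List (Fin m)) (h : H) :
    G (cop l h) = cop (l.flatMap F) h := by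
  induction l generalizing h with
  | nil => simp [cop_nil]
  | cons j l ih =>
    have h1 : cop (k := k) ((j :: l).flatMap F) h
        = (toConv (cop (k := k) (H := H) (F j)) *
          toConv (cop (k := k) (H := H) (l.flatMap F)) : WithConv (H →ₗ[k] Tn k H n)) h := by
      rw [← cop_append]; rfl
    rw [h1, LinearMap.convMul_apply, cop_cons]
    generalize (Coalgebra.comul h : H ⊗[k] H) = z
    induction z using TensorProduct.induction_on with
    | zero => simp
    | tmul x y => simp [hG, ih]
    | add x y hx hy => simp only [map_add, hx, hy]

/-- The iterated coproduct `H → H^{⊗ n}`; the counit for `n = 0`. -/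
def coprod (n : ℕ) : H →ₗ[k] Tn k H n := cop (List.finRange n)

variable [Coalgebra.IsCocomm k H]

theorem cop_perm {n : ℕ} {l l' : List (Fin n)} (hl : l.Nodup) (h : l.Perm l') :
    cop (k := k) (H := H) l = cop l' := by
  unfold cop
  congr 1
  refine (h.map _).prod_eq' ?_
  refine List.Pairwise.map _ (fun i j hij => ?_) hl
  ext x
  rw [LinearMap.convMul_apply, LinearMap.convMul_apply]
  conv_rhs => rw [← Coalgebra.comm_comul k x]
  generalize (Coalgebra.comul x : H ⊗[k] H) = z
  induction z using TensorProduct.induction_on with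
  | zero => simp
  | tmul x y => simpa using (slot_commute hij x y).eq
  | add x y hx hy => simp only [map_add, hx, hy]

theorem delta_coprod {m n : ℕ} (φ : Fin n → Fin m) (h : H) :
    delta (k := k) φ (coprod m h) = coprod n h := by
  rw [coprod, algHom_cop _ _ (delta_slot φ), coprod]
  refine DFunLike.congr_fun (cop_perm (k := k) (H := H) ?_ ?_) h
  · exact flatMap_fib_nodup φ
  · refine (List.perm_ext_iff_of_nodup ?_ (List.nodup_finRange n)).2 fun j => ?_
    · exact flatMap_fib_nodup φ
    · simp [mem_fib]

theorem emb_coprod {q n : ℕ} (e : Fin q → Fin n) (he : Function.Injective e) (h : H)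
    {m : ℕ} (φ : Fin n → Fin m) (i : Fin m) (hφ : ∀ j, φ j = i ↔ j ∈ Set.range e) :
    emb (k := k) e he (coprod q h) = delta φ (slot k i h) := by
  have hnd : ((List.finRange q).flatMap fun j => [e j]).Nodup := by
    rw [List.nodup_flatMap]
    refine ⟨fun i _ => by simp, (List.nodup_finRange q).imp fun hij => ?_⟩
    simpa using fun h => hij (he h.symm)
  rw [coprod, algHom_cop _ (fun j => [e j]) (fun j h => by rw [emb_slot, cop_singleton]),
    delta_slot]
  refine DFunLike.congr_fun (cop_perm (k := k) (H := H) ?_ ?_) h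
  · exact hnd
  · refine (List.perm_ext_iff_of_nodup hnd (fib_nodup φ i)).2 fun j => ?_
    rw [mem_fib, hφ]
    simp [eq_comm]

end TensorPowers

section PseudoTensor

variable (k H : Type*) [Field k] [Ring H] [HopfAlgebra k H]

/-- The relations `a Δ(h) ⊗ x = a ⊗ h x` defining `H^{⊗ n} ⊗_H M`. -/
def balanced (n : ℕ) (M : Type*) [AddCommGroup M] [Module k M] [Module H M] :
    Submodule (Tn k H n) (Tn k H n ⊗[k] M) :=
  Submodule.span _ {z | ∃ (h : H) (x : M), z = coprod n h ⊗ₜ[k] x - 1 ⊗ₜ[k] (h • x)}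

/-- The left `H^{⊗ n}`-module `H^{⊗ n} ⊗_H M`, where `H` acts on the right of `H^{⊗ n}` through
the iterated coproduct. -/
def PT (n : ℕ) (M : Type*) [AddCommGroup M] [Module k M] [Module H M] : Type _ :=
  (Tn k H n ⊗[k] M) ⧸ balanced k H n M

section instances
variable (n : ℕ) (M : Type*) [AddCommGroup M] [Module k M] [Module H M]

instance : AddCommGroup (PT k H n M) :=
  inferInstanceAs (AddCommGroup ((Tn k H n ⊗[k] M) ⧸ balanced k H n M))

instance : Module (Tn k H n) (PT k H n M) :=
  inferInstanceAs (Module (Tn k H n) ((Tn k H n ⊗[k] M) ⧸ balanced k H n M))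

instance : Module k (PT k H n M) :=
  inferInstanceAs (Module k ((Tn k H n ⊗[k] M) ⧸ balanced k H n M))

instance : IsScalarTower k (Tn k H n) (PT k H n M) :=
  inferInstanceAs (IsScalarTower k (Tn k H n) ((Tn k H n ⊗[k] M) ⧸ balanced k H n M))

instance : SMulCommClass k (Tn k H n) (PT k H n M) :=
  IsScalarTower.to_smulCommClass

instance : SMulCommClass (Tn k H n) k (PT k H n M) :=
  SMulCommClass.symm _ _ _

end instances

variable {k H}
variable {M : Type*} [AddCommGroup M] [Module k M] [Module H M]
variable {N : Type*} [AddCommGroup N] [Module k N] [Module H N]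

/-- The element `a ⊗_H x` of `H^{⊗ n} ⊗_H M`. -/
def PT.mk {n : ℕ} (a : Tn k H n) (x : M) : PT k H n M :=
  (balanced k H n M).mkQ (a ⊗ₜ[k] x)

theorem PT.smul_mk {n : ℕ} (a b : Tn k H n) (x : M) : a • PT.mk b x = PT.mk (a * b) x := rfl

theorem PT.mk_coprod {n : ℕ} (h : H) (x : M) :
    PT.mk (coprod n h) x = PT.mk (k := k) 1 (h • x) :=
  (Submodule.Quotient.eq _).2 (Submodule.subset_span ⟨h, x, rfl⟩)

theorem PT.induction {n : ℕ} {P : PT k H n M → Prop} (z : PT k H n M)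
    (h0 : P 0) (hmk : ∀ a x, P (PT.mk a x)) (hadd : ∀ z w, P z → P w → P (z + w)) : P z := by
  obtain ⟨z, rfl⟩ := Submodule.Quotient.mk_surjective _ z
  induction z using TensorProduct.induction_on with
  | zero => exact h0
  | tmul a x => exact hmk a x
  | add z w hz hw => exact hadd _ _ hz hw

/-- The map `a ⊗ x ↦ τ(a) B(x)`, semilinear with respect to `τ : H^{⊗ q} → A`. -/
def PT.preLift {q : ℕ} {A X : Type*} [Ring A] [Algebra k A] [AddCommGroup X] [Module k X]
    [Module A X] [IsScalarTower k A X] (τ : Tn k H q →ₐ[k] A) (B : M →ₗ[k] X) :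
    Tn k H q ⊗[k] M →ₛₗ[(τ : Tn k H q →+* A)] X where
  toFun := TensorProduct.lift
    (LinearMap.mk₂ k (fun (a : Tn k H q) (x : M) => τ a • B x)
      (by intros; simp [add_smul]) (by intros; simp) (by intros; simp) (by
        intro c a x
        rw [map_smul, ← algebraMap_smul A c (B x), ← algebraMap_smul A c (τ a • B x),
          smul_smul, smul_smul, Algebra.commutes]))
  map_add' := map_add _
  map_smul' a z := by
    induction z using TensorProduct.induction_on with
    | zero => simp
    | tmul b x => simp [TensorProduct.smul_tmul', mul_smul]
    | add z w hz hw => rw [smul_add, map_add, map_add, hz, hw, smul_add]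

/-- Universal property: `τ : H^{⊗ q} → A` and `B : M → X` with `τ(Δ(h)) B(x) = B(h x)` induce
`a ⊗_H x ↦ τ(a) B(x)`. -/
def PT.lift {q : ℕ} {A X : Type*} [Ring A] [Algebra k A] [AddCommGroup X] [Module k X]
    [Module A X] [IsScalarTower k A X] (τ : Tn k H q →ₐ[k] A) (B : M →ₗ[k] X)
    (hB : ∀ h x, τ (coprod q h) • B x = B (h • x)) :
    PT k H q M →ₛₗ[(τ : Tn k H q →+* A)] X :=
  (balanced k H q M).liftQ (PT.preLift τ B) (by
    refine Submodule.span_le.2 ?_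
    rintro _ ⟨h, x, rfl⟩
    simp only [SetLike.mem_coe, LinearMap.mem_ker, map_sub]
    simp [PT.preLift, hB])

theorem PT.lift_mk {q : ℕ} {A X : Type*} [Ring A] [Algebra k A] [AddCommGroup X] [Module k X]
    [Module A X] [IsScalarTower k A X] (τ : Tn k H q →ₐ[k] A) (B : M →ₗ[k] X) (hB)
    (a : Tn k H q) (x : M) : PT.lift τ B hB (PT.mk a x) = τ a • B x := by
  change PT.preLift τ B (a ⊗ₜ[k] x) = _
  simp [PT.preLift]

theorem PT.lift_smul {q : ℕ} {A X : Type*} [Ring A] [Algebra k A] [AddCommGroup X] [Module k X]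
    [Module A X] [IsScalarTower k A X] (τ : Tn k H q →ₐ[k] A) (B : M →ₗ[k] X) (hB)
    (a : Tn k H q) (z : PT k H q M) : PT.lift τ B hB (a • z) = τ a • PT.lift τ B hB z :=
  LinearMap.map_smulₛₗ _ _ _

/-- `PT.lift` as a `k`-linear map. -/
def PT.liftₗ {q : ℕ} {A X : Type*} [Ring A] [Algebra k A] [AddCommGroup X] [Module k X]
    [Module A X] [IsScalarTower k A X] (τ : Tn k H q →ₐ[k] A) (B : M →ₗ[k] X)
    (hB : ∀ h x, τ (coprod q h) • B x = B (h • x)) : PT k H q M →ₗ[k] X where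
  toFun := PT.lift τ B hB
  map_add' := map_add _
  map_smul' c z := by
    rw [← algebraMap_smul (Tn k H q) c z, PT.lift_smul]
    simp

theorem PT.liftₗ_mk {q : ℕ} {A X : Type*} [Ring A] [Algebra k A] [AddCommGroup X] [Module k X]
    [Module A X] [IsScalarTower k A X] (τ : Tn k H q →ₐ[k] A) (B : M →ₗ[k] X) (hB)
    (a : Tn k H q) (x : M) : PT.liftₗ τ B hB (PT.mk a x) = τ a • B x :=
  PT.lift_mk τ B hB a x

theorem PT.liftₗ_smul {q : ℕ} {A X : Type*} [Ring A] [Algebra k A] [AddCommGroup X] [Module k X]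
    [Module A X] [IsScalarTower k A X] (τ : Tn k H q →ₐ[k] A) (B : M →ₗ[k] X) (hB)
    (a : Tn k H q) (z : PT k H q M) : PT.liftₗ τ B hB (a • z) = τ a • PT.liftₗ τ B hB z :=
  PT.lift_smul τ B hB a z

/-- The map `x ↦ 1 ⊗_H x`. -/
def PT.unit (n : ℕ) : M →ₗ[k] PT k H n M where
  toFun x := PT.mk 1 x
  map_add' x y := congrArg Submodule.Quotient.mk (TensorProduct.tmul_add _ x y)
  map_smul' c x := congrArg Submodule.Quotient.mk (TensorProduct.tmul_smul c (1 : Tn k H n) x)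

theorem PT.unit_apply (n : ℕ) (x : M) :
    PT.unit (k := k) (H := H) n x = PT.mk 1 x := rfl

theorem PT.coprod_smul_unit (n : ℕ) (h : H) (x : M) :
    (coprod n h : Tn k H n) • PT.unit (k := k) (H := H) n x = PT.unit n (h • x) := by
  rw [PT.unit_apply, PT.unit_apply, PT.smul_mk, mul_one, PT.mk_coprod]

/-- The map `id ⊗_H T : H^{⊗ n} ⊗_H M → H^{⊗ n} ⊗_H N` induced by an `H`-linear map `T`. -/
def PT.map {n : ℕ} [IsScalarTower k H M] [IsScalarTower k H N] (T : M →ₗ[H] N) :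
    PT k H n M →ₗ[k] PT k H n N :=
  PT.liftₗ (AlgHom.id k (Tn k H n)) (PT.unit (k := k) (H := H) n ∘ₗ T.restrictScalars k)
    fun h x => by
      simp only [LinearMap.comp_apply, LinearMap.restrictScalars_apply, map_smul]
      exact PT.coprod_smul_unit n h (T x)

theorem PT.map_mk {n : ℕ} [IsScalarTower k H M] [IsScalarTower k H N] (T : M →ₗ[H] N)
    (a : Tn k H n) (x : M) : PT.map T (PT.mk a x) = PT.mk a (T x) := by
  refine (PT.liftₗ_mk _ _ _ a x).trans ?_
  exact (PT.smul_mk a 1 (T x)).trans (by rw [mul_one])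

theorem PT.map_smul_tn {n : ℕ} [IsScalarTower k H M] [IsScalarTower k H N] (T : M →ₗ[H] N)
    (a : Tn k H n) (z : PT k H n M) : PT.map T (a • z) = a • PT.map T z :=
  PT.liftₗ_smul _ _ _ a z

variable [Coalgebra.IsCocomm k H]

/-- `Δ^φ ⊗_H id : H^{⊗ m} ⊗_H M → H^{⊗ n} ⊗_H M`. -/
def PT.pull {m n : ℕ} (φ : Fin n → Fin m) : PT k H m M →ₗ[k] PT k H n M :=
  PT.liftₗ (delta φ) (PT.unit (k := k) (H := H) n) fun h x => by
    rw [delta_coprod]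
    exact PT.coprod_smul_unit n h x

theorem PT.pull_smul {m n : ℕ} (φ : Fin n → Fin m) (a : Tn k H m) (z : PT k H m M) :
    PT.pull (k := k) (H := H) (M := M) φ (a • z) =
      delta φ a • PT.pull (k := k) (H := H) (M := M) φ z :=
  PT.liftₗ_smul (delta φ) _ _ a z

/-- The action `σ ⊗_H id` of a permutation on `H^{⊗ n} ⊗_H M`: the tensor factor in position `i`
is moved to position `σ i`. -/
def PT.perm {n : ℕ} (σ : Equiv.Perm (Fin n)) : PT k H n M →ₗ[k] PT k H n M :=
  PT.pull (k := k) (H := H) (M := M) (σ⁻¹ : Equiv.Perm (Fin n))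

theorem PT.perm_slot_smul {n : ℕ} (σ : Equiv.Perm (Fin n)) (i : Fin n) (h : H)
    (z : PT k H n M) : PT.perm (k := k) (H := H) (M := M) σ (slot k i h • z) =
      slot k (σ i) h • PT.perm (k := k) (H := H) (M := M) σ z := by
  have h1 : fib (σ⁻¹ : Equiv.Perm (Fin n)) i = [σ i] := by
    refine List.perm_singleton.1 ((List.perm_ext_iff_of_nodup (fib_nodup _ _) (by simp)).2 ?_)
    intro j
    rw [mem_fib, Equiv.Perm.inv_eq_iff_eq]
    simp
  have h2 : delta (k := k) (σ⁻¹ : Equiv.Perm (Fin n)) (slot k i h) = slot k (σ i) h := by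
    rw [delta_slot, h1, cop_singleton]
  rw [← h2]
  exact PT.pull_smul (k := k) (H := H) (M := M) (σ⁻¹ : Equiv.Perm (Fin n)) _ _

variable (k H) in
/-- The `k`-linear maps `B : M → H^{⊗ m} ⊗_H N` that are `H`-linear with respect to the action of
`H` on the tensor factor in position `i`. -/
def SlotHom (m : ℕ) (i : Fin m) (M N : Type*) [AddCommGroup M] [Module k M] [Module H M]
    [AddCommGroup N] [Module k N] [Module H N] : Submodule k (M →ₗ[k] PT k H m N) where
  carrier := {B | ∀ (h : H) (x : M), B (h • x) = slot k i h • B x}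
  add_mem' := by
    intro B B' hB hB' h x
    simp [hB h x, hB' h x]
  zero_mem' := by intro h x; simp
  smul_mem' := by
    intro c B hB h x
    simp [hB h x, smul_comm c]

/-- Insertion of an element of `H^{⊗ q} ⊗_H M` into the `i`-th argument of a pseudo-operation `B`
(with fixed other arguments).  Here `e` lists the `q` positions of the result that come from the
inserted element, and `φ` collapses them to `i`:
`a ⊗_H x ↦ e(a) · (Δ^φ ⊗_H id)(B x)`. -/
def PT.graft {q m n : ℕ} (φ : Fin n → Fin m) (i : Fin m) (e : Fin q → Fin n)
    (he : Function.Injective e) (hφ : ∀ j, φ j = i ↔ j ∈ Set.range e) (B : SlotHom k H m i M N) :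
    PT k H q M →ₗ[k] PT k H n N :=
  PT.liftₗ (emb e he) (PT.pull (k := k) (H := H) (M := N) φ ∘ₗ B.1) fun h x => by
    rw [LinearMap.comp_apply, LinearMap.comp_apply, emb_coprod e he h φ i hφ, B.2 h x,
      PT.pull_smul]

section graft
variable {q m n : ℕ} (φ : Fin n → Fin m) (i : Fin m) (e : Fin q → Fin n)
    (he : Function.Injective e) (hφ : ∀ j, φ j = i ↔ j ∈ Set.range e)

theorem PT.graft_mk (B : SlotHom k H m i M N) (a : Tn k H q) (x : M) :
    PT.graft φ i e he hφ B (PT.mk a x) = 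
      emb e he a • PT.pull (k := k) (H := H) (M := N) φ (B.1 x) :=
  PT.liftₗ_mk (emb e he) (PT.pull (k := k) (H := H) (M := N) φ ∘ₗ B.1) _ a x

theorem PT.graft_add (B B' : SlotHom k H m i M N) (z : PT k H q M) :
    PT.graft φ i e he hφ (B + B') z = PT.graft φ i e he hφ B z + PT.graft φ i e he hφ B' z := by
  induction z using PT.induction with
  | h0 => simp
  | hmk a x =>
    simp only [PT.graft_mk, Submodule.coe_add, LinearMap.add_apply, map_add, smul_add]
  | hadd z w hz hw => rw [map_add, map_add, map_add, hz, hw]; abel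

theorem PT.graft_smul (c : k) (B : SlotHom k H m i M N) (z : PT k H q M) :
    PT.graft φ i e he hφ (c • B) z = c • PT.graft φ i e he hφ B z := by
  induction z using PT.induction with
  | h0 => simp
  | hmk a x =>
    simp only [PT.graft_mk, Submodule.coe_smul, LinearMap.smul_apply, map_smul]
    rw [smul_comm]
  | hadd z w hz hw => rw [map_add, map_add, hz, hw, smul_add]

theorem PT.graft_slot_left (B : SlotHom k H m i M N) (j : Fin q) (h : H) (z : PT k H q M) :
    PT.graft φ i e he hφ B (slot k j h • z) = slot k (e j) h • PT.graft φ i e he hφ B z := by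
  rw [← emb_slot e he]
  exact PT.liftₗ_smul (emb e he) (PT.pull (k := k) (H := H) (M := N) φ ∘ₗ B.1) _ _ z

theorem PT.graft_slot_right (B B' : SlotHom k H m i M N) (j : Fin n) (h : H)
    (hj : ∀ j', φ j' = φ j ↔ j' = j) (hji : φ j ≠ i)
    (hB : ∀ x, B'.1 x = slot k (φ j) h • B.1 x) (z : PT k H q M) :
    PT.graft φ i e he hφ B' z = slot k j h • PT.graft φ i e he hφ B z := by
  have h1 : fib φ (φ j) = [j] := by
    refine List.perm_singleton.1 ((List.perm_ext_iff_of_nodup (fib_nodup _ _) (by simp)).2 ?_)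
    intro j'
    rw [mem_fib, hj]
    simp
  induction z using PT.induction with
  | h0 => simp
  | hmk a x =>
    have h3 : Commute (slot k j h) (emb (k := k) e he a) := by
      refine commute_emb e he _ (fun j' h' => slot_commute ?_ _ _) a
      rintro rfl
      exact hji ((hφ _).2 ⟨j', rfl⟩)
    rw [PT.graft_mk, PT.graft_mk, hB, PT.pull_smul, delta_slot, h1, cop_singleton, smul_smul,
      smul_smul, h3.eq]
  | hadd z w hz hw => rw [map_add, map_add, hz, hw, smul_add]

end graft

end PseudoTensor

section Operations

variable (k H : Type*) [Field k] [Ring H] [HopfAlgebra k H]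

/-- The `H^{⊗ 2}`-linear maps `L ⊗ M → H^{⊗ 2} ⊗_H N`. -/
def PBil (L M N : Type*) [AddCommGroup L] [Module k L] [Module H L]
    [AddCommGroup M] [Module k M] [Module H M] [AddCommGroup N] [Module k N] [Module H N] :
    Submodule k (L →ₗ[k] M →ₗ[k] PT k H 2 N) where
  carrier := {B | (∀ (h : H) x y, B (h • x) y = slot k (0 : Fin 2) h • B x y) ∧
    ∀ (h : H) x y, B x (h • y) = slot k (1 : Fin 2) h • B x y}
  add_mem' := by
    intro B B' hB hB'
    exact ⟨fun h x y => by simp [hB.1, hB'.1], fun h x y => by simp [hB.2, hB'.2]⟩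
  zero_mem' := ⟨fun h x y => by simp, fun h x y => by simp⟩
  smul_mem' := by
    intro c B hB
    exact ⟨fun h x y => by simp [hB.1, smul_comm c], fun h x y => by simp [hB.2, smul_comm c]⟩

variable {k H} in
theorem PBil.smul_left {L M N : Type*} [AddCommGroup L] [Module k L] [Module H L]
    [AddCommGroup M] [Module k M] [Module H M] [AddCommGroup N] [Module k N] [Module H N]
    (B : PBil k H L M N) (h : H) (x : L) (y : M) :
    B.1 (h • x) y = slot k (0 : Fin 2) h • B.1 x y :=
  (show (∀ (h : H) x y, B.1 (h • x) y = slot k (0 : Fin 2) h • B.1 x y) ∧ _ from B.2).1 h x y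

variable {k H} in
theorem PBil.smul_right {L M N : Type*} [AddCommGroup L] [Module k L] [Module H L]
    [AddCommGroup M] [Module k M] [Module H M] [AddCommGroup N] [Module k N] [Module H N]
    (B : PBil k H L M N) (h : H) (x : L) (y : M) :
    B.1 x (h • y) = slot k (1 : Fin 2) h • B.1 x y :=
  (show _ ∧ (∀ (h : H) x y, B.1 x (h • y) = slot k (1 : Fin 2) h • B.1 x y) from B.2).2 h x y

/-- The submodule underlying `Poly`. -/
def polySub (p : ℕ) (L M : Type*) [AddCommGroup L] [Module k L] [Module H L]
    [AddCommGroup M] [Module k M] [Module H M] :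
    Submodule k (MultilinearMap k (fun _ : Fin p => L) (PT k H p M)) where
  carrier := {f | ∀ (x : Fin p → L) (i : Fin p) (h : H),
    f (Function.update x i (h • x i)) = slot k i h • f x}
  add_mem' := by intro f g hf hg x i h; simp [hf x i h, hg x i h]
  zero_mem' := by intro x i h; simp
  smul_mem' := by intro c f hf x i h; simp [hf x i h, smul_comm c]

/-- The space of `H^{⊗ p}`-linear maps `L^{⊗ p} → H^{⊗ p} ⊗_H M`; linearity over `H^{⊗ p}` is
expressed on the generators `1 ⊗ ⋯ ⊗ h ⊗ ⋯ ⊗ 1` of `H^{⊗ p}`. -/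
def Poly (p : ℕ) (L M : Type*) [AddCommGroup L] [Module k L] [Module H L]
    [AddCommGroup M] [Module k M] [Module H M] : Type _ := polySub k H p L M

section
variable (p : ℕ) (L M : Type*) [AddCommGroup L] [Module k L] [Module H L]
    [AddCommGroup M] [Module k M] [Module H M]

instance : AddCommGroup (Poly k H p L M) := inferInstanceAs (AddCommGroup (polySub k H p L M))

instance : Module k (Poly k H p L M) := inferInstanceAs (Module k (polySub k H p L M))

end

variable {k H}
variable {L L' M M' N N' : Type*}
  [AddCommGroup L] [Module k L] [Module H L] [IsScalarTower k H L]
  [AddCommGroup L'] [Module k L'] [Module H L'] [IsScalarTower k H L']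
  [AddCommGroup M] [Module k M] [Module H M] [IsScalarTower k H M]
  [AddCommGroup M'] [Module k M'] [Module H M'] [IsScalarTower k H M']
  [AddCommGroup N] [Module k N] [Module H N] [IsScalarTower k H N]
  [AddCommGroup N'] [Module k N'] [Module H N'] [IsScalarTower k H N']

/-- `(x, y) ↦ B (S x, T y)`. -/
def PBil.comp (B : PBil k H L M N) (S : L' →ₗ[H] L) (T : M' →ₗ[H] M) : PBil k H L' M' N where
  val := B.1.compl₁₂ (S.restrictScalars k) (T.restrictScalars k)
  property := by
    exact ⟨fun h x y => by simp [PBil.smul_left B], fun h x y => by simp [PBil.smul_right B]⟩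

/-- `(x, y) ↦ (id ⊗_H T) (B (x, y))`. -/
def PBil.map (T : N →ₗ[H] N') (B : PBil k H L M N) : PBil k H L M N' where
  val := B.1.compr₂ (PT.map T)
  property := by
    exact ⟨fun h x y => by simp [PBil.smul_left B, PT.map_smul_tn],
    fun h x y => by simp [PBil.smul_right B, PT.map_smul_tn]⟩

/-- A polylinear map is determined by its additivity and its `H`-linearity in each argument. -/
def Poly.ofFun {p : ℕ} (F : (Fin p → L) → PT k H p M)
    (hadd : ∀ x i (v w : L), F (Function.update x i (v + w)) =
      F (Function.update x i v) + F (Function.update x i w))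
    (hsmul : ∀ x i (h : H), F (Function.update x i (h • x i)) = slot k i h • F x) :
    Poly k H p L M where
  val := MultilinearMap.mk' F (fun x i v w => hadd x i v w) (fun x i c v => by
      have := hsmul (Function.update x i v) i (algebraMap k H c)
      simpa [algebraMap_smul] using this)
  property := hsmul

/-- A binary operation `L ⊗ L → H^{⊗ 2} ⊗_H N` as a polylinear map of two arguments. -/
def PBil.toPoly (B : PBil k H L L N) : Poly k H 2 L N :=
  Poly.ofFun (fun x => B.1 (x 0) (x 1))
    (fun x i v w => by fin_cases i <;> simp)
    (fun x i h => by
      fin_cases i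
      · simpa using PBil.smul_left B h (x 0) (x 1)
      · simpa using PBil.smul_right B h (x 0) (x 1))

/-- `f` as a function of its first argument, the other arguments being `y`. -/
def Poly.first {m : ℕ} (f : Poly k H (m + 1) L M) (y : Fin m → L) : SlotHom k H (m + 1) 0 L M where
  val :=
    { toFun := fun x => f.1 (Fin.cons x y)
      map_add' := fun v w => by
        simpa using f.1.map_update_add (Fin.cons 0 y) 0 v w
      map_smul' := fun c v => by
        simpa using f.1.map_update_smul (Fin.cons 0 y) 0 c v }
  property := fun h x => by
    simpa using f.2 (Fin.cons x y) 0 h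

/-- `B` as a function of its first argument. -/
def PBil.left (B : PBil k H L M N) (y : M) : SlotHom k H 2 0 L N :=
  ⟨B.1.flip y, fun h x => PBil.smul_left B h x y⟩

/-- `B` as a function of its second argument. -/
def PBil.right (B : PBil k H L M N) (x : L) : SlotHom k H 2 1 M N :=
  ⟨B.1 x, fun h y => PBil.smul_right B h x y⟩

/-- `f` with its arguments restricted along `S` and its values pushed along `T`. -/
def Poly.conj {p : ℕ} (S : L' →ₗ[H] L) (T : M →ₗ[H] M') :
    Poly k H p L M →ₗ[k] Poly k H p L' M' where
  toFun f := Poly.ofFun (fun x => PT.map T (f.1 fun t => S (x t)))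
    (fun x i v w => by
      have h1 : ∀ v, (fun t => S (Function.update x i v t)) =
          Function.update (fun t => S (x t)) i (S v) := fun v => by
        funext t; by_cases ht : t = i
        · subst ht; simp
        · simp [ht]
      rw [h1, h1, h1, map_add, MultilinearMap.map_update_add, map_add])
    (fun x i h => by
      have h1 : ∀ v, (fun t => S (Function.update x i v t)) =
          Function.update (fun t => S (x t)) i (S v) := fun v => by
        funext t; by_cases ht : t = i
        · subst ht; simp
        · simp [ht]
      rw [h1, map_smul, ← PT.map_smul_tn]
      exact congrArg _ (f.2 (fun t => S (x t)) i h))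
  map_add' f g := Subtype.ext (MultilinearMap.ext fun x => map_add (PT.map T) _ _)
  map_smul' c f := Subtype.ext (MultilinearMap.ext fun x => map_smul (PT.map T) _ _)

/-- An `H`-linear map `T` as the polylinear map `x ↦ 1 ⊗_H T x` of one argument. -/
def Poly.ofHom (T : L →ₗ[H] M) : Poly k H 1 L M :=
  Poly.ofFun (fun x => PT.mk 1 (T (x 0)))
    (fun x i v w => by
      obtain rfl : i = 0 := Subsingleton.elim _ _
      simp only [Function.update_self, map_add]
      exact map_add (PT.unit (k := k) (H := H) 1) _ _)
    (fun x i h => by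
      obtain rfl : i = 0 := Subsingleton.elim _ _
      simp only [Function.update_self, map_smul]
      rw [← PT.mk_coprod, PT.smul_mk, mul_one]
      have : (coprod 1 h : Tn k H 1) = slot k 0 h := by
        rw [coprod, show List.finRange 1 = [0] from rfl, cop_singleton]
      rw [this])

variable [Coalgebra.IsCocomm k H]

/-- `(y, x) ↦ ((12) ⊗_H id) B (x, y)`. -/
def PBil.swap (B : PBil k H L M N) : PBil k H M L N where
  val := B.1.flip.compr₂ (PT.perm (Equiv.swap 0 1))
  property := by
    exact ⟨fun h x y => by simp [PBil.smul_right B, PT.perm_slot_smul],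
    fun h x y => by simp [PBil.smul_left B, PT.perm_slot_smul]⟩


/-- `w ↦ B (x, w)` for `w ∈ H^{⊗ q} ⊗_H M`, with values in `H^{⊗ (q+1)} ⊗_H N`: the tensor factor
of `x` comes first, those of `w` follow. -/
def PBil.insR (B : PBil k H L M N) (q : ℕ) (x : L) : PT k H q M →ₗ[k] PT k H (q + 1) N :=
  PT.graft (Fin.cases 0 fun _ => 1) 1 Fin.succ (Fin.succ_injective q)
    (fun j => by refine Fin.cases ?_ (fun j => ?_) j <;> simp) (PBil.right B x)

/-- `w ↦ B (w, y)` for `w ∈ H^{⊗ q} ⊗_H L`, with values in `H^{⊗ (q+1)} ⊗_H N`: the tensor factors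
of `w` come first, that of `y` is last. -/
def PBil.insL (B : PBil k H L M N) (q : ℕ) (y : M) : PT k H q L →ₗ[k] PT k H (q + 1) N :=
  PT.graft (Fin.lastCases 1 fun _ => 0) 0 Fin.castSucc (Fin.castSucc_injective q)
    (fun j => by refine Fin.lastCases ?_ (fun j => ?_) j <;> simp) (PBil.left B y)

/-- `Ω : L ⊗ L → H^{⊗ 2} ⊗_H L` is a Lie pseudobracket: skew-commutativity and Jacobi identity. -/
def IsLiePseudo (Ω : PBil k H L L L) : Prop :=
  (∀ x y, Ω.1 x y = -PT.perm (Equiv.swap 0 1) (Ω.1 y x)) ∧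
  ∀ x y z, PBil.insR Ω 2 x (Ω.1 y z) =
    PBil.insL Ω 2 z (Ω.1 x y) + PT.perm (Equiv.swap 0 1) (PBil.insR Ω 2 y (Ω.1 x z))

/-- `ζ : L ⊗ M → H^{⊗ 2} ⊗_H M` is a representation of the Lie pseudoalgebra `(L, μ)` on `M`. -/
def IsRep (μ : PBil k H L L L) (ζ : PBil k H L M M) : Prop :=
  ∀ u v x, PBil.insL ζ 2 x (μ.1 u v) =
    PBil.insR ζ 2 u (ζ.1 v x) - PT.perm (Equiv.swap 0 1) (PBil.insR ζ 2 v (ζ.1 u x))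

/-- The action of permutations on polylinear maps:
`(x₀, …) ↦ (σ ⊗_H id) f (x_{σ 0}, x_{σ 1}, …)`. -/
def Poly.act {p : ℕ} (σ : Equiv.Perm (Fin p)) : Poly k H p L M →ₗ[k] Poly k H p L M where
  toFun f := Poly.ofFun (fun x => PT.perm σ (f.1 (x ∘ σ)))
    (fun x i v w => by
      have h1 : ∀ v, Function.update x i v ∘ σ = Function.update (x ∘ σ) (σ⁻¹ i) v := fun v => by
        rw [← Function.update_comp_eq_of_injective _ σ.injective]; simp
      rw [h1, h1, h1, MultilinearMap.map_update_add, map_add])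
    (fun x i h => by
      have h1 : ∀ v, Function.update x i v ∘ σ = Function.update (x ∘ σ) (σ⁻¹ i) v := fun v => by
        rw [← Function.update_comp_eq_of_injective _ σ.injective]; simp
      have h2 := f.2 (x ∘ σ) (σ⁻¹ i) h
      have h3 : (x ∘ σ) (σ⁻¹ i) = x i := by simp
      rw [h3] at h2
      rw [h1, h2, PT.perm_slot_smul]
      simp)
  map_add' f g := Subtype.ext (MultilinearMap.ext fun x => map_add (PT.perm σ) _ _)
  map_smul' c f := Subtype.ext (MultilinearMap.ext fun x => map_smul (PT.perm σ) _ _)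

variable (k H L M) in
/-- The space `C^p(L, M)` of `p`-cochains: the skew-symmetric `H^{⊗ p}`-linear maps
`L^{⊗ p} → H^{⊗ p} ⊗_H M`. -/
def Cochain (p : ℕ) : Submodule k (Poly k H p L M) where
  carrier := {f | ∀ σ : Equiv.Perm (Fin p), Poly.act σ f = (Equiv.Perm.sign σ : ℤ) • f}
  add_mem' := by
    intro f g hf hg σ
    rw [map_add, hf σ, hg σ, smul_add]
  zero_mem' := by intro σ; simp
  smul_mem' := by
    intro c f hf σ
    rw [map_smul, hf σ, smul_comm]

/-- Collapses the positions `0, …, n` to `0` and moves `n + t` to `t`. -/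
def collapse {m n r : ℕ} (hr : r = m + n) (j : Fin (r + 1)) : Fin (m + 1) :=
  ⟨j - n, by omega⟩

theorem collapse_eq_zero {m n r : ℕ} (hr : r = m + n) (j : Fin (r + 1)) :
    collapse hr j = 0 ↔ j ∈ Set.range (Fin.castLE (by omega : n + 1 ≤ r + 1)) := by
  simp only [collapse, Fin.ext_iff, Set.mem_range, Fin.val_zero, Fin.val_castLE]
  constructor
  · intro h
    exact ⟨⟨j, by omega⟩, rfl⟩
  · rintro ⟨y, hy⟩
    omega

/-- `w ↦ f (w, y₀, …, yₘ₋₁)` for `w ∈ H^{⊗ (n+1)} ⊗_H L`: the `n + 1` tensor factors of `w` come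
first, followed by those of the `yₜ`. -/
def Poly.ins {m n r : ℕ} (hr : r = m + n) (f : Poly k H (m + 1) L M) (y : Fin m → L) :
    PT k H (n + 1) L →ₗ[k] PT k H (r + 1) M :=
  PT.graft (collapse hr) 0 (Fin.castLE (by omega)) (Fin.castLE_injective _) (collapse_eq_zero hr)
    (Poly.first f y)

section
variable {m n r : ℕ} (hr : r = m + n)

/-- The position of the `t`-th argument of `f` after the `n + 1` arguments of `g`. -/
def tailIdx (t : Fin m) : Fin (r + 1) := ⟨n + 1 + t, by omega⟩

/-- The position of the `j`-th argument of `g`. -/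
def headIdx (j : Fin (n + 1)) : Fin (r + 1) := Fin.castLE (by omega) j
end

theorem Poly.ins_update_add {m n r : ℕ} (hr : r = m + n) (f : Poly k H (m + 1) L M) (y : Fin m → L)
    (t : Fin m) (v w : L) (z : PT k H (n + 1) L) :
    Poly.ins hr f (Function.update y t (v + w)) z = Poly.ins hr f (Function.update y t v) z +
      Poly.ins hr f (Function.update y t w) z := by
  have h1 : Poly.first f (Function.update y t (v + w)) =
      Poly.first f (Function.update y t v) + Poly.first f (Function.update y t w) := by
    refine Subtype.ext (LinearMap.ext fun x => ?_)
    change f.1 (Fin.cons x _) = f.1 (Fin.cons x _) + f.1 (Fin.cons x _)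
    rw [Fin.cons_update, Fin.cons_update, Fin.cons_update, MultilinearMap.map_update_add]
  rw [Poly.ins, h1, PT.graft_add]
  rfl

theorem Poly.ins_update_smul {m n r : ℕ} (hr : r = m + n) (f : Poly k H (m + 1) L M)
    (y : Fin m → L) (t : Fin m) (h : H) (z : PT k H (n + 1) L) :
    Poly.ins hr f (Function.update y t (h • y t)) z =
      slot k (tailIdx hr t) h • Poly.ins hr f y z := by
  have h1 : collapse hr (tailIdx hr t) = t.succ := by
    ext; simp only [collapse, tailIdx, Fin.val_succ]; omega
  refine PT.graft_slot_right _ _ _ _ _ (Poly.first f y) _ (tailIdx hr t) h ?_ ?_ ?_ z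
  · intro j'
    rw [h1]
    simp only [collapse, tailIdx, Fin.ext_iff, Fin.val_succ]
    omega
  · rw [h1]; exact Fin.succ_ne_zero t
  · intro x
    rw [h1]
    change f.1 (Fin.cons x _) = _ • f.1 (Fin.cons x _)
    rw [Fin.cons_update]
    have := f.2 (Fin.cons x y) t.succ h
    rwa [Fin.cons_succ] at this

theorem Poly.ins_slot_smul {m n r : ℕ} (hr : r = m + n) (f : Poly k H (m + 1) L M)
    (y : Fin m → L) (j : Fin (n + 1)) (h : H) (z : PT k H (n + 1) L) :
    Poly.ins hr f y (slot k j h • z) = slot k (headIdx hr j) h • Poly.ins hr f y z :=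
  PT.graft_slot_left _ _ _ _ _ _ j h z

section
variable {m n r : ℕ} (hr : r = m + n) {X : Type*}

theorem update_head (x : Fin (r + 1) → X) (j : Fin (n + 1)) (v : X) :
    (fun t => Function.update x (headIdx hr j) v (tailIdx hr t)) = (fun t => x (tailIdx hr t)) ∧
    (fun t => Function.update x (headIdx hr j) v (headIdx hr t)) =
      Function.update (fun t => x (headIdx hr t)) j v := by
  constructor
  · funext t
    refine Function.update_of_ne ?_ _ _
    simp only [tailIdx, headIdx, ne_eq, Fin.ext_iff, Fin.val_castLE]
    omega
  · exact Function.update_comp_eq_of_injective x (Fin.castLE_injective _) j v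

theorem update_tail (x : Fin (r + 1) → X) (t : Fin m) (v : X) :
    (fun s => Function.update x (tailIdx hr t) v (tailIdx hr s)) =
      Function.update (fun s => x (tailIdx hr s)) t v ∧
    (fun s => Function.update x (tailIdx hr t) v (headIdx hr s)) = (fun s => x (headIdx hr s)) := by
  constructor
  · refine Function.update_comp_eq_of_injective x (f := tailIdx hr) ?_ t v
    intro a b hab
    simp only [tailIdx, Fin.ext_iff] at hab
    ext
    omega
  · funext s
    refine Function.update_of_ne ?_ _ _
    simp only [tailIdx, headIdx, ne_eq, Fin.ext_iff, Fin.val_castLE]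
    omega

theorem head_or_tail (i : Fin (r + 1)) : (∃ j, i = headIdx hr j) ∨ ∃ t, i = tailIdx hr t := by
  by_cases h : i.val < n + 1
  · exact Or.inl ⟨⟨i, h⟩, rfl⟩
  · exact Or.inr ⟨⟨i - (n + 1), by omega⟩, by ext; simp only [tailIdx]; omega⟩

end

/-- Substitution of `g` into the first argument of `f`:
`(x₀, …, xᵣ) ↦ f (g (x₀, …, xₙ), xₙ₊₁, …, xᵣ)`. -/
def Poly.subst {m n r : ℕ} (hr : r = m + n) (f : Poly k H (m + 1) L M)
    (g : Poly k H (n + 1) L L) : Poly k H (r + 1) L M :=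
  Poly.ofFun (fun x => Poly.ins hr f (fun t => x (tailIdx hr t)) (g.1 fun j => x (headIdx hr j)))
    (fun x i v w => by
      rcases head_or_tail hr i with ⟨j, rfl⟩ | ⟨t, rfl⟩
      · simp only [(update_head hr x j _).1, (update_head hr x j _).2,
          MultilinearMap.map_update_add, map_add]
      · simp only [(update_tail hr x t _).1, (update_tail hr x t _).2, Poly.ins_update_add])
    (fun x i h => by
      rcases head_or_tail hr i with ⟨j, rfl⟩ | ⟨t, rfl⟩
      · simp only [(update_head hr x j _).1, (update_head hr x j _).2]
        rw [← Poly.ins_slot_smul]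
        exact congrArg _ (g.2 (fun t => x (headIdx hr t)) j h)
      · simp only [(update_tail hr x t _).1, (update_tail hr x t _).2]
        exact Poly.ins_update_smul hr f (fun s => x (tailIdx hr s)) t h _)

theorem Poly.subst_apply {m n r : ℕ} (hr : r = m + n) (f : Poly k H (m + 1) L M)
    (g : Poly k H (n + 1) L L) (x : Fin (r + 1) → L) : (Poly.subst hr f g).1 x =
      Poly.ins hr f (fun t => x (tailIdx hr t)) (g.1 fun j => x (headIdx hr j)) := rfl

theorem Poly.ins_add {m n r : ℕ} (hr : r = m + n) (f f' : Poly k H (m + 1) L M) (y : Fin m → L)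
    (z : PT k H (n + 1) L) : Poly.ins hr (f + f') y z = Poly.ins hr f y z + Poly.ins hr f' y z :=
  PT.graft_add _ _ _ _ _ (Poly.first f y) (Poly.first f' y) z

theorem Poly.ins_smul {m n r : ℕ} (hr : r = m + n) (c : k) (f : Poly k H (m + 1) L M)
    (y : Fin m → L) (z : PT k H (n + 1) L) : Poly.ins hr (c • f) y z = c • Poly.ins hr f y z :=
  PT.graft_smul _ _ _ _ _ c (Poly.first f y) z

/-- `Poly.subst` as a bilinear map. -/
def Poly.substₗ {m n r : ℕ} (hr : r = m + n) :
    Poly k H (m + 1) L M →ₗ[k] Poly k H (n + 1) L L →ₗ[k] Poly k H (r + 1) L M :=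
  LinearMap.mk₂ k (Poly.subst hr)
    (fun f f' _ => Subtype.ext (MultilinearMap.ext fun _ => Poly.ins_add hr f f' _ _))
    (fun c f _ => Subtype.ext (MultilinearMap.ext fun _ => Poly.ins_smul hr c f _ _))
    (fun f _ _ => Subtype.ext (MultilinearMap.ext fun _ => map_add (Poly.ins hr f _) _ _))
    (fun _ f _ => Subtype.ext (MultilinearMap.ext fun _ => map_smul (Poly.ins hr f _) _ _))

/-- The `(q, N - q)`-shuffles: the permutations that are increasing on `{0, …, q - 1}` and on
`{q, …, N - 1}`. -/
def shuffles (q N : ℕ) : Finset (Equiv.Perm (Fin N)) :=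
  Finset.univ.filter fun σ => ∀ a b : Fin N, a < b → (b.val < q ∨ q ≤ a.val) → σ a < σ b

/-- The circle product
`f ∘ g = ∑_{σ ∈ Sh(n+1, m)} sgn(σ) (σ ⊗_H id) f (g (x_{σ 0}, …, x_{σ n}), x_{σ (n+1)}, …)`. -/
def Poly.circ {m n r : ℕ} (hr : r = m + n) :
    Poly k H (m + 1) L M →ₗ[k] Poly k H (n + 1) L L →ₗ[k] Poly k H (r + 1) L M :=
  ∑ σ ∈ shuffles (n + 1) (r + 1), (Equiv.Perm.sign σ : ℤ) • (Poly.substₗ hr).compr₂ (Poly.act σ)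

/-- The Nijenhuis-Richardson bracket `[f, g] = f ∘ g - (-1)^{mn} g ∘ f` of polylinear maps `f`, `g`
of `m + 1` and `n + 1` arguments. -/
def Poly.nr {m n r : ℕ} (hr : r = m + n) :
    Poly k H (m + 1) L L →ₗ[k] Poly k H (n + 1) L L →ₗ[k] Poly k H (r + 1) L L :=
  Poly.circ (k := k) (H := H) (L := L) (M := L) hr -
    (-1 : ℤ) ^ (m * n) • (Poly.circ (k := k) (H := H) (L := L) (M := L) (hr.trans (Nat.add_comm m n))).flip

theorem PBil.insR_add (B : PBil k H L M N) (q : ℕ) (x x' : L) (z : PT k H q M) :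
    PBil.insR B q (x + x') z = PBil.insR B q x z + PBil.insR B q x' z := by
  have h1 : PBil.right B (x + x') = PBil.right B x + PBil.right B x' :=
    Subtype.ext (map_add B.1 x x')
  rw [PBil.insR, h1, PT.graft_add]
  rfl

theorem PBil.insR_smul (B : PBil k H L M N) (q : ℕ) (x : L) (h : H) (z : PT k H q M) :
    PBil.insR B q (h • x) z = slot k (0 : Fin (q + 1)) h • PBil.insR B q x z := by
  refine PT.graft_slot_right _ _ _ _ _ (PBil.right B x) _ 0 h ?_ ?_ ?_ z
  · intro j
    refine Fin.cases ?_ (fun j => ?_) j <;> simp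
  · simp
  · intro y
    exact PBil.smul_left B h x y

theorem PBil.insR_slot (B : PBil k H L M N) (q : ℕ) (x : L) (j : Fin q) (h : H) (z : PT k H q M) :
    PBil.insR B q x (slot k j h • z) = slot k j.succ h • PBil.insR B q x z :=
  PT.graft_slot_left _ _ _ _ _ _ j h z

/-- `(x₀, …, xₚ) ↦ ζ (x₀, f (x₁, …, xₚ))`. -/
def PBil.after (ζ : PBil k H L M N) {p : ℕ} : Poly k H p L M →ₗ[k] Poly k H (p + 1) L N where
  toFun f := Poly.ofFun (fun x => PBil.insR ζ p (x 0) (f.1 fun t => x t.succ))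
    (fun x i v w => by
      refine Fin.cases ?_ (fun i => ?_) i
      · have h1 : ∀ v, (fun t : Fin p => Function.update x 0 v t.succ) = fun t => x t.succ :=
          fun v => rfl
        simp only [Function.update_self, h1, PBil.insR_add]
      · have h1 : ∀ v, (fun t : Fin p => Function.update x i.succ v t.succ) =
            Function.update (fun t => x t.succ) i v := fun v =>
          Function.update_comp_eq_of_injective x (Fin.succ_injective p) i v
        rw [h1, h1, h1, MultilinearMap.map_update_add]
        exact map_add _ _ _)
    (fun x i h => by
      refine Fin.cases ?_ (fun i => ?_) i
      · have h1 : (fun t : Fin p => Function.update x 0 (h • x 0) t.succ) = fun t => x t.succ := rfl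
        rw [Function.update_self, h1, PBil.insR_smul]
      · have h1 : (fun t : Fin p => Function.update x i.succ (h • x i.succ) t.succ) =
            Function.update (fun t => x t.succ) i (h • x i.succ) :=
          Function.update_comp_eq_of_injective x (Fin.succ_injective p) i _
        rw [h1, ← PBil.insR_slot]
        exact congrArg _ (f.2 (fun t => x t.succ) i h))
  map_add' f g := Subtype.ext (MultilinearMap.ext fun x => map_add (PBil.insR ζ p (x 0)) _ _)
  map_smul' c f := Subtype.ext (MultilinearMap.ext fun x => map_smul (PBil.insR ζ p (x 0)) _ _)

/-- The Chevalley-Eilenberg coboundary of the Lie pseudoalgebra `(L, μ)` with coefficients in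
`(M, ζ)`:
`d f (u₀, …, uₚ) = ∑ᵢ (-1)^i ζ (uᵢ, f (u₀, …, ûᵢ, …, uₚ))
  + ∑_{i < j} (-1)^{i+j} f (μ (uᵢ, uⱼ), u₀, …, ûᵢ, …, ûⱼ, …, uₚ)`,
where in each summand the permutation of the tensor factors that restores the order `u₀, …, uₚ`
is applied.  The permutation `i.cycleRange.symm` is `(i, 0, …, î, …, p)`, and the second sum is
indexed by the permutations `(i, j, 0, …, î, …, ĵ, …, p)` with `i < j`, i.e. by the
`(2, p - 1)`-shuffles. -/
def ceD (μ : PBil k H L L L) (ζ : PBil k H L M M) :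
    (p : ℕ) → Poly k H p L M →ₗ[k] Poly k H (p + 1) L M
  | 0 => PBil.after ζ
  | m + 1 =>
    ∑ i : Fin (m + 2), (-1 : ℤ) ^ (i : ℕ) • Poly.act i.cycleRange.symm ∘ₗ PBil.after ζ +
    ∑ σ ∈ shuffles 2 (m + 2), (-1 : ℤ) ^ ((σ 0 : ℕ) + (σ 1 : ℕ)) •
      Poly.act σ ∘ₗ (Poly.substₗ (m := m) (n := 1) rfl).flip (PBil.toPoly μ)

/-- The cocycles `Z^p(L, M)` of the Lie pseudoalgebra `(L, μ)` with coefficients in `(M, ζ)`. -/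
def ceCocycles (μ : PBil k H L L L) (ζ : PBil k H L M M) (p : ℕ) : Submodule k (Poly k H p L M) :=
  Cochain k H L M p ⊓ LinearMap.ker (ceD μ ζ p)

/-- The coboundaries `B^p(L, M)`. -/
def ceCoboundaries (μ : PBil k H L L L) (ζ : PBil k H L M M) :
    (p : ℕ) → Submodule k (Poly k H p L M)
  | 0 => ⊥
  | p + 1 => (Cochain k H L M p).map (ceD μ ζ p)

/-- The Chevalley-Eilenberg cohomology `Z^p(L, M) / B^p(L, M)`. -/
abbrev CECohomology (μ : PBil k H L L L) (ζ : PBil k H L M M) (p : ℕ) : Type _ :=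
  ceCocycles μ ζ p ⧸ (ceCoboundaries μ ζ p).submoduleOf (ceCocycles μ ζ p)

end Operations

section QuasiTwilled

variable {k H : Type*} [Field k] [Ring H] [HopfAlgebra k H] [Coalgebra.IsCocomm k H]
variable {𝔤 𝔥 : Type*}
  [AddCommGroup 𝔤] [Module k 𝔤] [Module H 𝔤] [IsScalarTower k H 𝔤]
  [AddCommGroup 𝔥] [Module k 𝔥] [Module H 𝔥] [IsScalarTower k H 𝔥]

/-- A Lie pseudobracket `Ω` on `𝔤 × 𝔥` makes `(𝔤 × 𝔥, 𝔤, 𝔥)` a quasi-twilled Lie pseudoalgebra if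
`𝔥` is a subalgebra. -/
def IsQuasiTwilled (Ω : PBil k H (𝔤 × 𝔥) (𝔤 × 𝔥) (𝔤 × 𝔥)) : Prop :=
  IsLiePseudo Ω ∧ ∀ u v : 𝔥, PT.map (LinearMap.fst H 𝔤 𝔥) (Ω.1 (0, u) (0, v)) = 0

section Components

variable (Ω : PBil k H (𝔤 × 𝔥) (𝔤 × 𝔥) (𝔤 × 𝔥))

/-- The component `π : 𝔤 ⊗ 𝔤 → H^{⊗ 2} ⊗_H 𝔤` of `Ω`. -/
def cmpPi : PBil k H 𝔤 𝔤 𝔤 :=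
  PBil.map (LinearMap.fst H 𝔤 𝔥) (PBil.comp Ω (LinearMap.inl H 𝔤 𝔥) (LinearMap.inl H 𝔤 𝔥))

/-- The component `ρ : 𝔤 ⊗ 𝔥 → H^{⊗ 2} ⊗_H 𝔥` of `Ω`. -/
def cmpRho : PBil k H 𝔤 𝔥 𝔥 :=
  PBil.map (LinearMap.snd H 𝔤 𝔥) (PBil.comp Ω (LinearMap.inl H 𝔤 𝔥) (LinearMap.inr H 𝔤 𝔥))

/-- The component `μ : 𝔥 ⊗ 𝔥 → H^{⊗ 2} ⊗_H 𝔥` of `Ω`. -/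
def cmpMu : PBil k H 𝔥 𝔥 𝔥 :=
  PBil.map (LinearMap.snd H 𝔤 𝔥) (PBil.comp Ω (LinearMap.inr H 𝔤 𝔥) (LinearMap.inr H 𝔤 𝔥))

/-- The component `η : 𝔤 ⊗ 𝔥 → H^{⊗ 2} ⊗_H 𝔤` of `Ω`. -/
def cmpEta : PBil k H 𝔤 𝔥 𝔤 :=
  PBil.map (LinearMap.fst H 𝔤 𝔥) (PBil.comp Ω (LinearMap.inl H 𝔤 𝔥) (LinearMap.inr H 𝔤 𝔥))

/-- The component `θ : 𝔤 ⊗ 𝔤 → H^{⊗ 2} ⊗_H 𝔥` of `Ω`. -/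
def cmpTheta : PBil k H 𝔤 𝔤 𝔥 :=
  PBil.map (LinearMap.snd H 𝔤 𝔥) (PBil.comp Ω (LinearMap.inl H 𝔤 𝔥) (LinearMap.inl H 𝔤 𝔥))

/-- `T : 𝔥 → 𝔤` is a deformation map of type II. -/
def IsDMap (T : 𝔥 →ₗ[H] 𝔤) : Prop := ∀ u v : 𝔥,
  (cmpPi Ω).1 (T u) (T v) + (cmpEta Ω).1 (T u) v
      - PT.perm (Equiv.swap 0 1) ((cmpEta Ω).1 (T v) u) =
    PT.map T ((cmpRho Ω).1 (T u) v - PT.perm (Equiv.swap 0 1) ((cmpRho Ω).1 (T v) u)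
      + (cmpMu Ω).1 u v + (cmpTheta Ω).1 (T u) (T v))

/-- `μ^T (u, v) = μ (u, v) + ρ (T u, v) - (12) ρ (T v, u) + θ (T u, T v)`. -/
def muT (T : 𝔥 →ₗ[H] 𝔤) : PBil k H 𝔥 𝔥 𝔥 :=
  cmpMu Ω + PBil.comp (cmpRho Ω) T LinearMap.id
    - PBil.swap (PBil.comp (cmpRho Ω) T LinearMap.id) + PBil.comp (cmpTheta Ω) T T

/-- `ζ (v, x) = (12) (-η (x, v) - π (x, T v) + T ρ (x, v) - T (12) θ (T v, x))`. -/
def zeta (T : 𝔥 →ₗ[H] 𝔤) : PBil k H 𝔥 𝔤 𝔤 :=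
  PBil.swap (-cmpEta Ω - PBil.comp (cmpPi Ω) LinearMap.id T + PBil.map T (cmpRho Ω)
    - PBil.map T (PBil.swap (PBil.comp (cmpTheta Ω) T LinearMap.id)))

/-! The components as polylinear maps of two arguments in `𝔤 × 𝔥`, extended by zero and, for the
mixed components, skew-symmetrically. -/

/-- `((x, u), (y, v)) ↦ (π (x, y), 0)`. -/
def liftPi : Poly k H 2 (𝔤 × 𝔥) (𝔤 × 𝔥) :=
  PBil.toPoly (PBil.map (LinearMap.inl H 𝔤 𝔥)
    (PBil.comp (cmpPi Ω) (LinearMap.fst H 𝔤 𝔥) (LinearMap.fst H 𝔤 𝔥)))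

/-- `((x, u), (y, v)) ↦ (0, ρ (x, v) - (12) ρ (y, u))`. -/
def liftRho : Poly k H 2 (𝔤 × 𝔥) (𝔤 × 𝔥) :=
  let R := PBil.map (LinearMap.inr H 𝔤 𝔥)
    (PBil.comp (cmpRho Ω) (LinearMap.fst H 𝔤 𝔥) (LinearMap.snd H 𝔤 𝔥))
  PBil.toPoly (R - PBil.swap R)

/-- `((x, u), (y, v)) ↦ (0, μ (u, v))`. -/
def liftMu : Poly k H 2 (𝔤 × 𝔥) (𝔤 × 𝔥) :=
  PBil.toPoly (PBil.map (LinearMap.inr H 𝔤 𝔥)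
    (PBil.comp (cmpMu Ω) (LinearMap.snd H 𝔤 𝔥) (LinearMap.snd H 𝔤 𝔥)))

/-- `((x, u), (y, v)) ↦ (η (x, v) - (12) η (y, u), 0)`. -/
def liftEta : Poly k H 2 (𝔤 × 𝔥) (𝔤 × 𝔥) :=
  let E := PBil.map (LinearMap.inl H 𝔤 𝔥)
    (PBil.comp (cmpEta Ω) (LinearMap.fst H 𝔤 𝔥) (LinearMap.snd H 𝔤 𝔥))
  PBil.toPoly (E - PBil.swap E)

/-- `((x, u), (y, v)) ↦ (0, θ (x, y))`. -/
def liftTheta : Poly k H 2 (𝔤 × 𝔥) (𝔤 × 𝔥) :=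
  PBil.toPoly (PBil.map (LinearMap.inr H 𝔤 𝔥)
    (PBil.comp (cmpTheta Ω) (LinearMap.fst H 𝔤 𝔥) (LinearMap.fst H 𝔤 𝔥)))

end Components

variable (k H 𝔤 𝔥) in
/-- The embedding of the polylinear maps from `𝔥` to `𝔤` into those of `𝔤 × 𝔥`:
`((x₀, u₀), …) ↦ (f (u₀, …), 0)`. -/
def liftHG (p : ℕ) : Poly k H p 𝔥 𝔤 →ₗ[k] Poly k H p (𝔤 × 𝔥) (𝔤 × 𝔥) :=
  Poly.conj (LinearMap.snd H 𝔤 𝔥) (LinearMap.inl H 𝔤 𝔥)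

variable (Ω : PBil k H (𝔤 × 𝔥) (𝔤 × 𝔥) (𝔤 × 𝔥))

/-- `l₁ (f) = [μ + η, f]`. -/
def l1 (n : ℕ) : Poly k H (n + 1) 𝔥 𝔤 →ₗ[k] Poly k H (n + 2) (𝔤 × 𝔥) (𝔤 × 𝔥) :=
  Poly.nr (by omega) (liftMu Ω + liftEta Ω) ∘ₗ liftHG k H 𝔤 𝔥 (n + 1)

/-- `l₂ (f, g) = [[π + ρ, f], g]`, where `f` and `g` have `a + 1` and `b + 1` arguments. -/
def l2 {a b r : ℕ} (hr : r = 1 + a + b) (f : Poly k H (a + 1) 𝔥 𝔤) :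
    Poly k H (b + 1) 𝔥 𝔤 →ₗ[k] Poly k H (r + 1) (𝔤 × 𝔥) (𝔤 × 𝔥) :=
  Poly.nr hr (Poly.nr rfl (liftPi Ω + liftRho Ω) (liftHG k H 𝔤 𝔥 _ f)) ∘ₗ liftHG k H 𝔤 𝔥 (b + 1)

/-- `l₃ (f, g, h) = [[[θ, f], g], h]`, where `f`, `g`, `h` have `a + 1`, `b + 1`, `c + 1`
arguments. -/
def l3 {a b c r : ℕ} (hr : r = 1 + a + b + c) (f : Poly k H (a + 1) 𝔥 𝔤)
    (g : Poly k H (b + 1) 𝔥 𝔤) :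
    Poly k H (c + 1) 𝔥 𝔤 →ₗ[k] Poly k H (r + 1) (𝔤 × 𝔥) (𝔤 × 𝔥) :=
  Poly.nr hr (Poly.nr rfl (Poly.nr rfl (liftTheta Ω) (liftHG k H 𝔤 𝔥 _ f))
    (liftHG k H 𝔤 𝔥 _ g)) ∘ₗ liftHG k H 𝔤 𝔥 (c + 1)

/-- The twisted operation `l₁^T (f) = l₁ (f) + l₂ (T, f) + ½ l₃ (T, T, f)`. -/
def l1T (T : 𝔥 →ₗ[H] 𝔤) (n : ℕ) :
    Poly k H (n + 1) 𝔥 𝔤 →ₗ[k] Poly k H (n + 2) (𝔤 × 𝔥) (𝔤 × 𝔥) :=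
  l1 Ω n + l2 Ω (by omega) (Poly.ofHom T) +
    (1 / 2 : k) • l3 Ω (by omega) (Poly.ofHom T) (Poly.ofHom T)

/-- The cocycles of degree `n` of the complex `(⨁ₙ C^{n+1}(𝔥, 𝔤), l₁^T)`. -/
def twCocycles (T : 𝔥 →ₗ[H] 𝔤) (n : ℕ) : Submodule k (Poly k H (n + 1) 𝔥 𝔤) :=
  Cochain k H 𝔥 𝔤 (n + 1) ⊓ LinearMap.ker (l1T Ω T n)

/-- The coboundaries of degree `n` of the complex `(⨁ₙ C^{n+1}(𝔥, 𝔤), l₁^T)`. -/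
def twCoboundaries (T : 𝔥 →ₗ[H] 𝔤) : (n : ℕ) → Submodule k (Poly k H (n + 1) 𝔥 𝔤)
  | 0 => ⊥
  | n + 1 => ((Cochain k H 𝔥 𝔤 (n + 1)).map (l1T Ω T n)).comap (liftHG k H 𝔤 𝔥 (n + 2))

/-- The cohomology of the complex `(⨁ₙ C^{n+1}(𝔥, 𝔤), l₁^T)` in degree `n`. -/
abbrev TwCohomology (T : 𝔥 →ₗ[H] 𝔤) (n : ℕ) : Type _ :=
  twCocycles Ω T n ⧸ (twCoboundaries Ω T n).submoduleOf (twCocycles Ω T n)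

end QuasiTwilled
end

end LiePseudo

namespace LiePseudo

open scoped TensorProduct
open WithConv

noncomputable section

set_option linter.unusedSectionVars false

/-! ### Algebra maps between tensor powers, as relations between positions. -/

section TensorPowerHoms

variable {k H : Type*} [Field k] [Ring H] [HopfAlgebra k H]

/-! Claim 1 comes from a change of coordinates. The map (x, u) ↦ (x + Tu, u) is an H-linear
automorphism of 𝔤 × 𝔥 that carries 𝔥 onto the graph of T. The equation for a deformation map of type
II says that this graph is closed under Ω, that is, that 𝔥 is a subalgebra for the transported
bracket `twistBy Ω T`. A subalgebra is a Lie pseudoalgebra and acts on the quotient by it, here (𝔤 ×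
𝔥)/𝔥 = 𝔤. This bracket and this action are μ^T and ζ (`muT_eq_cmpMu_twistBy`, `zeta_eq_twistBy`,
`IsLiePseudo.subalgebra_and_quotient`), so the Jacobi identity of Ω never has to be expanded in
components.

For the complex, write Zf = ζ(x₀, f(x₁, …)) and Bf = f(μ(x₀, x₁), x₂, …), and let Alt be the full
signed sum over permutations. In characteristic 0, on cochains of m + 1 arguments, df =
Alt(Zf)/(m+1)! - Alt(Bf)/(2·m!) (`ceD_eq_alt`), which makes df skew at once. In d(df) the inner
alternations are absorbed by the outer ones. What remains is: Alt BZf = 2 Alt ZZf, which is the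
representation identity; the substitution of μ into an argument of f inside Zf, which gives Alt ZBf;
and the vanishing of Alt B Alt Bf. The last holds because nested brackets cancel by Jacobi
(`IsLiePseudo.alt_subst_subst`), while two brackets in different arguments of f cancel because an
even permutation exchanges them and f is skew (`Poly.alt_subst_act_swap_subst`). The scalars then
cancel in `ceD_ceD`.

For the comparison, linearity turns l₁^T into a single bracket with μ + η + [π + ρ, T] + ½[[θ, T],
T]. By `twisted_bracket_eq_semidirect` this is the semidirect product bracket of μ^T and ζ, and the
two halves of the Nijenhuis–Richardson bracket with it are the two sums in d, up to the sign
(`nr_semidirect_liftHG`). The embedding of cochains is injective and the sign is invertible, so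
cocycles, coboundaries and cohomology agree.

Underneath lies the bookkeeping of tensor factors. Because H is cocommutative, an algebra map that
spreads factors by coproducts is determined by which positions each factor reaches (`Spreads.ext`).
Hence each compatibility of insertions reduces to an identity between maps of finite sets. -/

theorem tn_algHom_ext {m : ℕ} {A : Type*} [Ring A] [Algebra k A] {G G' : Tn k H m →ₐ[k] A}
    (h : ∀ i x, G (slot k i x) = G' (slot k i x)) : G = G' :=
  PiTensorProduct.algHom_ext fun i => AlgHom.ext fun x => h i x

/-- The algebra map `G : H^{⊗ m} → H^{⊗ n}` spreads the `i`-th tensor factor by the iterated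
coproduct over the positions `j` with `R i j`. -/
def Spreads {m n : ℕ} (G : Tn k H m →ₐ[k] Tn k H n) (R : Fin m → Fin n → Prop) : Prop :=
  ∀ i, ∃ l : List (Fin n), l.Nodup ∧ (∀ j, j ∈ l ↔ R i j) ∧ ∀ h, G (slot k i h) = cop l h

theorem spreads_delta {m n : ℕ} (φ : Fin n → Fin m) :
    Spreads (delta (k := k) (H := H) φ) fun i j => φ j = i :=
  fun i => ⟨fib φ i, fib_nodup φ i, fun j => mem_fib φ i j, delta_slot φ i⟩

theorem spreads_emb {q n : ℕ} (e : Fin q → Fin n) (he : Function.Injective e) :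
    Spreads (emb (k := k) (H := H) e he) fun i j => j = e i :=
  fun i => ⟨[e i], by simp, by simp, fun h => by rw [emb_slot, cop_singleton]⟩

theorem emb_id {m : ℕ} (a : Tn k H m) : emb (k := k) id Function.injective_id a = a := by
  refine DFunLike.congr_fun (g := AlgHom.id k (Tn k H m)) (tn_algHom_ext fun i x => ?_) a
  rw [emb_slot]; rfl

theorem commute_algHom {m n : ℕ} (G : Tn k H m →ₐ[k] Tn k H n) (c : Tn k H n)
    (hc : ∀ i h, Commute c (G (slot k i h))) (a : Tn k H m) : Commute c (G a) := by
  induction a using PiTensorProduct.induction_on with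
  | smul_tprod r x =>
    rw [map_smul]
    refine Commute.smul_right ?_ _
    have h1 : PiTensorProduct.tprod k x = (List.ofFn fun i => slot k i (x i)).prod := by
      -- Seen through the identity embedding, the pure tensor is a value of `tnLift`, which is an
      -- ordered product of slots by construction.
      conv_lhs => rw [← emb_id (PiTensorProduct.tprod k x)]
      exact tnLift_tprod _ _ _
    rw [h1, map_list_prod]
    refine Commute.list_prod_right _ _ fun y hy => ?_
    obtain ⟨z, hz, rfl⟩ := List.mem_map.1 hy
    obtain ⟨i, rfl⟩ := (List.mem_ofFn' _ _).1 hz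
    exact hc _ _
  | add x y hx hy => rw [map_add]; exact hx.add_right hy

/-- H need not be commutative, but elements supported on disjoint sets of positions commute. This is
what allows two tensors inserted at different places to be exchanged. -/
theorem Spreads.commute {m m' n : ℕ} {G : Tn k H m →ₐ[k] Tn k H n}
    {G' : Tn k H m' →ₐ[k] Tn k H n} {R R'} (hG : Spreads G R) (hG' : Spreads G' R')
    (hd : ∀ i i' j, R i j → ¬ R' i' j) (a : Tn k H m) (b : Tn k H m') :
    Commute (G a) (G' b) := by
  refine (commute_algHom G _ (fun i h => (commute_algHom G' _ (fun i' h' => ?_) b).symm) a).symm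
  obtain ⟨l, -, hl, e1⟩ := hG i
  obtain ⟨l', -, hl', e2⟩ := hG' i'
  rw [e1, e2]
  exact cop_commute_cop _ _ (fun j hj hj' => hd i i' j ((hl j).1 hj) ((hl' j).1 hj')) _ _

variable [Coalgebra.IsCocomm k H]

/-- Coassociativity turns a coproduct of coproducts into the coproduct over the concatenated list of
positions. The hypothesis `hd` keeps the concatenated lists disjoint. -/
theorem Spreads.comp {m n p : ℕ} {G : Tn k H m →ₐ[k] Tn k H n} {G' : Tn k H n →ₐ[k] Tn k H p}
    {R R'} (hG : Spreads G R) (hG' : Spreads G' R') (hd : ∀ i i' j, R' i j → R' i' j → i = i') :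
    Spreads (G'.comp G) fun i j => ∃ t, R i t ∧ R' t j := by
  intro i
  choose F hF1 hF2 hF3 using hG'
  obtain ⟨l, hl1, hl2, hl3⟩ := hG i
  refine ⟨l.flatMap F, ?_, fun j => ?_, fun h => ?_⟩
  · rw [List.nodup_flatMap]
    refine ⟨fun i _ => hF1 i, hl1.imp fun hij j hj hj' => hij ?_⟩
    exact hd _ _ j ((hF2 _ _).1 hj) ((hF2 _ _).1 hj')
  · simp [List.mem_flatMap, hl2, hF2]
  · rw [AlgHom.comp_apply, hl3, algHom_cop _ _ hF3]

/-- Cocommutativity enters here: the iterated coproduct over a list of distinct positions depends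
only on the set of these positions. -/
theorem Spreads.ext {m n : ℕ} {G G' : Tn k H m →ₐ[k] Tn k H n}
    {R R'} (hG : Spreads G R) (hG' : Spreads G' R') (h : ∀ i j, R i j ↔ R' i j) : G = G' := by
  refine tn_algHom_ext fun i x => ?_
  obtain ⟨l, h1, h2, h3⟩ := hG i
  obtain ⟨l', h1', h2', h3'⟩ := hG' i
  rw [h3, h3']
  exact DFunLike.congr_fun (cop_perm h1 ((List.perm_ext_iff_of_nodup h1 h1').2 fun j => by
    rw [h2, h2', h])) x

theorem delta_delta {m n p : ℕ} (φ : Fin n → Fin m) (ψ : Fin p → Fin n) (a : Tn k H m) :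
    delta (k := k) ψ (delta φ a) = delta (fun j => φ (ψ j)) a := by
  refine DFunLike.congr_fun (f := (delta ψ).comp (delta φ)) ?_ a
  exact ((spreads_delta φ).comp (spreads_delta ψ) (fun i i' j h h' => h.symm.trans h')).ext
    (spreads_delta _) (by simp)

theorem delta_id {m : ℕ} (a : Tn k H m) : delta (k := k) (fun j : Fin m => j) a = a := by
  refine DFunLike.congr_fun (g := AlgHom.id k (Tn k H m)) ?_ a
  refine (spreads_delta _).ext (R' := fun i j => j = i) (fun i => ⟨[i], by simp, by simp,
    fun h => ?_⟩) (by simp)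
  rw [cop_singleton]; rfl

theorem emb_emb {m n p : ℕ} (e : Fin m → Fin n) (he) (ε : Fin n → Fin p) (hε)
    (e' : Fin m → Fin p) (he') (h : ∀ s, e' s = ε (e s)) (a : Tn k H m) :
    emb (k := k) ε hε (emb e he a) = emb e' he' a := by
  refine DFunLike.congr_fun (f := (emb ε hε).comp (emb e he)) ?_ a
  refine ((spreads_emb e he).comp (spreads_emb ε hε) ?_).ext (spreads_emb _ _) (by simp [h])
  rintro i i' j rfl h'
  exact hε h'

/-- Base change. The hypothesis says that the fibre of `ψ'` over `e s` is the image under `e'` of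
the fibre of `ψ` over `s`, so both composites spread factor `s` over the same positions. -/
theorem delta_emb {q q' n n' : ℕ} (e : Fin q → Fin n) (he) (e' : Fin q' → Fin n') (he')
    (ψ : Fin q' → Fin q) (ψ' : Fin n' → Fin n)
    (h : ∀ s t, ψ' t = e s ↔ ∃ s', t = e' s' ∧ ψ s' = s) (a : Tn k H q) :
    delta (k := k) ψ' (emb e he a) = emb e' he' (delta ψ a) := by
  refine DFunLike.congr_fun (f := (delta ψ').comp (emb e he)) (g := (emb e' he').comp (delta ψ))
    ?_ a
  refine ((spreads_emb e he).comp (spreads_delta ψ') (fun i i' j h h' => h.symm.trans h')).ext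
    ((spreads_delta ψ).comp (spreads_emb e' he') ?_) ?_
  · rintro i i' j rfl h'
    exact he' h'
  · intro i j
    simp only [exists_eq_left, h]
    exact exists_congr fun s => and_comm

theorem delta_emb' {q n n' : ℕ} (e : Fin q → Fin n) (he) (e' : Fin q → Fin n') (he')
    (ψ' : Fin n' → Fin n) (h : ∀ s t, ψ' t = e s ↔ t = e' s) (a : Tn k H q) :
    delta (k := k) ψ' (emb e he a) = emb e' he' a := by
  rw [delta_emb e he e' he' (fun s => s) ψ' (by simpa using h), delta_id]

end TensorPowerHoms

/-! ### Naturality, associativity and commutation of insertions. -/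

section PullGraft

variable {k H : Type*} [Field k] [Ring H] [HopfAlgebra k H]
variable {M N M' N' M₁ : Type*} [AddCommGroup M] [Module k M] [Module H M]
  [AddCommGroup N] [Module k N] [Module H N]
  [AddCommGroup M'] [Module k M'] [Module H M']
  [AddCommGroup N'] [Module k N'] [Module H N']
  [AddCommGroup M₁] [Module k M₁] [Module H M₁]

section
variable [IsScalarTower k H M] [IsScalarTower k H N] [IsScalarTower k H N']

theorem PT.map_map {n : ℕ} (S : N →ₗ[H] N') (T : M →ₗ[H] N) (z : PT k H n M) :
    PT.map S (PT.map T z) = PT.map (S ∘ₗ T) z := by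
  induction z using PT.induction with
  | h0 => simp
  | hmk a x => simp [PT.map_mk]
  | hadd z w hz hw => simp only [map_add, hz, hw]

theorem PT.map_id {n : ℕ} (z : PT k H n M) : PT.map LinearMap.id z = z := by
  induction z using PT.induction with
  | h0 => simp
  | hmk a x => simp [PT.map_mk]
  | hadd z w hz hw => simp only [map_add, hz, hw]

theorem PT.mk_add {n : ℕ} (a : Tn k H n) (x y : M) : PT.mk a (x + y) = PT.mk a x + PT.mk a y :=
  congrArg Submodule.Quotient.mk (TensorProduct.tmul_add _ x y)

theorem PT.mk_zero {n : ℕ} (a : Tn k H n) : PT.mk a (0 : M) = 0 := by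
  have := PT.mk_add a (0 : M) 0
  simpa using this

theorem PT.map_add_hom {n : ℕ} (S T : M →ₗ[H] N) (z : PT k H n M) :
    PT.map (S + T) z = PT.map S z + PT.map T z := by
  induction z using PT.induction with
  | h0 => simp
  | hmk a x => simp [PT.map_mk, PT.mk_add]
  | hadd z w hz hw => simp only [map_add, hz, hw]; abel

theorem PT.map_zero_hom {n : ℕ} (z : PT k H n M) : PT.map (0 : M →ₗ[H] N) z = 0 := by
  induction z using PT.induction with
  | h0 => simp
  | hmk a x => simp [PT.map_mk, PT.mk_zero]
  | hadd z w hz hw => simp only [map_add, hz, hw, add_zero]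

end

variable [Coalgebra.IsCocomm k H]

theorem PT.pull_mk {m n : ℕ} (φ : Fin n → Fin m) (a : Tn k H m) (x : M) :
    PT.pull (k := k) (H := H) φ (PT.mk a x) = PT.mk (delta φ a) x := by
  refine (PT.liftₗ_mk _ _ _ a x).trans ?_
  rw [PT.unit_apply, PT.smul_mk, mul_one]

theorem PT.pull_pull {m n p : ℕ} (φ : Fin n → Fin m) (ψ : Fin p → Fin n) (z : PT k H m M) :
    PT.pull (k := k) (H := H) ψ (PT.pull (k := k) (H := H) φ z) =
      PT.pull (k := k) (H := H) (fun j => φ (ψ j)) z := by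
  induction z using PT.induction with
  | h0 => simp
  | hmk a x => simp only [PT.pull_mk, delta_delta]
  | hadd z w hz hw => simp only [map_add, hz, hw]

theorem PT.pull_id {m : ℕ} (z : PT k H m M) :
    PT.pull (k := k) (H := H) (fun j : Fin m => j) z = z := by
  induction z using PT.induction with
  | h0 => simp
  | hmk a x => simp only [PT.pull_mk, delta_id]
  | hadd z w hz hw => simp only [map_add, hz, hw]

theorem PT.map_pull [IsScalarTower k H M] [IsScalarTower k H N] {m n : ℕ} (T : M →ₗ[H] N)
    (φ : Fin n → Fin m) (z : PT k H m M) : PT.map T (PT.pull (k := k) (H := H) φ z) =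
      PT.pull (k := k) (H := H) φ (PT.map T z) := by
  induction z using PT.induction with
  | h0 => simp
  | hmk a x => simp only [PT.pull_mk, PT.map_mk]
  | hadd z w hz hw => simp only [map_add, hz, hw]

theorem PT.map_perm [IsScalarTower k H M] [IsScalarTower k H N] {m : ℕ} (T : M →ₗ[H] N)
    (σ : Equiv.Perm (Fin m)) (z : PT k H m M) :
    PT.map T (PT.perm σ z) = PT.perm σ (PT.map T z) := PT.map_pull T _ z

theorem PT.perm_mul {m : ℕ} (σ τ : Equiv.Perm (Fin m)) (z : PT k H m M) :
    PT.perm (σ * τ) z = PT.perm σ (PT.perm τ z) := by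
  unfold PT.perm
  rw [PT.pull_pull]
  rfl

theorem PT.perm_one {m : ℕ} (z : PT k H m M) : PT.perm (1 : Equiv.Perm (Fin m)) z = z :=
  PT.pull_id z

theorem PT.perm_swap_swap {m : ℕ} (i j : Fin m) (z : PT k H m M) :
    PT.perm (Equiv.swap i j) (PT.perm (Equiv.swap i j) z) = z := by
  rw [← PT.perm_mul, Equiv.swap_mul_self, PT.perm_one]

/-- Naturality of insertion in the inserted element. -/
theorem PT.graft_pull {q q' m n n' : ℕ} {φ : Fin n → Fin m} {i : Fin m} {e : Fin q → Fin n}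
    {he hφ} {φ' : Fin n' → Fin m} {e' : Fin q' → Fin n'} {he' hφ'} (B : SlotHom k H m i M N)
    (ψ : Fin q' → Fin q) (ψ' : Fin n' → Fin n) (h1 : ∀ t, φ (ψ' t) = φ' t)
    (h2 : ∀ s, ψ' (e' s) = e (ψ s)) (z : PT k H q M) :
    PT.graft φ' i e' he' hφ' B (PT.pull (k := k) (H := H) ψ z) =
      PT.pull (k := k) (H := H) ψ' (PT.graft φ i e he hφ B z) := by
  induction z using PT.induction with
  | h0 => simp
  | hmk a x =>
    rw [PT.pull_mk, PT.graft_mk, PT.graft_mk, PT.pull_smul, PT.pull_pull,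
      delta_emb e he e' he' ψ ψ', funext h1]
    intro s t
    constructor
    · intro h
      have h3 : φ' t = i := by rw [← h1, h, hφ]; exact ⟨s, rfl⟩
      obtain ⟨s', rfl⟩ := (hφ' t).1 h3
      exact ⟨s', rfl, he ((h2 s').symm.trans h)⟩
    · rintro ⟨s', rfl, rfl⟩
      exact h2 s'
  | hadd z w hz hw => simp only [map_add, hz, hw]

theorem PT.graft_reindex {q m n n' : ℕ} {φ : Fin n → Fin m} {i : Fin m} {e : Fin q → Fin n}
    {he hφ} {φ' : Fin n' → Fin m} {e' : Fin q → Fin n'} {he' hφ'} (B : SlotHom k H m i M N)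
    (ψ' : Fin n' → Fin n) (h1 : ∀ t, φ (ψ' t) = φ' t)
    (h2 : ∀ s, ψ' (e' s) = e s) (z : PT k H q M) :
    PT.graft φ' i e' he' hφ' B z =
      PT.pull (k := k) (H := H) ψ' (PT.graft φ i e he hφ B z) := by
  rw [← PT.graft_pull (φ' := φ') (e' := e') (he' := he') (hφ' := hφ') B (fun s => s) ψ' h1 h2,
    PT.pull_id]

/-- Insertion into an operation of the form `(Δ^ψ ⊗_H id) ∘ B`. -/
theorem PT.graft_of_pull {q m m' n : ℕ} {φ : Fin n → Fin m} {i : Fin m} {e : Fin q → Fin n}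
    {he hφ} {φ' : Fin n → Fin m'} {i' : Fin m'} {hφ'} {B : SlotHom k H m i M N}
    {B' : SlotHom k H m' i' M N} (ψ : Fin m' → Fin m) (h : ∀ t, ψ (φ' t) = φ t)
    (hB : ∀ x, B'.1 x = PT.pull (k := k) (H := H) ψ (B.1 x)) (z : PT k H q M) :
    PT.graft φ' i' e he hφ' B' z = PT.graft φ i e he hφ B z := by
  induction z using PT.induction with
  | h0 => simp
  | hmk a x => rw [PT.graft_mk, PT.graft_mk, hB, PT.pull_pull, funext h]
  | hadd z w hz hw => simp only [map_add, hz, hw]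

/-- Associativity of insertion. -/
theorem PT.graft_graft {m n q r n₁ q₂ : ℕ} {φ : Fin n → Fin m} {i : Fin m} {e : Fin q → Fin n}
    {he hφ} {B : SlotHom k H m i M N} {a : Fin q} {C : SlotHom k H q a M' M}
    {i' : Fin n} {B' : SlotHom k H n i' M' N}
    (hB' : ∀ x, B'.1 x = PT.graft φ i e he hφ B (C.1 x))
    {φ₁ : Fin n₁ → Fin n} {e₁ : Fin r → Fin n₁} {he₁ hφ₁}
    {χ : Fin q₂ → Fin q} {ε : Fin r → Fin q₂} {hε hχ}
    {φ₂ : Fin n₁ → Fin m} {e₂ : Fin q₂ → Fin n₁} {he₂ hφ₂}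
    (h1 : ∀ s, e₁ s = e₂ (ε s)) (h2 : ∀ t, φ (φ₁ t) = φ₂ t) (h3 : ∀ s, φ₁ (e₂ s) = e (χ s))
    (z : PT k H r M') :
    PT.graft φ₁ i' e₁ he₁ hφ₁ B' z =
      PT.graft φ₂ i e₂ he₂ hφ₂ B (PT.graft χ a ε hε hχ C z) := by
  induction z using PT.induction with
  | h0 => simp
  | hmk b x =>
    have h4 : ∀ c w, PT.graft φ₂ i e₂ he₂ hφ₂ B (c • w) =
        emb e₂ he₂ c • PT.graft φ₂ i e₂ he₂ hφ₂ B w := fun c w => PT.liftₗ_smul _ _ _ c w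
    rw [PT.graft_mk, PT.graft_mk, hB', h4,
      PT.graft_pull (φ := φ) (e := e) (he := he) (hφ := hφ) B χ φ₁ h2 h3,
      emb_emb ε hε e₂ he₂ e₁ he₁ h1]
  | hadd z w hz hw => simp only [map_add, hz, hw]

theorem PT.graft_zero_hom {q m n : ℕ} {φ : Fin n → Fin m} {i : Fin m} {e : Fin q → Fin n}
    {he hφ} (z : PT k H q M) : PT.graft φ i e he hφ (0 : SlotHom k H m i M N) z = 0 := by
  have := PT.graft_add φ i e he hφ (0 : SlotHom k H m i M N) 0 z
  simpa using this

/-- Insertions into two different arguments commute. -/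
theorem PT.graft_comm {m n n' r q q' : ℕ} {i j : Fin m} {F : M' → SlotHom k H m i M N}
    {G : M → SlotHom k H m j M' N} (hFG : ∀ x y, (F y).1 x = (G x).1 y)
    {φ : Fin n → Fin m} {e : Fin q → Fin n} {he hφ}
    {χ : Fin n' → Fin m} {ε : Fin q' → Fin n'} {hε hχ}
    {j' : Fin n} {P : PT k H q M → SlotHom k H n j' M' N}
    (hP : ∀ z y, (P z).1 y = PT.graft φ i e he hφ (F y) z)
    {i' : Fin n'} {Q : PT k H q' M' → SlotHom k H n' i' M N}
    (hQ : ∀ w x, (Q w).1 x = PT.graft χ j ε hε hχ (G x) w)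
    {φ₁ : Fin r → Fin n} {e₁ : Fin q' → Fin r} {he₁ hφ₁}
    {χ₁ : Fin r → Fin n'} {ε₁ : Fin q → Fin r} {hε₁ hχ₁}
    (h1 : ∀ t, φ (φ₁ t) = χ (χ₁ t)) (h2 : ∀ s t, φ₁ t = e s ↔ t = ε₁ s)
    (h3 : ∀ s t, χ₁ t = ε s ↔ t = e₁ s) (h4 : ∀ s s', e₁ s ≠ ε₁ s')
    (z : PT k H q M) (w : PT k H q' M') :
    PT.graft φ₁ j' e₁ he₁ hφ₁ (P z) w = PT.graft χ₁ i' ε₁ hε₁ hχ₁ (Q w) z := by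
  -- The values prescribed by `hP` and `hQ` determine `P` and `Q`, so both are additive. This is
  -- what permits induction on `z` and then on `w`, down to pure elements.
  have hP0 : P 0 = 0 := Subtype.ext (LinearMap.ext fun y => by rw [hP, map_zero]; rfl)
  have hQ0 : Q 0 = 0 := Subtype.ext (LinearMap.ext fun y => by rw [hQ, map_zero]; rfl)
  have hPa : ∀ z z', P (z + z') = P z + P z' := fun z z' =>
    Subtype.ext (LinearMap.ext fun y => by
      rw [hP, map_add, ← hP, ← hP]; rfl)
  have hQa : ∀ z z', Q (z + z') = Q z + Q z' := fun z z' =>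
    Subtype.ext (LinearMap.ext fun y => by
      rw [hQ, map_add, ← hQ, ← hQ]; rfl)
  induction z using PT.induction with
  | h0 => rw [hP0, PT.graft_zero_hom, map_zero]
  | hadd z z' h h' => rw [hPa, PT.graft_add, map_add, h, h']
  | hmk a x =>
    induction w using PT.induction with
    | h0 => rw [hQ0, PT.graft_zero_hom, map_zero]
    | hadd z z' h h' => rw [hQa, PT.graft_add, map_add, h, h']
    | hmk b y =>
      rw [PT.graft_mk, PT.graft_mk, hP, hQ, PT.graft_mk, PT.graft_mk, PT.pull_smul, PT.pull_smul,
        PT.pull_pull, PT.pull_pull, delta_emb' e he ε₁ hε₁ φ₁ h2, delta_emb' ε hε e₁ he₁ χ₁ h3,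
        smul_smul, smul_smul, hFG, funext h1]
      congr 1
      -- The two coefficients occupy disjoint positions by `h4`, so the order of multiplication does
      -- not matter.
      refine (spreads_emb e₁ he₁).commute (spreads_emb ε₁ hε₁) ?_ b a
      rintro s s' t rfl
      exact h4 s s'

theorem PT.graft_smul_tn {q m n : ℕ} {φ : Fin n → Fin m} {i : Fin m} {e : Fin q → Fin n}
    {he hφ} (B : SlotHom k H m i M N) (a : Tn k H q) (z : PT k H q M) :
    PT.graft φ i e he hφ B (a • z) = emb e he a • PT.graft φ i e he hφ B z :=
  PT.liftₗ_smul _ _ _ a z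

end PullGraft

/-! ### Permutations, shuffles and block permutations. -/

section Shuffles

open Equiv

/-- The permutation of `{0, …, n}` that fixes `0` and acts as `τ` on the other elements. -/
def shiftPerm {n : ℕ} (τ : Perm (Fin n)) : Perm (Fin (n + 1)) := Perm.decomposeFin.symm (0, τ)

@[simp] theorem shiftPerm_zero {n : ℕ} (τ : Perm (Fin n)) : shiftPerm τ 0 = 0 := by
  simp [shiftPerm]

@[simp] theorem shiftPerm_succ {n : ℕ} (τ : Perm (Fin n)) (i : Fin n) :
    shiftPerm τ i.succ = (τ i).succ := by
  simp [shiftPerm]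

@[simp] theorem sign_shiftPerm {n : ℕ} (τ : Perm (Fin n)) : Perm.sign (shiftPerm τ) = Perm.sign τ := by
  simp [shiftPerm]

theorem shiftPerm_inv {n : ℕ} (τ : Perm (Fin n)) : (shiftPerm τ)⁻¹ = shiftPerm τ⁻¹ := by
  refine inv_eq_of_mul_eq_one_left (Equiv.ext fun i => ?_)
  refine Fin.cases ?_ (fun i => ?_) i <;> simp

/-- The permutations with `σ 0 = j` form the left coset of the stabilizer of `0` represented by `r
j`. -/
theorem sum_perm_left {n : ℕ} {A : Type*} [AddCommMonoid A] (r : Fin (n + 1) → Perm (Fin (n + 1)))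
    (hr : ∀ j, r j 0 = j) (G : Perm (Fin (n + 1)) → A) :
    ∑ σ, G σ = ∑ j, ∑ τ, G (r j * shiftPerm τ) := by
  have hb : Function.Bijective fun p : Fin (n + 1) × Perm (Fin n) => r p.1 * shiftPerm p.2 := by
    rw [Fintype.bijective_iff_injective_and_card]
    refine ⟨?_, ?_⟩
    · rintro ⟨j, τ⟩ ⟨j', τ'⟩ h
      have h0 := Equiv.congr_fun h 0
      simp only [Perm.mul_apply, shiftPerm_zero, hr] at h0
      subst h0
      refine Prod.ext rfl (Equiv.ext fun i => ?_)
      have h1 := Equiv.congr_fun h i.succ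
      simp only [Perm.mul_apply, shiftPerm_succ] at h1
      exact Fin.succ_injective _ ((r j).injective h1)
    · simp [Fintype.card_perm, Nat.factorial_succ]
  rw [← hb.sum_comp, Fintype.sum_prod_type]

/-- Inversion turns left cosets into right ones: the summand of index `j` runs over the permutations
that send `j` to `0`. This is the form needed when an operator absorbs permutations fixing `0` from
the left. -/
theorem sum_perm_right {n : ℕ} {A : Type*} [AddCommMonoid A]
    (r : Fin (n + 1) → Perm (Fin (n + 1)))
    (hr : ∀ j, r j 0 = j) (G : Perm (Fin (n + 1)) → A) :
    ∑ σ, G σ = ∑ j, ∑ τ, G (shiftPerm τ * (r j)⁻¹) := by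
  rw [← Equiv.sum_comp (Equiv.inv (Perm (Fin (n + 1)))), sum_perm_left r hr]
  refine Finset.sum_congr rfl fun j _ => ?_
  rw [← Equiv.sum_comp (Equiv.inv (Perm (Fin n)))]
  refine Finset.sum_congr rfl fun τ _ => ?_
  simp [shiftPerm_inv]

/-- The permutations that preserve `{0, …, q - 1}`. -/
def blockPerms (q N : ℕ) : Finset (Perm (Fin N)) :=
  Finset.univ.filter fun κ => ∀ a : Fin N, (κ a).val < q ↔ a.val < q

theorem mem_blockPerms {q N : ℕ} (κ : Perm (Fin N)) :
    κ ∈ blockPerms q N ↔ ∀ a : Fin N, (κ a).val < q ↔ a.val < q := by simp [blockPerms]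

theorem mem_shuffles {q N : ℕ} (σ : Perm (Fin N)) : σ ∈ shuffles q N ↔
    ∀ a b : Fin N, a < b → (b.val < q ∨ q ≤ a.val) → σ a < σ b := by simp [shuffles]

/-- Block permutations are the stabilizer of the two-colouring of the positions by `a < q`, whose
order is the product of the factorials of the sizes of the colour classes. -/
theorem card_blockPerms {q N : ℕ} (hq : q ≤ N) :
    (blockPerms q N).card = q.factorial * (N - q).factorial := by
  have h := DomMulAct.stabilizer_card (fun a : Fin N => decide (a.val < q))
  have h1 : Fintype.card {a : Fin N // decide (a.val < q) = true} = q := by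
    rw [Fintype.card_subtype]
    simp only [decide_eq_true_eq]
    rw [Fin.card_filter_val_lt]
    exact min_eq_right hq
  have h2 : Fintype.card {a : Fin N // decide (a.val < q) = false} = N - q := by
    have := Fintype.card_subtype_compl (fun a : Fin N => decide (a.val < q) = true)
    simp only [h1, Fintype.card_fin, Bool.not_eq_true] at this
    exact this
  rw [Fintype.prod_bool, h1, h2] at h
  rw [← h, Fintype.card_subtype, blockPerms]
  congr 1
  ext κ
  simp [funext_iff]

/-- Within a block both `σ` and `σ * κ` increase, so `κ` cannot reverse an order; across the blocks
`κ` preserves the order because it preserves the blocks. A monotone permutation of a finite chain is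
the identity. -/
theorem shuffle_unique {q N : ℕ} {σ κ : Perm (Fin N)} (h1 : σ ∈ shuffles q N)
    (h2 : σ * κ ∈ shuffles q N) (hκ : κ ∈ blockPerms q N) : κ = 1 := by
  rw [mem_shuffles] at h1 h2
  rw [mem_blockPerms] at hκ
  have hm : StrictMono κ := by
    intro a b hab
    have ha := hκ a
    have hb := hκ b
    have hab' : a.val < b.val := hab
    by_cases hc : b.val < q ∨ q ≤ a.val
    · have h3 : σ (κ a) < σ (κ b) := h2 a b hab hc
      by_contra h4
      rcases (not_lt.1 h4).eq_or_lt with h5 | h5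
      · exact absurd (κ.injective h5) (ne_of_gt hab)
      · exact absurd (h1 _ _ h5 (by omega)) (not_lt.2 h3.le)
    · have : (κ a).val < (κ b).val := by omega
      exact this
  have : hm.orderIsoOfSurjective κ κ.surjective = OrderIso.refl _ := Subsingleton.elim _ _
  ext i
  exact congrArg Fin.val (DFunLike.congr_fun this i)

theorem exists_shuffle {q N : ℕ} (σ : Perm (Fin N)) :
    ∃ κ ∈ blockPerms q N, σ * κ ∈ shuffles q N := by
  -- Sorting first by block and then by the value of `σ` keeps the blocks in place and makes `σ`
  -- increasing on each.
  let g : Fin N → Bool ×ₗ Fin N := fun i => toLex (decide (q ≤ i.val), σ i)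
  have hmono : Monotone (g ∘ Tuple.sort g) := Tuple.monotone_sort g
  set κ := Tuple.sort g with hκdef
  have h1 : ∀ a b, a ≤ b → q ≤ (κ a).val → q ≤ (κ b).val := by
    intro a b hab ha
    have h := hmono hab
    simp only [Function.comp_apply, g, Prod.Lex.toLex_le_toLex] at h
    by_contra hb
    simp only [ha, hb, decide_true, decide_false] at h
    rcases h with h | h
    · exact absurd h (by decide)
    · exact absurd h.1 (by decide)
  -- By `h1` the positions that `κ` sends into the first block form an initial segment. It has as
  -- many elements as the first block, hence equals it.
  have hcard : (Finset.univ.filter fun a => (κ a).val < q).card =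
      (Finset.univ.filter fun a : Fin N => a.val < q).card := by
    refine Finset.card_bij (fun a _ => κ a) (by simp) (fun a _ b _ h => κ.injective h) ?_
    intro b hb
    exact ⟨κ.symm b, by simpa using hb, by simp⟩
  have hκ : ∀ a : Fin N, (κ a).val < q ↔ a.val < q := by
    intro a
    constructor
    · intro ha
      by_contra hq
      refine absurd hcard (ne_of_gt (Finset.card_lt_card ?_))
      refine Finset.ssubset_iff_subset_ne.2 ⟨fun b hb => ?_, fun h => ?_⟩
      · simp only [Finset.mem_filter, Finset.mem_univ, true_and] at hb ⊢
        by_contra hb'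
        exact absurd (h1 b a (Fin.le_def.2 (by omega)) (by omega)) (by omega)
      · have : a ∈ Finset.univ.filter fun a : Fin N => a.val < q := by rw [h]; simpa using ha
        simp [hq] at this
    · intro ha
      by_contra hq
      refine absurd hcard (ne_of_lt (Finset.card_lt_card ?_))
      refine Finset.ssubset_iff_subset_ne.2 ⟨fun b hb => ?_, fun h => ?_⟩
      · simp only [Finset.mem_filter, Finset.mem_univ, true_and] at hb ⊢
        by_contra hb'
        exact absurd (h1 a b (Fin.le_def.2 (by omega)) (by omega)) (by omega)
      · have : a ∈ Finset.univ.filter fun a => (κ a).val < q := by rw [h]; simpa using ha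
        simp [hq] at this
  refine ⟨κ, (mem_blockPerms κ).2 hκ, (mem_shuffles _).2 fun a b hab hc => ?_⟩
  have h := hmono hab.le
  have ha := hκ a
  have hb := hκ b
  have h2 : decide (q ≤ (κ a).val) = decide (q ≤ (κ b).val) := by
    rw [decide_eq_decide]
    have : a.val < b.val := hab
    omega
  simp only [Function.comp_apply, g, Prod.Lex.toLex_le_toLex, h2, lt_irrefl, true_and,
    false_or] at h
  exact lt_of_le_of_ne h fun h3 => absurd (κ.injective (σ.injective h3)) hab.ne

/-- Every permutation is uniquely the product of a shuffle and a permutation that preserves the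
two blocks. -/
theorem sum_perm_shuffles (q N : ℕ) {A : Type*} [AddCommMonoid A] (G : Perm (Fin N) → A) :
    ∑ σ, G σ = ∑ σ ∈ shuffles q N, ∑ κ ∈ blockPerms q N, G (σ * κ) := by
  rw [← Finset.sum_product']
  symm
  refine Finset.sum_nbij (fun p => p.1 * p.2) (by simp) ?_ ?_ (by simp)
  · rintro ⟨σ, κ⟩ hp ⟨σ', κ'⟩ hp' h
    simp only [Finset.coe_product, Set.mem_prod, Finset.mem_coe] at hp hp' h
    have h2 : κ * κ'⁻¹ = 1 := by
      refine shuffle_unique hp.1 (q := q) ?_ ?_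
      · rw [← mul_assoc, h, mul_inv_cancel_right]; exact hp'.1
      · refine (mem_blockPerms _).2 fun a => ?_
        rw [Perm.mul_apply, (mem_blockPerms _).1 hp.2, ← (mem_blockPerms _).1 hp'.2]
        simp
    have h3 := mul_inv_eq_one.1 h2
    subst h3
    simpa using h
  · intro σ _
    obtain ⟨κ, h1, h2⟩ := exists_shuffle (q := q) σ
    refine ⟨(σ * κ, κ⁻¹), ?_, by simp⟩
    simp only [Finset.coe_product, Set.mem_prod, Finset.mem_coe]
    refine ⟨h2, (mem_blockPerms _).2 fun a => ?_⟩
    rw [← (mem_blockPerms _).1 h1]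
    simp

/-- A shuffle with a first block of size two is determined by its first two values, so it is the
product of the cycle bringing `σ 0` to the front and the shifted cycle bringing `σ 1` to the second
place. The latter has length one less than the value suggests, whence the minus sign that relates
shuffle signs to the signs in the second sum of the coboundary. -/
theorem sign_two_shuffle {m : ℕ} {σ : Perm (Fin (m + 2))} (hσ : σ ∈ shuffles 2 (m + 2)) :
    (Perm.sign σ : ℤ) = -(-1) ^ ((σ 0 : ℕ) + (σ 1 : ℕ)) := by
  have h01 : σ 0 < σ 1 := (mem_shuffles σ).1 hσ 0 1 (by simp) (Or.inl (by simp))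
  -- `j` is the rank of `σ 1` among the elements other than `σ 0`; since `σ 0 < σ 1`, this is `σ 1 -
  -- 1`.
  obtain ⟨j, hj⟩ := Fin.exists_succ_eq.2 (ne_of_gt (lt_of_le_of_lt (Fin.zero_le _) h01))
  let c : Perm (Fin (m + 2)) := (σ 0).cycleRange.symm * shiftPerm j.cycleRange.symm
  have hc0 : c 0 = σ 0 := by simp [c, Fin.cycleRange_symm_zero]
  have hc1 : c 1 = σ 1 := by
    have : (1 : Fin (m + 2)) = Fin.succ 0 := rfl
    simp only [c, Perm.mul_apply]
    rw [this, shiftPerm_succ, Fin.cycleRange_symm_succ, Fin.cycleRange_symm_zero,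
      Fin.succAbove_of_le_castSucc, ← this, hj]
    rw [Fin.le_def]
    have h2 : (σ 0).val < (σ 1).val := h01
    rw [← hj, Fin.val_succ] at h2
    simp only [Fin.val_castSucc]
    omega
  have hc2 : ∀ t : Fin m, c t.succ.succ = (σ 0).succAbove (j.succAbove t) := by
    intro t
    simp only [c, Perm.mul_apply, shiftPerm_succ, Fin.cycleRange_symm_succ]
  have hc : c ∈ shuffles 2 (m + 2) := by
    rw [mem_shuffles]
    intro a b
    refine Fin.cases ?_ (fun a => ?_) a <;> refine Fin.cases ?_ (fun b => ?_) b
    · intro h; simp at h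
    · refine Fin.cases ?_ (fun b => ?_) b
      · intro _ _
        have h1 : (Fin.succ 0 : Fin (m + 2)) = 1 := rfl
        rw [hc0, h1, hc1]; exact h01
      · intro _ h; simp at h
    · intro h; simp at h
    · refine Fin.cases ?_ (fun a => ?_) a <;> refine Fin.cases ?_ (fun b => ?_) b
      · intro h; simp at h
      · intro _ h; simp at h
      · intro h; simp at h
      · intro h _
        rw [hc2, hc2]
        exact Fin.strictMono_succAbove _ (Fin.strictMono_succAbove _ (by simpa using h))
  -- Both shuffles agree on `0` and `1`, so `c⁻¹ * σ` preserves the first block and uniqueness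
  -- applies.
  have hκ : c⁻¹ * σ = 1 := by
    refine shuffle_unique hc (by simpa using hσ) ((mem_blockPerms _).2 fun a => ?_)
    have e0 : (c⁻¹ * σ) 0 = 0 := by rw [Perm.mul_apply, ← hc0]; simp
    have e1 : (c⁻¹ * σ) 1 = 1 := by rw [Perm.mul_apply, ← hc1]; simp
    have key : ∀ b : Fin (m + 2), b.val < 2 ↔ b = 0 ∨ b = 1 := by
      intro b
      simp only [Fin.ext_iff, Fin.val_zero, Fin.val_one]
      omega
    rw [key, key]
    constructor
    · rintro (h | h)
      · exact Or.inl ((c⁻¹ * σ).injective (h.trans e0.symm))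
      · exact Or.inr ((c⁻¹ * σ).injective (h.trans e1.symm))
    · rintro (rfl | rfl)
      · exact Or.inl e0
      · exact Or.inr e1
  have hσc : σ = c := (inv_mul_eq_one.1 hκ).symm
  have hs : (Perm.sign c : ℤ) = (-1) ^ (σ 0 : ℕ) * (-1) ^ (j : ℕ) := by
    simp [c, Perm.sign_symm, Fin.sign_cycleRange]
  rw [hσc, hs, ← hσc, ← hj, Fin.val_succ]
  ring

end Shuffles

/-! ### Alternation of polylinear maps. -/

section Alternation

variable {k H : Type*} [Field k] [Ring H] [HopfAlgebra k H]
variable {L M : Type*}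
  [AddCommGroup L] [Module k L] [Module H L] [IsScalarTower k H L]
  [AddCommGroup M] [Module k M] [Module H M]

theorem Poly.ext {p : ℕ} {f g : Poly k H p L M} (h : ∀ x, f.1 x = g.1 x) : f = g :=
  Subtype.ext (MultilinearMap.ext h)

theorem Poly.sub_apply {p : ℕ} (f g : Poly k H p L M) (x) : (f - g).1 x = f.1 x - g.1 x := rfl

theorem Poly.neg_apply {p : ℕ} (f : Poly k H p L M) (x) : (-f).1 x = -f.1 x := rfl

variable [Coalgebra.IsCocomm k H]

theorem Poly.act_apply {p : ℕ} (σ : Equiv.Perm (Fin p)) (f : Poly k H p L M) (x) :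
    (Poly.act σ f).1 x = PT.perm σ (f.1 (x ∘ σ)) := rfl

theorem Poly.act_mul {p : ℕ} (σ τ : Equiv.Perm (Fin p)) (f : Poly k H p L M) :
    Poly.act (σ * τ) f = Poly.act σ (Poly.act τ f) :=
  Poly.ext fun _ => PT.perm_mul σ τ _

theorem Poly.act_one {p : ℕ} (f : Poly k H p L M) : Poly.act 1 f = f :=
  Poly.ext fun _ => PT.perm_one _

/-- The alternation `∑ sgn(σ) (σ ⊗_H id) f (x_{σ 0}, x_{σ 1}, …)`. -/
def Poly.alt {p : ℕ} : Poly k H p L M →ₗ[k] Poly k H p L M :=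
  ∑ σ : Equiv.Perm (Fin p), (Equiv.Perm.sign σ : ℤ) • Poly.act σ

theorem Poly.alt_apply {p : ℕ} (f : Poly k H p L M) :
    Poly.alt f = ∑ σ : Equiv.Perm (Fin p), (Equiv.Perm.sign σ : ℤ) • Poly.act σ f := by
  simp [Poly.alt]

theorem factorial_eq_card (p : ℕ) :
    p.factorial = (Finset.univ : Finset (Equiv.Perm (Fin p))).card := by
  rw [Finset.card_univ, Fintype.card_perm, Fintype.card_fin]

theorem sign_mul_self {p : ℕ} (σ : Equiv.Perm (Fin p)) :
    (Equiv.Perm.sign σ : ℤ) * (Equiv.Perm.sign σ : ℤ) = 1 := by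
  rw [← Units.val_mul, Int.units_mul_self, Units.val_one]

theorem Poly.alt_act {p : ℕ} (τ : Equiv.Perm (Fin p)) (f : Poly k H p L M) :
    Poly.alt (Poly.act τ f) = (Equiv.Perm.sign τ : ℤ) • Poly.alt f := by
  rw [Poly.alt_apply, Poly.alt_apply, Finset.smul_sum,
    ← Equiv.sum_comp (Equiv.mulRight τ) (fun σ => (Equiv.Perm.sign τ : ℤ) •
      (Equiv.Perm.sign σ : ℤ) • Poly.act σ f)]
  refine Finset.sum_congr rfl fun σ _ => ?_
  rw [Equiv.coe_mulRight, ← Poly.act_mul, smul_smul, Equiv.Perm.sign_mul, Units.val_mul,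
    mul_comm (Equiv.Perm.sign σ : ℤ), ← mul_assoc, sign_mul_self, one_mul]

theorem Poly.act_alt {p : ℕ} (τ : Equiv.Perm (Fin p)) (f : Poly k H p L M) :
    Poly.act τ (Poly.alt f) = (Equiv.Perm.sign τ : ℤ) • Poly.alt f := by
  rw [Poly.alt_apply, map_sum, Finset.smul_sum, ← Equiv.sum_comp (Equiv.mulLeft τ)
    (fun σ => (Equiv.Perm.sign τ : ℤ) • (Equiv.Perm.sign σ : ℤ) • Poly.act σ f)]
  refine Finset.sum_congr rfl fun σ _ => ?_
  rw [Equiv.coe_mulLeft, map_zsmul, ← Poly.act_mul, smul_smul, Equiv.Perm.sign_mul, Units.val_mul,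
    ← mul_assoc, sign_mul_self, one_mul]

theorem Poly.alt_mem {p : ℕ} (f : Poly k H p L M) : Poly.alt f ∈ Cochain k H L M p :=
  fun σ => Poly.act_alt σ f

/-- Skew-symmetry within the two blocks makes all summands in a coset of the block permutations
equal; shuffles represent the cosets, and the factor is the size of each. -/
theorem Poly.alt_eq_shuffles {N : ℕ} (q : ℕ) (hq : q ≤ N) {f : Poly k H N L M}
    (hf : ∀ κ ∈ blockPerms q N, Poly.act κ f = (Equiv.Perm.sign κ : ℤ) • f) :
    Poly.alt f = (q.factorial * (N - q).factorial) •
      ∑ σ ∈ shuffles q N, (Equiv.Perm.sign σ : ℤ) • Poly.act σ f := by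
  rw [Poly.alt_apply, sum_perm_shuffles q, Finset.smul_sum]
  refine Finset.sum_congr rfl fun σ _ => ?_
  rw [← card_blockPerms hq]
  refine Finset.sum_eq_card_nsmul fun κ hκ => ?_
  rw [Poly.act_mul, hf κ hκ, map_zsmul, smul_smul, Equiv.Perm.sign_mul, Units.val_mul, mul_assoc,
    sign_mul_self, mul_one]

/-- The alternation of a polylinear map that is skew-symmetric in all arguments but the first. -/
theorem Poly.alt_eq_cycles {n : ℕ} {f : Poly k H (n + 1) L M}
    (hf : ∀ τ : Equiv.Perm (Fin n), Poly.act (shiftPerm τ) f = (Equiv.Perm.sign τ : ℤ) • f) :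
    Poly.alt f = n.factorial •
      ∑ i : Fin (n + 1), (-1 : ℤ) ^ (i : ℕ) • Poly.act i.cycleRange.symm f := by
  rw [Poly.alt_apply, sum_perm_left (fun i => i.cycleRange.symm) Fin.cycleRange_symm_zero,
    Finset.smul_sum]
  refine Finset.sum_congr rfl fun i _ => ?_
  rw [factorial_eq_card n]
  refine Finset.sum_eq_card_nsmul fun τ _ => ?_
  rw [Poly.act_mul, hf τ, map_zsmul, smul_smul, Equiv.Perm.sign_mul, Units.val_mul, mul_assoc,
    sign_shiftPerm, sign_mul_self, mul_one, Equiv.Perm.sign_symm, Fin.sign_cycleRange]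
  simp

/-- If `Φ` is compatible with the permutations fixing the first argument, then `Alt Φ Alt g`
is a sum over the argument that is moved to the first position. -/
theorem Poly.alt_alt_eq_swaps {n p : ℕ} {L' M' : Type*}
    [AddCommGroup L'] [Module k L'] [Module H L'] [IsScalarTower k H L']
    [AddCommGroup M'] [Module k M'] [Module H M']
    (Φ : Poly k H (n + 1) L M →ₗ[k] Poly k H p L' M')
    (hΦ : ∀ (τ : Equiv.Perm (Fin n)) g, Poly.alt (Φ (Poly.act (shiftPerm τ) g)) =
      (Equiv.Perm.sign τ : ℤ) • Poly.alt (Φ g)) (g : Poly k H (n + 1) L M) :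
    Poly.alt (Φ (Poly.alt g)) = n.factorial •
      ∑ j : Fin (n + 1), (Equiv.Perm.sign (Equiv.swap 0 j) : ℤ) •
        Poly.alt (Φ (Poly.act (Equiv.swap 0 j) g)) := by
  rw [Poly.alt_apply g, sum_perm_right (fun j => Equiv.swap 0 j) (fun j => by simp), map_sum, map_sum,
    Finset.smul_sum]
  refine Finset.sum_congr rfl fun j _ => ?_
  rw [factorial_eq_card n]
  rw [map_sum, map_sum]
  refine Finset.sum_eq_card_nsmul fun τ _ => ?_
  rw [map_zsmul, map_zsmul, Poly.act_mul, hΦ, smul_smul, Equiv.Perm.sign_mul, Units.val_mul,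
    mul_right_comm, sign_shiftPerm, sign_mul_self, one_mul, Equiv.swap_inv]

end Alternation

/-! ### Insertion under changes of positions, modules and scalars. -/

section GraftRelations

variable {k H : Type*} [Field k] [Ring H] [HopfAlgebra k H]
variable {M N M' N' : Type*} [AddCommGroup M] [Module k M] [Module H M]
  [AddCommGroup N] [Module k N] [Module H N]
  [AddCommGroup M'] [Module k M'] [Module H M']
  [AddCommGroup N'] [Module k N'] [Module H N']

section
variable [Coalgebra.IsCocomm k H]

/-- Two insertions related by maps of the positions. -/
theorem PT.graft_rel {q m m' n n' : ℕ} {φ : Fin n → Fin m} {i : Fin m} {e : Fin q → Fin n}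
    {he hφ} {φ' : Fin n' → Fin m'} {i' : Fin m'} {e' : Fin q → Fin n'} {he' hφ'}
    {B : SlotHom k H m i M N} {B' : SlotHom k H m' i' M N} (ψ : Fin m' → Fin m)
    (ψ' : Fin n' → Fin n) (hB : ∀ x, B'.1 x = PT.pull (k := k) (H := H) ψ (B.1 x))
    (h1 : ∀ t, ψ (φ' t) = φ (ψ' t)) (h2 : ∀ s, ψ' (e' s) = e s) (h3 : ∀ s, ψ s = i → s = i')
    (z : PT k H q M) :
    PT.graft φ' i' e' he' hφ' B' z =
      PT.pull (k := k) (H := H) ψ' (PT.graft φ i e he hφ B z) := by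
  induction z using PT.induction with
  | h0 => simp
  | hmk a x =>
    rw [PT.graft_mk, PT.graft_mk, hB, PT.pull_smul, PT.pull_pull, PT.pull_pull, funext h1,
      delta_emb' e he e' he' ψ']
    intro s t
    refine ⟨fun h => ?_, fun h => by rw [h, h2]⟩
    -- By `h3` only `i'` can lie over the inserted slot, so a position that `ψ'` sends into the
    -- range of `e` must come from the range of `e'`.
    have h4 : φ' t = i' := h3 _ (by rw [h1, h]; exact (hφ _).2 ⟨s, rfl⟩)
    obtain ⟨s', rfl⟩ := (hφ' t).1 h4
    rw [h2] at h
    rw [he h]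
  | hadd z w hz hw => simp only [map_add, hz, hw]

theorem PT.graft_congr {q m n : ℕ} {φ φ' : Fin n → Fin m} {i i' : Fin m} {e e' : Fin q → Fin n}
    {he hφ he' hφ'} {B : SlotHom k H m i M N} {B' : SlotHom k H m i' M N}
    (hφφ' : ∀ t, φ t = φ' t) (hii' : i = i') (hee' : ∀ s, e s = e' s) (hB : ∀ x, B.1 x = B'.1 x)
    (z : PT k H q M) : PT.graft φ i e he hφ B z = PT.graft φ' i' e' he' hφ' B' z := by
  obtain rfl := funext hφφ'
  obtain rfl := funext hee'
  subst hii'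
  obtain rfl : B = B' := Subtype.ext (LinearMap.ext hB)
  rfl

theorem PT.graft_neg_hom {q m n : ℕ} {φ : Fin n → Fin m} {i : Fin m} {e : Fin q → Fin n}
    {he hφ} {B B' : SlotHom k H m i M N} (hB : ∀ x, B'.1 x = -B.1 x)
    (z : PT k H q M) : PT.graft φ i e he hφ B' z = -PT.graft φ i e he hφ B z := by
  obtain rfl : B' = -B := Subtype.ext (LinearMap.ext hB)
  rw [eq_neg_iff_add_eq_zero, ← PT.graft_add, neg_add_cancel, PT.graft_zero_hom]

theorem PT.graft_map [IsScalarTower k H M] [IsScalarTower k H M'] {q m n : ℕ} {φ : Fin n → Fin m}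
    {i : Fin m} {e : Fin q → Fin n} {he hφ} {B : SlotHom k H m i M N} {B' : SlotHom k H m i M' N}
    (S : M' →ₗ[H] M) (hB : ∀ x, B'.1 x = B.1 (S x)) (z : PT k H q M') :
    PT.graft φ i e he hφ B (PT.map S z) = PT.graft φ i e he hφ B' z := by
  induction z using PT.induction with
  | h0 => simp
  | hmk a x => rw [PT.map_mk, PT.graft_mk, PT.graft_mk, hB]
  | hadd z w hz hw => simp only [map_add, hz, hw]

theorem PT.map_graft [IsScalarTower k H N] [IsScalarTower k H N'] {q m n : ℕ} {φ : Fin n → Fin m}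
    {i : Fin m} {e : Fin q → Fin n} {he hφ} {B : SlotHom k H m i M N} {B' : SlotHom k H m i M N'}
    (S : N →ₗ[H] N') (hB : ∀ x, B'.1 x = PT.map S (B.1 x)) (z : PT k H q M) :
    PT.map S (PT.graft φ i e he hφ B z) = PT.graft φ i e he hφ B' z := by
  induction z using PT.induction with
  | h0 => simp
  | hmk a x => rw [PT.graft_mk, PT.graft_mk, PT.map_smul_tn, PT.map_pull, hB]
  | hadd z w hz hw => simp only [map_add, hz, hw]

/-- Insertion into a multiple of an operation. -/
theorem PT.graft_smul_pull {p q m m' n n' : ℕ} {φ : Fin n → Fin m} {i : Fin m} {e : Fin q → Fin n}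
    {he hφ} {φ' : Fin n' → Fin m'} {i' : Fin m'} {e' : Fin q → Fin n'} {he' hφ'}
    {B : SlotHom k H m i M N} {B' : SlotHom k H m' i' M N} (ψ : Fin m' → Fin m)
    (ψ' : Fin n' → Fin n) {ε : Fin p → Fin m'} {hε} {ε' : Fin p → Fin n'} {hε'} (a : Tn k H p)
    (hB : ∀ x, B'.1 x = emb ε hε a • PT.pull (k := k) (H := H) ψ (B.1 x))
    (h1 : ∀ t, ψ (φ' t) = φ (ψ' t)) (h2 : ∀ s, ψ' (e' s) = e s) (h3 : ∀ s, ψ s = i → s = i')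
    (h4 : ∀ s t, φ' t = ε s ↔ t = ε' s) (h5 : ∀ s s', e' s ≠ ε' s') (z : PT k H q M) :
    PT.graft φ' i' e' he' hφ' B' z = emb ε' hε' a •
      PT.pull (k := k) (H := H) ψ' (PT.graft φ i e he hφ B z) := by
  induction z using PT.induction with
  | h0 => simp
  | hmk b x =>
    rw [PT.graft_mk, PT.graft_mk, hB, PT.pull_smul, PT.pull_smul, PT.pull_pull, PT.pull_pull,
      funext h1, delta_emb' e he e' he' ψ', delta_emb' ε hε ε' hε' φ' h4, smul_smul, smul_smul]
    · congr 1
      refine (spreads_emb e' he').commute (spreads_emb ε' hε') ?_ b a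
      rintro s s' t rfl
      exact h5 s s'
    intro s t
    refine ⟨fun h => ?_, fun h => by rw [h, h2]⟩
    have h4 : φ' t = i' := h3 _ (by rw [h1, h]; exact (hφ _).2 ⟨s, rfl⟩)
    obtain ⟨s', rfl⟩ := (hφ' t).1 h4
    rw [h2] at h
    rw [he h]
  | hadd z w hz hw => simp only [map_add, hz, hw, smul_add]

end

end GraftRelations

/-! ### Equivariance and associativity of substitution. -/

section Equivariance

variable {k H : Type*} [Field k] [Ring H] [HopfAlgebra k H] [Coalgebra.IsCocomm k H]
variable {L M N : Type*}
  [AddCommGroup L] [Module k L] [Module H L] [IsScalarTower k H L]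
  [AddCommGroup M] [Module k M] [Module H M] [IsScalarTower k H M]
  [AddCommGroup N] [Module k N] [Module H N] [IsScalarTower k H N]

theorem perm_inv_apply {α : Type*} (σ : Equiv.Perm α) (s : α) : σ⁻¹ (σ s) = s :=
  σ.symm_apply_apply s

theorem perm_apply_inv {α : Type*} (σ : Equiv.Perm α) (s : α) : σ (σ⁻¹ s) = s :=
  σ.apply_symm_apply s

theorem val_cases_zero_one {q : ℕ} (t : Fin (q + 1)) :
    ((Fin.cases 0 (fun _ => 1) t : Fin 2) : ℕ) = min t.val 1 := by
  refine Fin.cases ?_ (fun t => ?_) t <;> simp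

theorem val_lastCases_one_zero (t : Fin 3) :
    ((Fin.lastCases (motive := fun _ => Fin 2) 1 (fun _ => 0) t : Fin 2) : ℕ) = t.val - 1 := by
  refine Fin.lastCases ?_ (fun t => ?_) t
  · rw [Fin.lastCases_last]; rfl
  · rw [Fin.lastCases_castSucc]; simp only [Fin.val_castSucc]; have := t.2; simp; omega

@[simp] theorem collapse_headIdx {m n r : ℕ} (hr : r = m + n) (j : Fin (n + 1)) :
    collapse hr (headIdx hr j) = 0 :=
  (collapse_eq_zero hr _).2 ⟨j, rfl⟩

@[simp] theorem collapse_tailIdx {m n r : ℕ} (hr : r = m + n) (t : Fin m) :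
    collapse hr (tailIdx hr t) = t.succ := by
  ext; simp only [collapse, tailIdx, Fin.val_succ]; omega

/-- Permuting the arguments of `f` other than the first permutes the tail of the composite and
leaves its head alone. The permutation `σ` is given by its values on head and tail so that no
explicit formula for it is needed. -/
theorem Poly.subst_act_left {m n r : ℕ} (hr : r = m + n) (f : Poly k H (m + 1) L M)
    (g : Poly k H (n + 1) L L) (τ : Equiv.Perm (Fin m)) (σ : Equiv.Perm (Fin (r + 1)))
    (h1 : ∀ j, σ (headIdx hr j) = headIdx hr j) (h2 : ∀ t, σ (tailIdx hr t) = tailIdx hr (τ t)) :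
    Poly.subst hr (Poly.act (shiftPerm τ) f) g = Poly.act σ (Poly.subst hr f g) := by
  refine Poly.ext fun x => ?_
  rw [Poly.act_apply, Poly.subst_apply, Poly.subst_apply]
  simp only [Function.comp_apply, h1, h2]
  refine PT.graft_rel (B := Poly.first f fun t => x (tailIdx hr (τ t))) ((shiftPerm τ)⁻¹ : Equiv.Perm (Fin (m + 1))) _
    (fun v => ?_) (fun t => ?_) (fun s => ?_) (fun s hs => ?_) _
  · change PT.perm (shiftPerm τ) (f.1 _) = PT.perm (shiftPerm τ) (f.1 _)
    congr 2
    funext t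
    refine Fin.cases ?_ (fun t => ?_) t <;> simp
  · obtain ⟨s, rfl⟩ := σ.surjective t
    rw [perm_inv_apply, Equiv.Perm.inv_eq_iff_eq]
    rcases head_or_tail hr s with ⟨j, rfl⟩ | ⟨j, rfl⟩
    · rw [h1, collapse_headIdx, shiftPerm_zero]
    · rw [h2, collapse_tailIdx, collapse_tailIdx, shiftPerm_succ]
  · rw [Equiv.Perm.inv_eq_iff_eq]
    exact (h1 s).symm
  · rwa [Equiv.Perm.inv_eq_iff_eq, shiftPerm_zero] at hs

theorem Poly.subst_act_right {m n r : ℕ} (hr : r = m + n) (f : Poly k H (m + 1) L M)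
    (g : Poly k H (n + 1) L L) (τ : Equiv.Perm (Fin (n + 1))) (σ : Equiv.Perm (Fin (r + 1)))
    (h1 : ∀ j, σ (headIdx hr j) = headIdx hr (τ j)) (h2 : ∀ t, σ (tailIdx hr t) = tailIdx hr t) :
    Poly.subst hr f (Poly.act τ g) = Poly.act σ (Poly.subst hr f g) := by
  refine Poly.ext fun x => ?_
  rw [Poly.act_apply, Poly.subst_apply, Poly.subst_apply, Poly.act_apply]
  simp only [Function.comp_apply, h1, h2]
  refine PT.graft_pull _ (τ⁻¹ : Equiv.Perm (Fin (n + 1))) (σ⁻¹ : Equiv.Perm (Fin (r + 1)))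
    (fun t => ?_) (fun s => ?_) _
  · obtain ⟨s, rfl⟩ := σ.surjective t
    rw [perm_inv_apply]
    rcases head_or_tail hr s with ⟨j, rfl⟩ | ⟨j, rfl⟩
    · rw [h1, collapse_headIdx, collapse_headIdx]
    · rw [h2]
  · rw [Equiv.Perm.inv_eq_iff_eq]
    change headIdx hr s = σ (headIdx hr _)
    rw [h1, perm_apply_inv]

theorem PBil.after_apply (ζ : PBil k H L M N) {p : ℕ} (f : Poly k H p L M) (x) :
    (PBil.after ζ f).1 x = PBil.insR ζ p (x 0) (f.1 fun t => x t.succ) := rfl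

theorem PBil.after_act (ζ : PBil k H L M N) {p : ℕ} (τ : Equiv.Perm (Fin p))
    (f : Poly k H p L M) :
    PBil.after ζ (Poly.act τ f) = Poly.act (shiftPerm τ) (PBil.after ζ f) := by
  refine Poly.ext fun x => ?_
  rw [Poly.act_apply, PBil.after_apply, PBil.after_apply, Poly.act_apply]
  have h0 : (fun t => (x ∘ shiftPerm τ) (Fin.succ t)) = (fun t : Fin p => x t.succ) ∘ τ := by
    funext t; simp
  rw [h0, Function.comp_apply, shiftPerm_zero]
  refine PT.graft_pull _ (τ⁻¹ : Equiv.Perm (Fin p))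
    ((shiftPerm τ)⁻¹ : Equiv.Perm (Fin (p + 1))) (fun t => ?_) (fun s => ?_) _
  · rw [shiftPerm_inv]
    refine Fin.cases ?_ (fun t => ?_) t <;> simp
  · rw [shiftPerm_inv, shiftPerm_succ]

/-- This is the sequential composition axiom of an operad, obtained from `PT.graft_graft` by
checking the position maps. The three sums of arities are separate hypotheses so that either
bracketing can be stated without casts. -/
theorem Poly.subst_assoc {m n p r s r' : ℕ} (h₁ : r = m + n) (h₂ : s = r + p) (h₁' : r' = n + p)
    (h₂' : s = m + r') (f : Poly k H (m + 1) L M) (g : Poly k H (n + 1) L L)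
    (h : Poly k H (p + 1) L L) :
    Poly.subst h₂ (Poly.subst h₁ f g) h = Poly.subst h₂' f (Poly.subst h₁' g h) := by
  refine Poly.ext fun x => ?_
  rw [Poly.subst_apply, Poly.subst_apply, Poly.subst_apply]
  refine PT.graft_graft (φ := collapse h₁) (e := Fin.castLE (by omega))
    (he := Fin.castLE_injective _) (hφ := collapse_eq_zero h₁)
    (B := Poly.first f fun t => x (tailIdx h₂' t))
    (C := Poly.first g fun t => x (headIdx h₂' (tailIdx h₁' t)))
    (fun v => ?_) (fun s => ?_) (fun t => ?_) (fun s => ?_) _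
  · change (Poly.subst h₁ f g).1 _ = Poly.ins h₁ f _ (g.1 _)
    rw [Poly.subst_apply]
    have e1 : (fun t => (Fin.cons v fun t => x (tailIdx h₂ t) : Fin (r + 1) → L) (tailIdx h₁ t)) =
        fun t => x (tailIdx h₂' t) := by
      funext t
      have : tailIdx h₁ t = Fin.succ ⟨n + t, by omega⟩ := by
        ext; simp only [tailIdx, Fin.val_succ]; omega
      rw [this, Fin.cons_succ]
      congr 1
      ext; simp only [tailIdx]; omega
    have e2 : (fun t => (Fin.cons v fun t => x (tailIdx h₂ t) : Fin (r + 1) → L) (headIdx h₁ t)) =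
        Fin.cons v fun t => x (headIdx h₂' (tailIdx h₁' t)) := by
      funext t
      refine Fin.cases ?_ (fun t => ?_) t
      · rfl
      · have : headIdx h₁ t.succ = Fin.succ ⟨t, by omega⟩ := rfl
        rw [this, Fin.cons_succ, Fin.cons_succ]
        rfl
    rw [e1, e2]
  · rfl
  · ext; simp only [collapse]; omega
  · ext; simp only [collapse, Fin.val_castLE]

end Equivariance

/-! ### The representation identity with a polylinear map in the module argument. -/

section CompositionIdentities

variable {k H : Type*} [Field k] [Ring H] [HopfAlgebra k H] [Coalgebra.IsCocomm k H]
variable {L M N : Type*}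
  [AddCommGroup L] [Module k L] [Module H L] [IsScalarTower k H L]
  [AddCommGroup M] [Module k M] [Module H M] [IsScalarTower k H M]
  [AddCommGroup N] [Module k N] [Module H N] [IsScalarTower k H N]

theorem val_swap {n : ℕ} (i j t : Fin n) : (Equiv.swap i j t).val =
    if t.val = i.val then j.val else if t.val = j.val then i.val else t.val := by
  simp only [Equiv.swap_apply_def, Fin.ext_iff, apply_ite Fin.val]

/-- `x ↦ ζ (x, z)` for `z ∈ H^{⊗ q} ⊗_H M`. -/
def PBil.insRHom (ζ : PBil k H L M N) (q : ℕ) (z : PT k H q M) : SlotHom k H (q + 1) 0 L N where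
  val :=
    { toFun := fun x => PBil.insR ζ q x z
      map_add' := fun x y => PBil.insR_add ζ q x y z
      map_smul' := fun c x => by
        have := PBil.insR_smul ζ q x (algebraMap k H c) z
        simpa [algebraMap_smul] using this }
  property := fun h x => PBil.insR_smul ζ q x h z

theorem PBil.insR_mk (ζ : PBil k H L M N) (q : ℕ) (x : L) (a : Tn k H q) (y : M) :
    PBil.insR ζ q x (PT.mk a y) = emb Fin.succ (Fin.succ_injective q) a •
      PT.pull (k := k) (H := H) (fun t : Fin (q + 1) => Fin.cases 0 (fun _ => 1) t) (ζ.1 x y) :=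
  PT.graft_mk _ _ _ _ _ _ a y

/-- Collapses the positions `2, 3, …` to `2`. -/
def clampTwo {p : ℕ} (t : Fin (p + 2)) : Fin 3 := ⟨min t.val 2, by omega⟩

theorem succ_succ_injective (p : ℕ) : Function.Injective fun s : Fin p => s.succ.succ :=
  fun _ _ h => Fin.succ_injective _ (Fin.succ_injective _ h)

/-- The coefficient `a` rides along unchanged on the positions from `2` on, so the double action is
governed by the computation with three tensor factors, pulled back along `clampTwo`. -/
theorem PBil.insR_insR_mk (ζ : PBil k H L M M) {p : ℕ} (u v : L) (a : Tn k H p) (x : M) :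
    PBil.insR ζ (p + 1) u (PBil.insR ζ p v (PT.mk a x)) = emb _ (succ_succ_injective p) a •
      PT.pull (k := k) (H := H) clampTwo (PBil.insR ζ 2 u (ζ.1 v x)) := by
  rw [PBil.insR_mk, PBil.insR, PT.graft_smul_tn,
    emb_emb _ _ _ _ _ (succ_succ_injective p) (fun _ => rfl)]
  congr 1
  refine PT.graft_pull _ _ clampTwo (fun t => ?_) (fun s => ?_) _
  · ext; simp only [val_cases_zero_one, clampTwo]; omega
  · ext; simp only [val_cases_zero_one, clampTwo, Fin.val_succ]; omega

theorem PBil.insRHom_mk_apply (ζ : PBil k H L M N) {p : ℕ} (a : Tn k H p) (x : M) (v : L) :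
    (PBil.insRHom ζ p (PT.mk a x)).1 v = emb Fin.succ (Fin.succ_injective p) a •
      PT.pull (k := k) (H := H) (fun t : Fin (p + 1) => Fin.cases 0 (fun _ => 1) t)
        ((PBil.left ζ x).1 v) :=
  PBil.insR_mk ζ p v a x

theorem lastCases_eq_zero (j : Fin 3) :
    (Fin.lastCases 1 (fun _ => 0) j : Fin 2) = 0 ↔ j ∈ Set.range (Fin.castSucc (n := 2)) := by
  rw [Fin.ext_iff, val_lastCases_one_zero, Fin.val_zero]
  constructor
  · intro h
    exact ⟨⟨j.val, by omega⟩, rfl⟩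
  · rintro ⟨i, rfl⟩
    rw [Fin.val_castSucc]
    omega

theorem PBil.ins_insRHom_mk (ζ : PBil k H L M N) {p : ℕ} (w : PT k H 2 L) (a : Tn k H p) (x : M) :
    PT.graft (collapse (rfl : p + 1 = p + 1)) 0 (Fin.castLE (by omega)) (Fin.castLE_injective _)
      (collapse_eq_zero rfl) (PBil.insRHom ζ p (PT.mk a x)) w =
    emb _ (succ_succ_injective p) a •
      PT.pull (k := k) (H := H) clampTwo (PBil.insL ζ 2 x w) := by
  have key := PT.graft_smul_pull (φ := fun i : Fin 3 => Fin.lastCases 1 (fun _ => 0) i)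
    (i := 0) (e := Fin.castSucc) (he := Fin.castSucc_injective 2)
    (hφ := lastCases_eq_zero)
    (φ' := collapse (rfl : p + 1 = p + 1)) (i' := 0) (e' := Fin.castLE (by omega))
    (he' := Fin.castLE_injective _) (hφ' := collapse_eq_zero rfl)
    (B := PBil.left ζ x) (B' := PBil.insRHom ζ p (PT.mk a x))
    (fun t : Fin (p + 1) => Fin.cases 0 (fun _ => 1) t) clampTwo (ε := Fin.succ)
    (hε := Fin.succ_injective p) (ε' := fun s : Fin p => s.succ.succ)
    (hε' := succ_succ_injective p) a
  refine key (PBil.insRHom_mk_apply ζ a x) (fun t => ?_) (fun s => ?_) (fun s hs => ?_)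
    (fun s t => ?_) (fun s s' hss => ?_) w
  · ext; simp only [val_cases_zero_one, val_lastCases_one_zero, clampTwo, collapse]; omega
  · ext; simp only [clampTwo, Fin.val_castLE, Fin.val_castSucc]; omega
  · have := congrArg Fin.val hs
    rw [val_cases_zero_one, Fin.val_zero] at this
    exact Fin.ext (by rw [Fin.val_zero]; omega)
  · simp only [Fin.ext_iff, collapse, Fin.val_succ]; omega
  · have := congrArg Fin.val hss
    simp only [Fin.val_castLE, Fin.val_succ] at this
    omega

/-- The transposition fixes the positions from `2` on, where `a` sits, and commutes with the
collapse of these positions. -/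
theorem PT.perm_swap_emb_pull {p : ℕ} (a : Tn k H p) (w : PT k H 3 M) :
    PT.perm (Equiv.swap (0 : Fin (p + 2)) 1) (emb _ (succ_succ_injective p) a •
      PT.pull (k := k) (H := H) clampTwo w) = emb _ (succ_succ_injective p) a •
      PT.pull (k := k) (H := H) clampTwo (PT.perm (Equiv.swap 0 1) w) := by
  rw [PT.perm, PT.perm, PT.pull_smul, PT.pull_pull, PT.pull_pull,
    delta_emb' _ (succ_succ_injective p) _ (succ_succ_injective p)]
  · congr 3
    funext t
    ext
    simp only [Equiv.swap_inv, clampTwo, val_swap, Fin.val_zero, Fin.val_one]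
    grind
  · intro s t
    simp only [Equiv.swap_inv, Fin.ext_iff, val_swap, Fin.val_zero, Fin.val_one, Fin.val_succ]
    grind

/-- On pure elements `a ⊗_H x` all three terms have the same coefficient and the same pull-back, so
the identity reduces to the axiom `IsRep` for `x`; the general case follows by additivity. -/
theorem IsRep.ins {μ : PBil k H L L L} {ζ : PBil k H L M M} (h : IsRep μ ζ) {p : ℕ} (u v : L)
    (z : PT k H p M) :
    PT.graft (collapse (rfl : p + 1 = p + 1)) 0 (Fin.castLE (by omega)) (Fin.castLE_injective _)
      (collapse_eq_zero rfl) (PBil.insRHom ζ p z) (μ.1 u v) =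
    PBil.insR ζ (p + 1) u (PBil.insR ζ p v z) -
      PT.perm (Equiv.swap 0 1) (PBil.insR ζ (p + 1) v (PBil.insR ζ p u z)) := by
  induction z using PT.induction with
  | h0 =>
    have h0 : PBil.insRHom ζ p (0 : PT k H p M) = 0 :=
      Subtype.ext (LinearMap.ext fun x => map_zero (PBil.insR ζ p x))
    rw [h0, PT.graft_zero_hom]
    simp
  | hadd z w hz hw =>
    have h0 : PBil.insRHom ζ p (z + w) = PBil.insRHom ζ p z + PBil.insRHom ζ p w :=
      Subtype.ext (LinearMap.ext fun x => map_add (PBil.insR ζ p x) z w)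
    rw [h0, PT.graft_add, hz, hw]
    simp only [map_add]
    abel
  | hmk a x =>
    rw [PBil.insR_insR_mk, PBil.insR_insR_mk, PBil.ins_insRHom_mk, h u v x, map_sub, smul_sub,
      PT.perm_swap_emb_pull]

/-- The representation axiom as an identity between operations: substituting the bracket into the
acting argument gives the commutator of two successive actions. Its alternation supplies the
relation between the two halves of the coboundary. -/
theorem IsRep.subst_after {μ : PBil k H L L L} {ζ : PBil k H L M M} (h : IsRep μ ζ) {p : ℕ}
    (f : Poly k H p L M) : Poly.subst rfl (PBil.after ζ f) (PBil.toPoly μ) =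
      PBil.after ζ (PBil.after ζ f) -
        Poly.act (Equiv.swap 0 1) (PBil.after ζ (PBil.after ζ f)) := by
  refine Poly.ext fun x => ?_
  rw [Poly.sub_apply, Poly.act_apply, PBil.after_apply, PBil.after_apply, PBil.after_apply,
    PBil.after_apply]
  have e1 : (fun t : Fin p => (x ∘ Equiv.swap 0 1) (Fin.succ (Fin.succ t))) =
      fun t : Fin p => x t.succ.succ := by
    funext t
    exact congrArg x (Equiv.swap_apply_of_ne_of_ne (Fin.succ_ne_zero _) fun h =>
      Fin.succ_ne_zero _ (Fin.succ_injective _ h))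
  have e2 : (x ∘ Equiv.swap 0 1) 0 = x 1 := by simp
  have e3 : (x ∘ Equiv.swap 0 1) (Fin.succ 0) = x 0 := by
    exact congrArg x (Equiv.swap_apply_right 0 1)
  rw [e1, e2, e3]
  refine Eq.trans ?_ (h.ins (x 0) (x 1) (f.1 fun t => x t.succ.succ))
  refine PT.graft_congr (hφ := collapse_eq_zero rfl) (fun _ => rfl) rfl (fun _ => rfl) (fun v => ?_) _
  change (PBil.after ζ f).1 _ = _
  rw [PBil.after_apply, Fin.cons_zero]
  have e4 : (fun t : Fin p => (Fin.cons v fun t => x (tailIdx (rfl : p + 1 = p + 1) t) :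
      Fin (p + 1) → L) t.succ) = fun t => x t.succ.succ := by
    funext t
    rw [Fin.cons_succ]
    congr 1
    ext; simp only [tailIdx, Fin.val_succ]; omega
  rw [e4]
  rfl

end CompositionIdentities

/-! ### Substitution into an argument of the cochain inside an action. -/

section CompositionIdentities

variable {k H : Type*} [Field k] [Ring H] [HopfAlgebra k H] [Coalgebra.IsCocomm k H]
variable {L M N : Type*}
  [AddCommGroup L] [Module k L] [Module H L] [IsScalarTower k H L]
  [AddCommGroup M] [Module k M] [Module H M] [IsScalarTower k H M]
  [AddCommGroup N] [Module k N] [Module H N] [IsScalarTower k H N]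

/-- The cycle `0 ↦ 2 ↦ 1 ↦ 0`. -/
def threeCycle (m : ℕ) : Equiv.Perm (Fin (m + 3)) := Equiv.swap 1 2 * Equiv.swap 0 1

theorem sign_threeCycle (m : ℕ) : Equiv.Perm.sign (threeCycle m) = 1 := by
  rw [threeCycle, Equiv.Perm.sign_mul, Equiv.Perm.sign_swap, Equiv.Perm.sign_swap]
  · rfl
  · exact Fin.ne_of_val_ne (by simp)
  · exact Fin.ne_of_val_ne (by rw [Fin.val_one, Fin.val_two]; decide)

theorem val_threeCycle {m : ℕ} (t : Fin (m + 3)) : (threeCycle m t).val =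
    if t.val = 0 then 2 else if t.val = 1 then 0 else if t.val = 2 then 1 else t.val := by
  rw [threeCycle, Equiv.Perm.mul_apply, val_swap, val_swap]
  simp only [Fin.val_zero, Fin.val_one, Fin.val_two]
  grind

theorem val_threeCycle_inv {m : ℕ} (t : Fin (m + 3)) :
    ((threeCycle m)⁻¹ t).val =
      if t.val = 0 then 1 else if t.val = 1 then 2 else if t.val = 2 then 0 else t.val := by
  rw [threeCycle, mul_inv_rev, Equiv.Perm.mul_apply, Equiv.swap_inv, Equiv.swap_inv, val_swap,
    val_swap]
  simp only [Fin.val_zero, Fin.val_one, Fin.val_two]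
  grind

/-- The positions other than `1`. -/
def skipOne {m : ℕ} (s : Fin (m + 1)) : Fin (m + 2) := if s.val = 0 then 0 else s.succ

/-- Collapses the positions other than `a` to `1` and moves `a` to `0`. -/
def collapseOthers (a : ℕ) {n : ℕ} (t : Fin n) : Fin 2 := if t.val = a then 0 else 1

theorem val_skipOne {m : ℕ} (s : Fin (m + 1)) :
    (skipOne s).val = if s.val = 0 then 0 else s.val + 1 := by
  rw [skipOne]
  split_ifs <;> simp

theorem val_collapseOthers (a : ℕ) {n : ℕ} (t : Fin n) :
    (collapseOthers a t).val = if t.val = a then 0 else 1 := by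
  rw [collapseOthers]
  split_ifs <;> rfl

theorem skipOne_injective (m : ℕ) : Function.Injective (skipOne (m := m)) := by
  intro s t hst
  have := congrArg Fin.val hst
  rw [val_skipOne, val_skipOne] at this
  ext
  grind

theorem collapseOthers_eq_one (a : ℕ) {n : ℕ} (t : Fin n) :
    collapseOthers a t = 1 ↔ t.val ≠ a := by
  rw [Fin.ext_iff, val_collapseOthers, Fin.val_one]
  grind

theorem collapseOthers_one_eq_one {m : ℕ} (j : Fin (m + 2)) :
    collapseOthers 1 j = 1 ↔ j ∈ Set.range (skipOne (m := m)) := by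
  rw [collapseOthers_eq_one]
  constructor
  · intro h
    by_cases h0 : j.val = 0
    · exact ⟨0, by ext; rw [val_skipOne]; simp [h0]⟩
    · refine ⟨⟨j.val - 1, by omega⟩, ?_⟩
      ext
      rw [val_skipOne]
      grind
  · rintro ⟨s, rfl⟩
    rw [val_skipOne]
    grind

theorem val_threeCycle_succ {m : ℕ} (s : Fin (m + 2)) : (threeCycle m s.succ).val =
    if s.val = 0 then 0 else if s.val = 1 then 1 else s.val + 1 := by
  rw [val_threeCycle, Fin.val_succ]
  grind

theorem threeCycle_succ_injective (m : ℕ) :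
    Function.Injective fun s : Fin (m + 2) => threeCycle m s.succ :=
  fun _ _ h => Fin.succ_injective _ ((threeCycle m).injective h)

theorem collapseOthers_two_eq_one {m : ℕ} (j : Fin (m + 3)) :
    collapseOthers 2 j = 1 ↔ j ∈ Set.range fun s : Fin (m + 2) => threeCycle m s.succ := by
  rw [collapseOthers_eq_one]
  obtain ⟨t, rfl⟩ := (threeCycle m).surjective j
  refine Fin.cases ?_ (fun t => ?_) t
  · rw [val_threeCycle]
    simp only [Fin.val_zero, if_true, ne_eq, not_true, false_iff]
    rintro ⟨s, hs⟩
    exact Fin.succ_ne_zero _ ((threeCycle m).injective hs)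
  · rw [val_threeCycle_succ]
    simp only [Set.mem_range_self, iff_true]
    grind

/-- After the transposition the first argument feeds `f` and the second acts through `ζ`. This
exhibits the operation as an insertion of a value of `f` into the module argument of `ζ`, the form
to which `PT.graft_graft` applies. -/
theorem PBil.first_act_swap_after (ζ : PBil k H L M N) {m : ℕ} (f : Poly k H (m + 1) L M)
    (y : Fin (m + 1) → L) (v : L) :
    (Poly.first (Poly.act (Equiv.swap 0 1) (PBil.after ζ f)) y).1 v =
      PT.graft (collapseOthers 1) 1 skipOne (skipOne_injective m) collapseOthers_one_eq_one
        (PBil.right ζ (y 0)) ((Poly.first f fun t => y t.succ).1 v) := by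
  change PT.perm (Equiv.swap (0 : Fin (m + 2)) 1) (PBil.insR ζ (m + 1)
    ((Fin.cons v y ∘ Equiv.swap 0 1 : Fin (m + 2) → L) 0)
    (f.1 fun t => (Fin.cons v y ∘ Equiv.swap 0 1 : Fin (m + 2) → L) (Fin.succ t))) = _
  have e4 : (Fin.cons v y ∘ Equiv.swap 0 1 : Fin (m + 2) → L) 0 = y 0 := by
    simp only [Function.comp_apply, Equiv.swap_apply_left]; rfl
  have e5 : (fun t => (Fin.cons v y ∘ Equiv.swap 0 1 : Fin (m + 2) → L) (Fin.succ t)) =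
      Fin.cons v fun t => y t.succ := by
    funext t
    refine Fin.cases ?_ (fun t => ?_) t
    · change (Fin.cons v y : Fin (m + 2) → L) (Equiv.swap 0 1 1) = v
      simp
    · simp only [Function.comp_apply]
      rw [Equiv.swap_apply_of_ne_of_ne (Fin.succ_ne_zero _), Fin.cons_succ, Fin.cons_succ]
      intro h
      have := congrArg Fin.val h
      simp only [Fin.val_succ, Fin.val_one] at this
      omega
  rw [e4, e5]
  refine (PT.graft_reindex (PBil.right ζ (y 0)) (Equiv.swap (0 : Fin (m + 2)) 1)⁻¹.toFun (fun t => ?_)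
    (fun s => ?_) (f.1 (Fin.cons v fun t => y t.succ))).symm
  · ext
    change (Fin.cases 0 (fun _ => 1) ((Equiv.swap 0 1)⁻¹ t) : Fin 2).val = _
    rw [val_cases_zero_one, Equiv.swap_inv, val_swap, val_collapseOthers, Fin.val_zero,
      Fin.val_one]
    grind
  · ext
    change ((Equiv.swap (0 : Fin (m + 2)) 1)⁻¹ (skipOne s)).val = _
    rw [Equiv.swap_inv, val_swap, val_skipOne, Fin.val_zero, Fin.val_one, Fin.val_succ]
    grind

/-- Substitution into the second argument of `(x₀, …) ↦ ζ (x₀, f (x₁, …))`. -/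
theorem PBil.subst_act_swap_after (ζ : PBil k H L M N) {m : ℕ}
    (f : Poly k H (m + 1) L M) (g : Poly k H 2 L L) :
    Poly.subst rfl (Poly.act (Equiv.swap 0 1) (PBil.after ζ f)) g =
      Poly.act (threeCycle m) (PBil.after ζ (Poly.subst (m := m) (n := 1) rfl f g)) := by
  refine Poly.ext fun x => ?_
  rw [Poly.act_apply, PBil.after_apply, Poly.subst_apply, Poly.subst_apply]
  have e1 : (fun j => (x ∘ threeCycle m) (Fin.succ (headIdx (rfl : m + 1 = m + 1) j))) =
      fun j : Fin 2 => x (headIdx (rfl : m + 1 + 1 = m + 1 + 1) j) := by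
    funext j
    refine congrArg x (Fin.ext ((val_threeCycle_succ _).trans ?_))
    simp only [headIdx, Fin.val_castLE]
    grind
  have e2 : (fun j => (x ∘ threeCycle m) (Fin.succ (tailIdx (rfl : m + 1 = m + 1) j))) =
      fun j : Fin m => x (tailIdx (rfl : m + 1 + 1 = m + 1 + 1) j.succ) := by
    funext j
    refine congrArg x (Fin.ext ((val_threeCycle_succ _).trans ?_))
    simp only [tailIdx, Fin.val_succ]
    grind
  have e3 : (x ∘ threeCycle m) 0 = x (tailIdx (rfl : m + 1 + 1 = m + 1 + 1) 0) := by
    refine congrArg x (Fin.ext ((val_threeCycle _).trans ?_))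
    simp [tailIdx]
  rw [e1, e2, e3]
  have key := PT.graft_graft (χ := collapse (rfl : m + 1 = m + 1)) (ε := Fin.castLE (by omega))
    (hε := Fin.castLE_injective _) (hχ := collapse_eq_zero rfl) (φ₂ := collapseOthers 2)
    (e₂ := fun s : Fin (m + 2) => threeCycle m s.succ)
    (he₂ := threeCycle_succ_injective m) (hφ₂ := collapseOthers_two_eq_one)
    (PBil.first_act_swap_after ζ f fun t => x (tailIdx (rfl : m + 1 + 1 = m + 1 + 1) t))
    (φ₁ := collapse (rfl : m + 2 = m + 1 + 1)) (e₁ := Fin.castLE (by omega))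
    (he₁ := Fin.castLE_injective _) (hφ₁ := collapse_eq_zero rfl)
  refine (key (fun s => ?_) (fun t => ?_) (fun s => ?_) _).trans ?_
  · ext
    rw [val_threeCycle_succ]
    simp only [Fin.val_castLE]
    grind
  · ext
    rw [val_collapseOthers, val_collapseOthers]
    simp only [collapse]
    grind
  · ext
    rw [val_skipOne]
    simp only [collapse, val_threeCycle_succ]
    grind
  · refine PT.graft_reindex _ ((threeCycle m)⁻¹ : Equiv.Perm (Fin (m + 3))) (fun t => ?_)
      (fun s => ?_) _
    · ext
      rw [val_cases_zero_one, val_threeCycle_inv, val_collapseOthers]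
      grind
    · exact perm_inv_apply (threeCycle m) s.succ

end CompositionIdentities

/-! ### Block permutations acting on a substitution. -/

section BlockPermutations

variable {k H : Type*} [Field k] [Ring H] [HopfAlgebra k H] [Coalgebra.IsCocomm k H]
variable {L M : Type*}
  [AddCommGroup L] [Module k L] [Module H L] [IsScalarTower k H L]
  [AddCommGroup M] [Module k M] [Module H M] [IsScalarTower k H M]

theorem exists_perm_head_tail {m n r : ℕ} (hr : r = m + n) (τ' : Equiv.Perm (Fin (n + 1)))
    (τ : Equiv.Perm (Fin m)) : ∃ σ : Equiv.Perm (Fin (r + 1)),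
      (∀ j, σ (headIdx hr j) = headIdx hr (τ' j)) ∧ (∀ t, σ (tailIdx hr t) = tailIdx hr (τ t)) ∧
      Equiv.Perm.sign σ = Equiv.Perm.sign τ' * Equiv.Perm.sign τ := by
  let e : Fin (n + 1) ⊕ Fin m ≃ Fin (r + 1) := finSumFinEquiv.trans (finCongr (by omega))
  have h1 : ∀ j, headIdx hr j = e (Sum.inl j) := fun j => by
    ext; simp [e, headIdx]
  have h2 : ∀ t, tailIdx hr t = e (Sum.inr t) := fun t => by
    ext; simp [e, tailIdx]
  refine ⟨e.permCongr (Equiv.Perm.sumCongr τ' τ), fun j => ?_, fun t => ?_, ?_⟩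
  · rw [h1, h1]; simp [Equiv.permCongr_apply]
  · rw [h2, h2]; simp [Equiv.permCongr_apply]
  · rw [Equiv.Perm.sign_permCongr, Equiv.Perm.sign_sumCongr]

theorem perm_eq_of_head_tail {m n r : ℕ} (hr : r = m + n) {σ τ : Equiv.Perm (Fin (r + 1))}
    (h1 : ∀ j, σ (headIdx hr j) = τ (headIdx hr j))
    (h2 : ∀ t, σ (tailIdx hr t) = τ (tailIdx hr t)) : σ = τ := by
  refine Equiv.ext fun i => ?_
  rcases head_or_tail hr i with ⟨j, rfl⟩ | ⟨t, rfl⟩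
  · exact h1 j
  · exact h2 t

theorem exists_of_mem_blockPerms {m n r : ℕ} (hr : r = m + n) {κ : Equiv.Perm (Fin (r + 1))}
    (hκ : κ ∈ blockPerms (n + 1) (r + 1)) :
    ∃ (τ' : Equiv.Perm (Fin (n + 1))) (τ : Equiv.Perm (Fin m)),
      (∀ j, κ (headIdx hr j) = headIdx hr (τ' j)) ∧ (∀ t, κ (tailIdx hr t) = tailIdx hr (τ t)) := by
  rw [mem_blockPerms] at hκ
  have h1 : ∀ j : Fin (n + 1), ∃ j', κ (headIdx hr j) = headIdx hr j' := fun j =>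
    ⟨⟨(κ (headIdx hr j)).val, (hκ _).2 j.2⟩, rfl⟩
  have h2 : ∀ t : Fin m, ∃ t', κ (tailIdx hr t) = tailIdx hr t' := fun t => by
    rcases head_or_tail hr (κ (tailIdx hr t)) with ⟨j, hj⟩ | h
    · have h3 := (hκ (tailIdx hr t)).1 (by rw [hj]; exact j.2)
      simp only [tailIdx] at h3
      omega
    · exact h
  choose a ha using h1
  choose b hb using h2
  have head_inj : Function.Injective (headIdx hr) :=
    Fin.castLE_injective (by omega : n + 1 ≤ r + 1)
  have tail_inj : Function.Injective (tailIdx hr) := fun s t h => by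
    have := congrArg Fin.val h
    simp only [tailIdx] at this
    exact Fin.ext (by omega)
  have ha' : Function.Injective a := fun i j h =>
    head_inj (κ.injective ((ha i).trans ((congrArg _ h).trans (ha j).symm)))
  have hb' : Function.Injective b := fun i j h =>
    tail_inj (κ.injective ((hb i).trans ((congrArg _ h).trans (hb j).symm)))
  exact ⟨Equiv.ofBijective a (Finite.injective_iff_bijective.1 ha'),
    Equiv.ofBijective b (Finite.injective_iff_bijective.1 hb'), ha, hb⟩

/-- If `f` is skew-symmetric in all arguments but the first, and `g` is skew-symmetric, then the
substitution of `g` into `f` is skew-symmetric in each of the two groups of arguments. -/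
theorem Poly.act_subst_of_skew {m n r : ℕ} (hr : r = m + n) {f : Poly k H (m + 1) L M}
    {g : Poly k H (n + 1) L L}
    (hf : ∀ τ : Equiv.Perm (Fin m), Poly.act (shiftPerm τ) f = (Equiv.Perm.sign τ : ℤ) • f)
    (hg : g ∈ Cochain k H L L (n + 1)) {κ : Equiv.Perm (Fin (r + 1))}
    (hκ : κ ∈ blockPerms (n + 1) (r + 1)) :
    Poly.act κ (Poly.subst hr f g) = (Equiv.Perm.sign κ : ℤ) • Poly.subst hr f g := by
  obtain ⟨τ', τ, h1, h2⟩ := exists_of_mem_blockPerms hr hκ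
  obtain ⟨σ, a1, a2, a3⟩ := exists_perm_head_tail hr τ' 1
  obtain ⟨ρ, b1, b2, b3⟩ := exists_perm_head_tail hr 1 τ
  -- A block permutation splits into one moving only the head, absorbed by the skew-symmetry of `g`,
  -- and one moving only the tail, absorbed by that of `f`.
  have hκ' : κ = σ * ρ := perm_eq_of_head_tail hr
    (fun j => by simp [h1, a1, b1]) (fun t => by simp [h2, a2, b2])
  have hl := Poly.subst_act_left hr f g τ ρ b1 b2
  have hr' := Poly.subst_act_right hr f g τ' σ a1 a2
  rw [hf τ] at hl
  rw [hg τ'] at hr'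
  have hl' : Poly.act ρ (Poly.subst hr f g) = (Equiv.Perm.sign τ : ℤ) • Poly.subst hr f g := by
    rw [← hl]
    exact DFunLike.congr_fun (map_zsmul (Poly.substₗ hr) (Equiv.Perm.sign τ : ℤ) f) g
  have hr'' : Poly.act σ (Poly.subst hr f g) = (Equiv.Perm.sign τ' : ℤ) • Poly.subst hr f g := by
    rw [← hr']
    exact map_zsmul (Poly.substₗ hr f) (Equiv.Perm.sign τ' : ℤ) g
  rw [hκ', Poly.act_mul, hl', map_zsmul, hr'', smul_smul, Equiv.Perm.sign_mul, a3, b3]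
  simp [mul_comm]

theorem Cochain.act_shiftPerm {m : ℕ} {f : Poly k H (m + 1) L M} (hf : f ∈ Cochain k H L M (m + 1))
    (τ : Equiv.Perm (Fin m)) : Poly.act (shiftPerm τ) f = (Equiv.Perm.sign τ : ℤ) • f := by
  rw [hf, sign_shiftPerm]

end BlockPermutations

/-! ### The Jacobi identity and nested brackets. -/

section Jacobi

variable {k H : Type*} [Field k] [Ring H] [HopfAlgebra k H] [Coalgebra.IsCocomm k H]
variable {L M : Type*}
  [AddCommGroup L] [Module k L] [Module H L] [IsScalarTower k H L]
  [AddCommGroup M] [Module k M] [Module H M] [IsScalarTower k H M]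

theorem PBil.toPoly_apply (μ : PBil k H L L M) (x : Fin 2 → L) :
    (PBil.toPoly μ).1 x = μ.1 (x 0) (x 1) := rfl

theorem perm_fin_two (σ : Equiv.Perm (Fin 2)) : σ = 1 ∨ σ = Equiv.swap 0 1 := by
  revert σ
  decide

theorem PBil.toPoly_mem {μ : PBil k H L L M}
    (h : ∀ x y, μ.1 x y = -PT.perm (Equiv.swap 0 1) (μ.1 y x)) :
    PBil.toPoly μ ∈ Cochain k H L M 2 := by
  intro σ
  rcases perm_fin_two σ with rfl | rfl
  · rw [Poly.act_one]; simp
  · refine Poly.ext fun x => ?_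
    rw [Equiv.Perm.sign_swap (by decide), Poly.act_apply, PBil.toPoly_apply]
    have : (((-1 : ℤˣ) : ℤ) • PBil.toPoly μ).1 x = -(PBil.toPoly μ).1 x := by
      rw [Units.val_neg, Units.val_one, neg_smul, one_smul]; rfl
    rw [this, PBil.toPoly_apply, h (x 0) (x 1), neg_neg]
    simp

/-- Skew-symmetry moves the inserted element from the second argument to the first, at the cost of a
sign and a cyclic rotation of the three tensor factors. This lets the Jacobi identity be written
with the single operation μ(μ(x₀, x₁), x₂). -/
theorem PBil.insR_eq_neg_insL {μ : PBil k H L L M}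
    (h : ∀ x y, μ.1 x y = -PT.perm (Equiv.swap 0 1) (μ.1 y x)) (x : L) (w : PT k H 2 L) :
    PBil.insR μ 2 x w = -PT.perm (threeCycle 0)⁻¹ (PBil.insL μ 2 x w) := by
  have h0 : ∀ v, (-(PBil.right μ x)).1 v =
      PT.pull (k := k) (H := H) (Equiv.swap (0 : Fin 2) 1)⁻¹.toFun ((PBil.left μ x).1 v) := by
    intro v
    change -(μ.1 x v) = PT.perm (Equiv.swap 0 1) (μ.1 v x)
    rw [h, neg_neg]
  have h1 : PBil.insR μ 2 x w = -PT.graft (Fin.cases 0 fun _ => 1) 1 Fin.succ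
      (Fin.succ_injective 2) (fun j => by refine Fin.cases ?_ (fun j => ?_) j <;> simp)
      (-(PBil.right μ x)) w :=
    PT.graft_neg_hom (fun v => (neg_neg _).symm) w
  rw [h1, neg_inj]
  have key := PT.graft_rel (φ' := fun t : Fin 3 => Fin.cases 0 (fun _ => 1) t) (i' := 1)
    (e' := Fin.succ) (he' := Fin.succ_injective 2)
    (hφ' := (fun j => by refine Fin.cases ?_ (fun j => ?_) j <;> simp))
    (φ := fun i : Fin 3 => Fin.lastCases 1 (fun _ => 0) i)
    (i := 0) (e := Fin.castSucc) (he := Fin.castSucc_injective 2)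
    (hφ := lastCases_eq_zero) (B := PBil.left μ x) (B' := -PBil.right μ x)
    (Equiv.swap (0 : Fin 2) 1)⁻¹.toFun
  refine (key ((threeCycle 0)⁻¹)⁻¹.toFun h0 (fun t => ?_) (fun s => ?_) (fun s hs => ?_) w)
  · rw [inv_inv, Equiv.swap_inv]
    change Equiv.swap (0 : Fin 2) 1 (Fin.cases 0 (fun _ => 1) t) =
      Fin.lastCases 1 (fun _ => 0) (threeCycle 0 t)
    ext
    rw [val_swap, val_cases_zero_one, val_lastCases_one_zero, val_threeCycle, Fin.val_zero,
      Fin.val_one]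
    grind
  · rw [inv_inv]
    change threeCycle 0 s.succ = s.castSucc
    ext
    rw [val_threeCycle_succ, Fin.val_castSucc]
    grind
  · rw [Equiv.swap_inv] at hs
    change Equiv.swap 0 1 s = 0 at hs
    revert hs
    revert s
    decide

theorem IsLiePseudo.jacobi_subst {μ : PBil k H L L L} (hμ : IsLiePseudo μ) :
    -Poly.act (threeCycle 0)⁻¹ (Poly.subst (m := 1) (n := 1) rfl (PBil.toPoly μ) (PBil.toPoly μ)) =
      Poly.subst (m := 1) (n := 1) rfl (PBil.toPoly μ) (PBil.toPoly μ) -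
      Poly.act (Equiv.swap 1 2)
        (Poly.subst (m := 1) (n := 1) rfl (PBil.toPoly μ) (PBil.toPoly μ)) := by
  have hJ : ∀ x : Fin 3 → L, (Poly.subst (m := 1) (n := 1) rfl (PBil.toPoly μ)
      (PBil.toPoly μ)).1 x = PBil.insL μ 2 (x 2) (μ.1 (x 0) (x 1)) := by
    intro x
    rw [Poly.subst_apply]
    refine PT.graft_congr (hφ := collapse_eq_zero rfl) (fun t => ?_) rfl (fun s => rfl)
      (fun v => rfl) _
    ext
    rw [val_lastCases_one_zero]
    rfl
  refine Poly.ext fun x => ?_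
  rw [Poly.neg_apply, Poly.sub_apply, Poly.act_apply, Poly.act_apply, hJ, hJ, hJ]
  have e0 : (threeCycle 0)⁻¹ 0 = 1 := by decide
  have e1 : (threeCycle 0)⁻¹ 1 = 2 := by decide
  have e2 : (threeCycle 0)⁻¹ 2 = 0 := by decide
  have f0 : Equiv.swap (1 : Fin 3) 2 0 = 0 := by decide
  simp only [Function.comp_apply, e0, e1, e2, f0, Equiv.swap_apply_left, Equiv.swap_apply_right]
  have h := hμ.2 (x 0) (x 1) (x 2)
  rw [PBil.insR_eq_neg_insL hμ.1, PBil.insR_eq_neg_insL hμ.1, map_neg, ← PT.perm_mul] at h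
  -- The last Jacobi term carries the transposition of the axiom and also the rotation coming from
  -- `PBil.insR_eq_neg_insL`; together they form one transposition.
  have e3 : Equiv.swap 0 1 * (threeCycle 0)⁻¹ = Equiv.swap 1 2 := by decide
  rw [e3] at h
  rw [h]
  abel

/-- By associativity the operation is `f` with J = μ(μ(x₀, x₁), x₂) inserted. In the Jacobi identity
for J the rotation is even and the transposition odd, so alternation gives -A = A + A for the
alternated operation A. Hence 3A = 0, and 3 is invertible. No symmetry of `f` enters. -/
theorem IsLiePseudo.alt_subst_subst [CharZero k] {μ : PBil k H L L L} (hμ : IsLiePseudo μ) {m : ℕ}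
    (f : Poly k H (m + 1) L M) :
    Poly.alt (Poly.subst (m := m + 1) (n := 1) rfl
      (Poly.subst (m := m) (n := 1) rfl f (PBil.toPoly μ)) (PBil.toPoly μ)) = 0 := by
  rw [Poly.subst_assoc (r' := 2) rfl rfl rfl rfl]
  set J := Poly.subst (m := 1) (n := 1) (r := 2) rfl (PBil.toPoly μ) (PBil.toPoly μ) with hJ
  have h1 : Poly.subst (m := m) (n := 2) rfl f (Poly.act (threeCycle 0)⁻¹ J) =
      Poly.act (threeCycle m)⁻¹ (Poly.subst rfl f J) := by
    refine Poly.subst_act_right _ f J _ _ (fun j => ?_) (fun t => ?_)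
    · ext
      rw [val_threeCycle_inv]
      simp only [headIdx, Fin.val_castLE]
      rw [val_threeCycle_inv]
      rfl
    · ext
      rw [val_threeCycle_inv]
      simp only [tailIdx]
      grind
  have h2 : Poly.subst (m := m) (n := 2) rfl f (Poly.act (Equiv.swap 1 2) J) =
      Poly.act (Equiv.swap 1 2) (Poly.subst rfl f J) := by
    refine Poly.subst_act_right _ f J _ _ (fun j => ?_) (fun t => ?_)
    · ext
      rw [val_swap]
      simp only [headIdx, Fin.val_castLE]
      rw [val_swap]
      simp only [Fin.val_one, Fin.val_two]
      rfl
    · ext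
      rw [val_swap]
      simp only [tailIdx, Fin.val_one, Fin.val_two]
      grind
  have h3 := congrArg (fun g => Poly.alt (Poly.substₗ (m := m) (n := 2) (r := m + 2) rfl f g))
    hμ.jacobi_subst
  simp only [map_neg, map_sub] at h3
  rw [← hJ] at h3
  change -Poly.alt (Poly.subst (m := m) (n := 2) rfl f (Poly.act (threeCycle 0)⁻¹ J)) =
    Poly.alt (Poly.subst (m := m) (n := 2) rfl f J) -
    Poly.alt (Poly.subst (m := m) (n := 2) rfl f (Poly.act (Equiv.swap 1 2) J)) at h3
  rw [h1, h2, Poly.alt_act, Poly.alt_act, Equiv.Perm.sign_inv, sign_threeCycle,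
    Equiv.Perm.sign_swap (Fin.ne_of_val_ne (by rw [Fin.val_one, Fin.val_two]; decide))] at h3
  simp only [Units.val_one, one_smul, Units.val_neg, neg_smul, sub_neg_eq_add] at h3
  have h4 : (3 : k) • Poly.alt (Poly.subst (m := m) (n := 2) rfl f J) = 0 := by
    rw [show (3 : k) = 1 + 1 + 1 by norm_num, add_smul, add_smul, one_smul, ← h3, neg_add_cancel]
  exact (smul_eq_zero.1 h4).resolve_left (by norm_num)

end Jacobi

/-! ### Brackets substituted into two different arguments. -/

section ParallelSubstitution

variable {k H : Type*} [Field k] [Ring H] [HopfAlgebra k H] [Coalgebra.IsCocomm k H]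
variable {L M : Type*}
  [AddCommGroup L] [Module k L] [Module H L] [IsScalarTower k H L]
  [AddCommGroup M] [Module k M] [Module H M] [IsScalarTower k H M]

/-- An operation with its tensor factors permuted. -/
def permSlot {m : ℕ} {i i' : Fin m} (σ : Equiv.Perm (Fin m)) (h : σ i = i')
    (B : SlotHom k H m i L M) : SlotHom k H m i' L M where
  val := PT.perm σ ∘ₗ B.1
  property := fun a x => by
    rw [LinearMap.comp_apply, B.2 a x, PT.perm_slot_smul, h]
    rfl

/-- `v ↦ f (z, v, y₀, …)` with the tensor factor of `v` moved to the first position and the two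
tensor factors of `z` in reverse order. -/
def Poly.insPair {m : ℕ} (f : Poly k H (m + 2) L M) (y : Fin m → L) (z : PT k H 2 L) :
    SlotHom k H (m + 3) 0 L M :=
  permSlot (i := 2) (Equiv.swap 0 2) (Equiv.swap_apply_right 0 2)
    { val :=
        { toFun := fun v => Poly.ins (m := m + 1) (n := 1) rfl f (Fin.cons v y) z
          map_add' := fun v w => by
            have := Poly.ins_update_add (m := m + 1) (n := 1) rfl f (Fin.cons 0 y) 0 v w z
            simpa using this
          map_smul' := fun c v => by
            have := Poly.ins_update_smul (m := m + 1) (n := 1) rfl f (Fin.cons v y) 0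
              (algebraMap k H c) z
            simpa [algebraMap_smul] using this }
      property := fun h v => by
        have := Poly.ins_update_smul (m := m + 1) (n := 1) rfl f (Fin.cons v y) 0 h z
        have e : tailIdx (rfl : m + 1 + 1 = m + 1 + 1) 0 = (2 : Fin (m + 3)) := rfl
        rw [e] at this
        simpa using this }

theorem Poly.insPair_apply {m : ℕ} (f : Poly k H (m + 2) L M) (y : Fin m → L) (z : PT k H 2 L)
    (v : L) : (Poly.insPair f y z).1 v = PT.perm (Equiv.swap 0 2)
      (Poly.ins (m := m + 1) (n := 1) rfl f (Fin.cons v y) z) := rfl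

theorem Poly.insPair_neg {m : ℕ} (f : Poly k H (m + 2) L M) (y : Fin m → L) (z : PT k H 2 L)
    (v : L) : (Poly.insPair f y (-z)).1 v = -(Poly.insPair f y z).1 v := by
  rw [Poly.insPair_apply, Poly.insPair_apply, map_neg, map_neg]

/-- `0, 1, 2, 3, 4, … ↦ 1, 0, 0, 2, 3, …` -/
def pairCollapse {m : ℕ} (t : Fin (m + 3)) : Fin (m + 2) :=
  collapse (m := m + 1) (n := 1) rfl (Equiv.swap 0 2 t)

/-- `0, 1, 2, 3, … ↦ 0, 1, 1, 2, …` -/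
def pairCollapse' {m : ℕ} (t : Fin (m + 3)) : Fin (m + 2) :=
  ⟨if t.val = 0 then 0 else if t.val = 1 then 1 else t.val - 1, by grind⟩

/-- `0, 1, 2, 3, 4, … ↦ 1, 2, 0, 0, 3, …` -/
def pairCollapse₂ {m : ℕ} (t : Fin (m + 4)) : Fin (m + 3) :=
  ⟨if t.val = 0 then 1 else if t.val = 1 then 2 else if t.val < 4 then 0 else t.val - 1, by grind⟩

theorem val_pairCollapse {m : ℕ} (t : Fin (m + 3)) : (pairCollapse t).val =
    if t.val = 0 then 1 else if t.val = 1 then 0 else if t.val = 2 then 0 else t.val - 1 := by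
  simp only [pairCollapse, collapse, val_swap, Fin.val_zero, Fin.val_two]
  grind

theorem val_pairCollapse' {m : ℕ} (t : Fin (m + 3)) : (pairCollapse' t).val =
    if t.val = 0 then 0 else if t.val = 1 then 1 else t.val - 1 := rfl

theorem val_pairCollapse₂ {m : ℕ} (t : Fin (m + 4)) : (pairCollapse₂ t).val =
    if t.val = 0 then 1 else if t.val = 1 then 2 else if t.val < 4 then 0 else t.val - 1 := rfl

/-- The embedding of two positions as `a - 1` and `a`, in reverse order. -/
def revPair {n : ℕ} (a : Fin (n + 1)) (s : Fin 2) : Fin (n + 1) := ⟨a.val - s.val, by omega⟩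

theorem revPair_injective {n : ℕ} {a : Fin (n + 1)} (ha : 1 ≤ a.val) :
    Function.Injective (revPair a) := by
  intro s t h
  have := congrArg Fin.val h
  simp only [revPair] at this
  ext
  omega

/-- The positions `1` and `2`. -/
def midPair {m : ℕ} (s : Fin 2) : Fin (m + 3) := ⟨s.val + 1, by omega⟩

theorem midPair_injective (m : ℕ) : Function.Injective (midPair (m := m)) := by
  intro s t h
  have := congrArg Fin.val h
  simp only [midPair] at this
  ext
  omega

theorem pairCollapse_eq_zero {m : ℕ} (t : Fin (m + 3)) :
    pairCollapse t = 0 ↔ t ∈ Set.range (midPair (m := m)) := by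
  rw [Fin.ext_iff, val_pairCollapse, Fin.val_zero]
  constructor
  · intro h
    refine ⟨⟨t.val - 1, by grind⟩, ?_⟩
    ext
    simp only [midPair]
    grind
  · rintro ⟨s, rfl⟩
    simp only [midPair]
    grind

theorem range_revPair_two (m : ℕ) (t : Fin (m + 3)) :
    t ∈ Set.range (revPair (2 : Fin (m + 3))) ↔ t ∈ Set.range (midPair (m := m)) := by
  constructor
  · rintro ⟨s, rfl⟩
    refine ⟨⟨1 - s.val, by omega⟩, ?_⟩
    ext
    simp only [midPair, revPair, Fin.val_two]
    omega
  · rintro ⟨s, rfl⟩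
    refine ⟨⟨1 - s.val, by omega⟩, ?_⟩
    ext
    simp only [midPair, revPair, Fin.val_two]
    omega

theorem pairCollapse'_eq_one {m : ℕ} (t : Fin (m + 3)) :
    pairCollapse' t = 1 ↔ t ∈ Set.range (midPair (m := m)) := by
  rw [Fin.ext_iff, val_pairCollapse', Fin.val_one]
  constructor
  · intro h
    refine ⟨⟨t.val - 1, by grind⟩, ?_⟩
    ext
    simp only [midPair]
    grind
  · rintro ⟨s, rfl⟩
    simp only [midPair]
    grind

theorem pairCollapse₂_eq_zero {m : ℕ} (t : Fin (m + 4)) :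
    pairCollapse₂ t = 0 ↔ t ∈ Set.range (revPair (⟨3, by omega⟩ : Fin (m + 4))) := by
  rw [Fin.ext_iff, val_pairCollapse₂, Fin.val_zero]
  constructor
  · intro h
    refine ⟨⟨3 - t.val, by grind⟩, ?_⟩
    ext
    simp only [revPair]
    grind
  · rintro ⟨s, rfl⟩
    simp only [revPair]
    grind

/-- The permutation in `Poly.insPair` is absorbed into the position maps, which leaves a plain
insertion into the first argument of `f`, as `PT.graft_comm` requires. -/
theorem Poly.insPair_eq_graft {m : ℕ} (f : Poly k H (m + 2) L M) (y : Fin m → L)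
    (z : PT k H 2 L) (v : L) : (Poly.insPair f y z).1 v =
      PT.graft pairCollapse 0 (revPair (2 : Fin (m + 3)))
        (revPair_injective (by rw [Fin.val_two]; omega))
        (fun t => (pairCollapse_eq_zero t).trans (range_revPair_two m t).symm)
        (Poly.first f (Fin.cons v y)) z := by
  rw [Poly.insPair_apply]
  refine (PT.graft_reindex (Poly.first f (Fin.cons v y))
    (Equiv.swap (0 : Fin (m + 3)) 2)⁻¹.toFun (fun t => ?_) (fun s => ?_) z).symm
  · rw [Equiv.swap_inv]; rfl
  · ext
    change ((Equiv.swap (0 : Fin (m + 3)) 2)⁻¹ (revPair 2 s)).val = s.val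
    rw [Equiv.swap_inv, val_swap, Fin.val_zero, Fin.val_two]
    simp only [revPair, Fin.val_two]
    grind

/-- Insertion of the swapped element agrees with insertion into the second argument. -/
theorem Poly.neg_insPair_swap {m : ℕ} (f : Poly k H (m + 2) L M)
    (y : Fin m → L) (w : PT k H 2 L) (v : L) :
    (-Poly.insPair f y (PT.perm (Equiv.swap 0 1) w)).1 v =
      PT.graft pairCollapse' 1 midPair (midPair_injective m) pairCollapse'_eq_one
        (-permSlot (Equiv.swap 0 1) (Equiv.swap_apply_left 0 1) (Poly.first f (Fin.cons v y))) w := by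
  have h0 : (Poly.insPair f y (PT.perm (Equiv.swap 0 1) w)).1 v =
      PT.graft pairCollapse 0 midPair (midPair_injective m) pairCollapse_eq_zero
        (Poly.first f (Fin.cons v y)) w := by
    rw [Poly.insPair_eq_graft]
    have key := PT.graft_pull (φ := pairCollapse) (φ' := pairCollapse) (he := midPair_injective m)
      (hφ := pairCollapse_eq_zero)
      (he' := revPair_injective (a := (2 : Fin (m + 3))) (by rw [Fin.val_two]; omega))
      (hφ' := fun t => (pairCollapse_eq_zero t).trans (range_revPair_two m t).symm)
      (Poly.first f (Fin.cons v y)) (Equiv.swap (0 : Fin 2) 1)⁻¹.toFun (fun t => t)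
    refine (key (fun t => rfl) (fun s => ?_) w).trans (PT.pull_id _)
    rw [Equiv.swap_inv]
    ext
    change (2 : Fin (m + 3)).val - s.val = (Equiv.swap 0 1 s).val + 1
    rw [val_swap, Fin.val_two, Fin.val_zero, Fin.val_one]
    grind
  have h1 : PT.graft pairCollapse' 1 midPair (midPair_injective m) pairCollapse'_eq_one
      (permSlot (Equiv.swap 0 1) (Equiv.swap_apply_left 0 1) (Poly.first f (Fin.cons v y))) w =
      PT.graft pairCollapse 0 midPair (midPair_injective m) pairCollapse_eq_zero
        (Poly.first f (Fin.cons v y)) w := by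
    have key := PT.graft_of_pull (φ := pairCollapse) (φ' := pairCollapse')
      (he := midPair_injective m) (hφ := pairCollapse_eq_zero) (hφ' := pairCollapse'_eq_one)
      (B := Poly.first f (Fin.cons v y)) (B' := permSlot (Equiv.swap 0 1)
        (Equiv.swap_apply_left 0 1) (Poly.first f (Fin.cons v y)))
      (Equiv.swap (0 : Fin (m + 2)) 1)⁻¹.toFun
    refine key (fun t => ?_) (fun x => rfl) w
    rw [Equiv.swap_inv]
    ext
    change (Equiv.swap (0 : Fin (m + 2)) 1 (pairCollapse' t)).val = _
    rw [val_swap, val_pairCollapse, val_pairCollapse', Fin.val_zero, Fin.val_one]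
    grind
  rw [PT.graft_neg_hom (B := permSlot (Equiv.swap 0 1) (Equiv.swap_apply_left 0 1)
    (Poly.first f (Fin.cons v y))) (fun x => rfl), h1, ← h0]
  rfl

theorem Poly.first_eq_neg_permSlot {m : ℕ} {f : Poly k H (m + 2) L M}
    (hf : f ∈ Cochain k H L M (m + 2)) (y : Fin m → L) (v w : L) :
    (Poly.first f (Fin.cons w y)).1 v =
      (-permSlot (Equiv.swap 0 1) (Equiv.swap_apply_left 0 1) (Poly.first f (Fin.cons v y))).1 w := by
  have h := hf (Equiv.swap 0 1)
  rw [Equiv.Perm.sign_swap (Fin.ne_of_val_ne (by simp))] at h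
  have h1 := congrArg (fun g : Poly k H (m + 2) L M => g.1 (Fin.cons v (Fin.cons w y))) h
  have h2 : (((-1 : ℤˣ) : ℤ) • f).1 (Fin.cons v (Fin.cons w y)) =
      -f.1 (Fin.cons v (Fin.cons w y)) := by
    rw [Units.val_neg, Units.val_one, neg_smul, one_smul]; rfl
  simp only [h2] at h1
  change f.1 (Fin.cons v (Fin.cons w y)) = -PT.perm (Equiv.swap 0 1)
    (f.1 (Fin.cons w (Fin.cons v y)))
  rw [← neg_eq_iff_eq_neg, ← h1, Poly.act_apply]
  congr 2
  funext t
  refine Fin.cases ?_ (fun t => ?_) t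
  · simp
  · refine Fin.cases ?_ (fun t => ?_) t
    · exact congrArg _ (Equiv.swap_apply_right 0 1)
    · have : Equiv.swap (0 : Fin (m + 2)) 1 t.succ.succ = t.succ.succ :=
        Equiv.swap_apply_of_ne_of_ne (Fin.succ_ne_zero _)
          (fun h => Fin.succ_ne_zero _ (Fin.succ_injective _ h))
      rw [Function.comp_apply, this]
      rfl

/-- The permutation that exchanges `0` with `2` and `1` with `3`. -/
def pairSwap (m : ℕ) : Equiv.Perm (Fin (m + 4)) :=
  Equiv.swap ⟨0, by omega⟩ ⟨2, by omega⟩ * Equiv.swap ⟨1, by omega⟩ ⟨3, by omega⟩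

theorem sign_pairSwap (m : ℕ) : Equiv.Perm.sign (pairSwap m) = 1 := by
  rw [pairSwap, Equiv.Perm.sign_mul, Equiv.Perm.sign_swap (Fin.ne_of_val_ne (by simp)),
    Equiv.Perm.sign_swap (Fin.ne_of_val_ne (by simp))]
  rfl

theorem val_pairSwap {m : ℕ} (t : Fin (m + 4)) : (pairSwap m t).val =
    if t.val < 2 then t.val + 2 else if t.val < 4 then t.val - 2 else t.val := by
  rw [pairSwap, Equiv.Perm.mul_apply, val_swap, val_swap]
  simp only
  grind

theorem pairSwap_inv (m : ℕ) : (pairSwap m)⁻¹ = pairSwap m := by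
  refine inv_eq_of_mul_eq_one_left (Equiv.ext fun t => Fin.ext ?_)
  rw [Equiv.Perm.mul_apply, val_pairSwap, val_pairSwap]
  simp only [Equiv.Perm.one_apply]
  grind

/-- Insertions into the first two arguments of `f` commute, and `f` changes sign when these
arguments are exchanged. The two inserted elements may therefore trade places, up to a sign and the
exchange of their pairs of tensor factors. The inner transpositions appear because `Poly.insPair`
reverses the factors of its element. -/
theorem Poly.graft_insPair {m : ℕ} {f : Poly k H (m + 2) L M}
    (hf : f ∈ Cochain k H L M (m + 2)) (y : Fin m → L) (z w : PT k H 2 L) :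
    PT.graft (collapse (m := m + 2) (n := 1) rfl) 0 (Fin.castLE (by omega))
      (Fin.castLE_injective _) (collapse_eq_zero (m := m + 2) (n := 1) rfl) (Poly.insPair f y z) w =
    -PT.perm (pairSwap m) (PT.graft (collapse (m := m + 2) (n := 1) rfl) 0
      (Fin.castLE (by omega)) (Fin.castLE_injective _) (collapse_eq_zero (m := m + 2) (n := 1) rfl)
      (Poly.insPair f y (PT.perm (Equiv.swap 0 1) w)) (PT.perm (Equiv.swap 0 1) z)) := by
  have h3 : (1 : ℕ) ≤ (⟨3, by omega⟩ : Fin (m + 4)).val := by simp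
  have key := PT.graft_comm (F := fun v => Poly.first f (Fin.cons v y))
    (G := fun v => -permSlot (Equiv.swap 0 1) (Equiv.swap_apply_left 0 1)
      (Poly.first f (Fin.cons v y))) (Poly.first_eq_neg_permSlot hf y)
    (P := Poly.insPair f y) (Poly.insPair_eq_graft f y)
    (Q := fun w => -Poly.insPair f y (PT.perm (Equiv.swap 0 1) w)) (Poly.neg_insPair_swap f y)
    (φ₁ := collapse (m := m + 2) (n := 1) rfl) (e₁ := Fin.castLE (by omega))
    (he₁ := Fin.castLE_injective _) (hφ₁ := collapse_eq_zero (m := m + 2) (n := 1) rfl)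
    (χ₁ := pairCollapse₂) (ε₁ := revPair (⟨3, by omega⟩ : Fin (m + 4)))
    (hε₁ := revPair_injective h3) (hχ₁ := pairCollapse₂_eq_zero)
  refine (key (fun t => ?_) (fun s t => ?_) (fun s t => ?_) (fun s s' => ?_) z w).trans ?_
  · ext
    rw [val_pairCollapse, val_pairCollapse', val_pairCollapse₂]
    simp only [collapse]
    grind
  · simp only [Fin.ext_iff, collapse, revPair, Fin.val_two]
    omega
  · rw [Fin.ext_iff, val_pairCollapse₂]
    simp only [Fin.ext_iff, midPair, Fin.val_castLE]
    grind
  · refine Fin.ne_of_val_ne ?_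
    simp only [revPair, Fin.val_castLE]
    omega
  · rw [PT.graft_neg_hom (B := Poly.insPair f y (PT.perm (Equiv.swap 0 1) w)) (fun x => rfl),
      neg_inj]
    -- This restores the standard order of positions: `pairSwap` carries the first pair to the
    -- second, and the reversal inside the pair is undone by the transposition applied to `z`.
    have h4 := PT.graft_pull (φ := collapse (m := m + 2) (n := 1) rfl)
      (e := Fin.castLE (by omega)) (he := Fin.castLE_injective (by omega : 2 ≤ m + 4))
      (hφ := collapse_eq_zero (m := m + 2) (n := 1) rfl)
      (φ' := pairCollapse₂) (he' := revPair_injective h3) (hφ' := pairCollapse₂_eq_zero)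
      (Poly.insPair f y (PT.perm (Equiv.swap 0 1) w)) (Equiv.swap (0 : Fin 2) 1)⁻¹.toFun
      (pairSwap m)⁻¹.toFun (fun t => ?_) (fun s => ?_) (PT.perm (Equiv.swap 0 1) z)
    · have h5 : PT.pull (k := k) (H := H) (Equiv.swap (0 : Fin 2) 1)⁻¹.toFun
          (PT.perm (Equiv.swap 0 1) z) = z := PT.perm_swap_swap 0 1 z
      rw [h5] at h4
      exact h4
    · rw [pairSwap_inv]
      ext
      change (pairSwap m t).val - 1 = _
      rw [val_pairSwap, val_pairCollapse₂]
      grind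
    · rw [pairSwap_inv, Equiv.swap_inv]
      ext
      change (pairSwap m (revPair _ s)).val = (Equiv.swap (0 : Fin 2) 1 s).val
      rw [val_pairSwap, val_swap, Fin.val_zero, Fin.val_one]
      simp only [revPair]
      grind

/-- The operation is f(g(x₃, x₂), h(x₀, x₁), x₄, …). The transposition brings the second argument of
`f` to the front for the outer substitution and thereby reverses the arguments of `g`. -/
theorem Poly.subst_act_swap_subst {m : ℕ} (f : Poly k H (m + 2) L M) (g h : Poly k H 2 L L)
    (x : Fin (m + 4) → L) :
    (Poly.subst (m := m + 2) (n := 1) rfl (Poly.act (Equiv.swap 0 2)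
      (Poly.subst (m := m + 1) (n := 1) rfl f g)) h).1 x =
    PT.graft (collapse (m := m + 2) (n := 1) rfl) 0 (Fin.castLE (by omega))
      (Fin.castLE_injective _) (collapse_eq_zero (m := m + 2) (n := 1) rfl)
      (Poly.insPair f (fun t => x ⟨t.val + 4, by omega⟩)
        (g.1 fun j => x (revPair ⟨3, by omega⟩ j)))
      (h.1 fun j => x ⟨j.val, by omega⟩) := by
  rw [Poly.subst_apply]
  refine PT.graft_congr (hφ := collapse_eq_zero (m := m + 2) (n := 1) rfl) (fun t => rfl) rfl (fun s => rfl)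
    (fun v => ?_) _
  change PT.perm (Equiv.swap (0 : Fin (m + 3)) 2)
    ((Poly.subst (m := m + 1) (n := 1) rfl f g).1 _) = _
  rw [Poly.insPair_apply, Poly.subst_apply]
  set y : Fin (m + 2) → L := fun t => x (tailIdx (rfl : m + 2 + 1 = m + 2 + 1) t) with hy
  have e1 : (fun t => ((Fin.cons v y : Fin (m + 3) → L) ∘ Equiv.swap 0 2)
      (tailIdx (rfl : m + 1 + 1 = m + 1 + 1) t)) =
      (Fin.cons v fun t => x ⟨t.val + 4, by omega⟩ : Fin (m + 1) → L) := by
    funext t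
    refine Fin.cases ?_ (fun t => ?_) t
    · have : Equiv.swap (0 : Fin (m + 3)) 2 (tailIdx (rfl : m + 1 + 1 = m + 1 + 1) 0) = 0 :=
        Equiv.swap_apply_right 0 2
      rw [Function.comp_apply, this, Fin.cons_zero, Fin.cons_zero]
    · have : Equiv.swap (0 : Fin (m + 3)) 2 (tailIdx (rfl : m + 1 + 1 = m + 1 + 1) t.succ) =
          Fin.succ ⟨t.val + 2, by omega⟩ := by
        ext
        rw [val_swap, Fin.val_zero, Fin.val_two]
        simp only [tailIdx, Fin.val_succ]
        grind
      rw [Function.comp_apply, this, Fin.cons_succ, Fin.cons_succ, hy]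
      refine congrArg x (Fin.ext ?_)
      simp only [tailIdx]
      omega
  have e2 : (fun t => ((Fin.cons v y : Fin (m + 3) → L) ∘ Equiv.swap 0 2)
      (headIdx (rfl : m + 1 + 1 = m + 1 + 1) t)) = fun j => x (revPair ⟨3, by omega⟩ j) := by
    funext j
    have : Equiv.swap (0 : Fin (m + 3)) 2 (headIdx (rfl : m + 1 + 1 = m + 1 + 1) j) =
        Fin.succ ⟨1 - j.val, by omega⟩ := by
      ext
      rw [val_swap, Fin.val_zero, Fin.val_two]
      simp only [headIdx, Fin.val_castLE, Fin.val_succ]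
      grind
    rw [Function.comp_apply, this, Fin.cons_succ, hy]
    refine congrArg x (Fin.ext ?_)
    simp only [tailIdx, revPair]
    omega
  rw [e1, e2]

/-- Both inserted operations are the same `g`. Exchanging the two pairs of variables is an even
permutation but exchanges two arguments of the skew map `f`; the two reversals inside the pairs
contribute signs that cancel. So F is minus an even permutation of itself, and twice its alternation
vanishes. -/
theorem Poly.alt_subst_act_swap_subst [CharZero k] {m : ℕ} {f : Poly k H (m + 2) L M}
    (hf : f ∈ Cochain k H L M (m + 2)) {g : Poly k H 2 L L} (hg : g ∈ Cochain k H L L 2) :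
    Poly.alt (Poly.subst (m := m + 2) (n := 1) rfl (Poly.act (Equiv.swap 0 2)
      (Poly.subst (m := m + 1) (n := 1) rfl f g)) g) = 0 := by
  set F := Poly.subst (m := m + 2) (n := 1) rfl (Poly.act (Equiv.swap 0 2)
      (Poly.subst (m := m + 1) (n := 1) rfl f g)) g with hF
  have hg' : ∀ x y : Fin 2 → L, x 0 = y 1 → x 1 = y 0 →
      PT.perm (Equiv.swap 0 1) (g.1 x) = -g.1 y := by
    intro x y h0 h1
    have h := congrArg (fun g : Poly k H 2 L L => g.1 y) (hg (Equiv.swap 0 1))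
    rw [Equiv.Perm.sign_swap (by decide)] at h
    have h2 : (((-1 : ℤˣ) : ℤ) • g).1 y = -g.1 y := by
      rw [Units.val_neg, Units.val_one, neg_smul, one_smul]; rfl
    simp only [h2, Poly.act_apply] at h
    rw [← h]
    congr 2
    funext t
    refine Fin.cases ?_ (fun t => ?_) t
    · simpa using h0
    · rw [Subsingleton.elim t 0]
      simpa using h1
  have h1 : F = -Poly.act (pairSwap m) F := by
    refine Poly.ext fun x => ?_
    rw [Poly.neg_apply, Poly.act_apply, hF, Poly.subst_act_swap_subst, Poly.subst_act_swap_subst,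
      Poly.graft_insPair hf]
    congr 2
    rw [hg' (fun j => x ⟨j.val, by omega⟩)
      (fun j => (x ∘ pairSwap m) (revPair ⟨3, by omega⟩ j)),
      hg' (fun j => x (revPair ⟨3, by omega⟩ j))
      (fun j => (x ∘ pairSwap m) ⟨j.val, by omega⟩), map_neg,
      PT.graft_neg_hom (fun v => Poly.insPair_neg _ _ _ v), neg_neg]
    · congr 2
    all_goals
      refine congrArg x (Fin.ext ?_)
      rw [val_pairSwap]
      simp [revPair]
  have h2 := congrArg Poly.alt h1
  rw [map_neg, Poly.alt_act, sign_pairSwap, Units.val_one, one_smul] at h2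
  have h4 : (2 : k) • Poly.alt F = 0 := by
    rw [two_smul]
    nth_rewrite 1 [h2]
    exact neg_add_cancel _
  exact (smul_eq_zero.1 h4).resolve_left (by norm_num)

end ParallelSubstitution

/-! ### The Chevalley-Eilenberg differential and its square. -/

section ChevalleyEilenberg

variable {k H : Type*} [Field k] [Ring H] [HopfAlgebra k H] [Coalgebra.IsCocomm k H]
variable {L M : Type*}
  [AddCommGroup L] [Module k L] [Module H L] [IsScalarTower k H L]
  [AddCommGroup M] [Module k M] [Module H M] [IsScalarTower k H M]

/-- `(x₀, …, xₘ₊₁) ↦ f (μ (x₀, x₁), x₂, …)`. -/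
def PBil.before (μ : PBil k H L L L) {m : ℕ} : Poly k H (m + 1) L M →ₗ[k] Poly k H (m + 2) L M :=
  (Poly.substₗ (m := m) (n := 1) rfl).flip (PBil.toPoly μ)

theorem PBil.before_apply (μ : PBil k H L L L) {m : ℕ} (f : Poly k H (m + 1) L M) :
    PBil.before μ f = Poly.subst (m := m) (n := 1) rfl f (PBil.toPoly μ) := rfl

theorem PBil.before_act (μ : PBil k H L L L) {m : ℕ} (τ : Equiv.Perm (Fin m))
    (f : Poly k H (m + 1) L M) : PBil.before μ (Poly.act (shiftPerm τ) f) =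
      Poly.act (shiftPerm (shiftPerm τ)) (PBil.before μ f) := by
  refine Poly.subst_act_left _ f _ τ _ (fun j => ?_) (fun t => ?_)
  · refine Fin.cases ?_ (fun j => ?_) j
    · exact shiftPerm_zero _
    · have : (headIdx (m := m) (n := 1) rfl j.succ) = Fin.succ 0 := by
        rw [Subsingleton.elim j 0]
        rfl
      rw [this, shiftPerm_succ, shiftPerm_zero]
  · have : ∀ t, tailIdx (m := m) (n := 1) rfl t = t.succ.succ := fun t => by
      ext
      simp only [tailIdx, Fin.val_succ]
      omega
    rw [this, this, shiftPerm_succ, shiftPerm_succ]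

theorem PBil.alt_before_act (μ : PBil k H L L L) {m : ℕ} (τ : Equiv.Perm (Fin m))
    (f : Poly k H (m + 1) L M) : Poly.alt (PBil.before μ (Poly.act (shiftPerm τ) f)) =
      (Equiv.Perm.sign τ : ℤ) • Poly.alt (PBil.before μ f) := by
  rw [PBil.before_act, Poly.alt_act, sign_shiftPerm, sign_shiftPerm]

/-- A permutation of the arguments of `f` becomes one fixing the acting argument, and the outer
alternation absorbs it with its sign; all p! summands of the inner alternation are therefore equal.
-/
theorem PBil.alt_after_alt (ζ : PBil k H L M M) {p : ℕ} (f : Poly k H p L M) :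
    Poly.alt (PBil.after ζ (Poly.alt f)) = p.factorial • Poly.alt (PBil.after ζ f) := by
  rw [Poly.alt_apply f, map_sum, map_sum, factorial_eq_card p]
  refine Finset.sum_eq_card_nsmul fun σ _ => ?_
  rw [map_zsmul, map_zsmul, PBil.after_act, Poly.alt_act, sign_shiftPerm, smul_smul, sign_mul_self,
    one_smul]

/-- Conjugating a transposition by a permutation under which everything is skew-symmetric. -/
theorem Poly.alt_act_swap_conj {n p : ℕ} {L' M' : Type*}
    [AddCommGroup L'] [Module k L'] [Module H L'] [IsScalarTower k H L']
    [AddCommGroup M'] [Module k M'] [Module H M']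
    (Φ : Poly k H (n + 1) L M →ₗ[k] Poly k H p L' M')
    (hΦ : ∀ (τ : Equiv.Perm (Fin n)) g, Poly.alt (Φ (Poly.act (shiftPerm τ) g)) =
      (Equiv.Perm.sign τ : ℤ) • Poly.alt (Φ g)) (g : Poly k H (n + 1) L M)
    (τ : Equiv.Perm (Fin n))
    (hg : Poly.act (shiftPerm τ⁻¹) g = (Equiv.Perm.sign τ : ℤ) • g) (i : Fin (n + 1)) :
    Poly.alt (Φ (Poly.act (Equiv.swap 0 (shiftPerm τ i)) g)) =
      Poly.alt (Φ (Poly.act (Equiv.swap 0 i) g)) := by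
  have h : Equiv.swap 0 (shiftPerm τ i) = shiftPerm τ * Equiv.swap 0 i * shiftPerm τ⁻¹ := by
    conv_lhs => rw [← shiftPerm_zero τ]
    rw [Equiv.swap_apply_apply, shiftPerm_inv]
  rw [h, Poly.act_mul, Poly.act_mul, hΦ, hg, map_zsmul, map_zsmul, map_zsmul, smul_smul,
    sign_mul_self, one_smul]

/-- Sort the inner alternation by the argument that receives the bracket. If it is the acting one,
nothing changes. The `m + 1` others all contribute the same, by conjugation with permutations of the
arguments of `f`, and there the bracket goes into `f` itself, with the sign of a transposition. -/
theorem PBil.alt_before_alt_after (μ : PBil k H L L L) (ζ : PBil k H L M M) {m : ℕ}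
    {f : Poly k H (m + 1) L M} (hf : f ∈ Cochain k H L M (m + 1)) :
    Poly.alt (PBil.before μ (Poly.alt (PBil.after ζ f))) = (m + 1).factorial •
      (Poly.alt (PBil.before μ (PBil.after ζ f)) -
        (m + 1) • Poly.alt (PBil.after ζ (PBil.before μ f))) := by
  have hZ : ∀ τ : Equiv.Perm (Fin (m + 1)), Poly.act (shiftPerm τ) (PBil.after ζ f) =
      (Equiv.Perm.sign τ : ℤ) • PBil.after ζ f := fun τ => by
    rw [← PBil.after_act, hf τ, map_zsmul]
  rw [Poly.alt_alt_eq_swaps _ (PBil.alt_before_act μ)]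
  congr 1
  rw [Fin.sum_univ_succ, Equiv.swap_self, sub_eq_add_neg]
  congr 1
  · rw [← Equiv.Perm.one_def, Poly.act_one]; simp
  · have h : ∀ j : Fin (m + 1), (Equiv.Perm.sign (Equiv.swap 0 j.succ) : ℤ) • Poly.alt
        (PBil.before μ (Poly.act (Equiv.swap 0 j.succ) (PBil.after ζ f))) =
        -Poly.alt (PBil.after ζ (PBil.before μ f)) := fun j => by
      have h1 : j.succ = shiftPerm (Equiv.swap 0 j) 1 := by
        have : (1 : Fin (m + 2)) = Fin.succ 0 := rfl
        rw [this, shiftPerm_succ, Equiv.swap_apply_left]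
      rw [Equiv.Perm.sign_swap (Fin.succ_ne_zero j).symm, h1,
        Poly.alt_act_swap_conj _ (PBil.alt_before_act μ) _ _ (by rw [hZ, Equiv.Perm.sign_inv]),
        PBil.before_apply, PBil.subst_act_swap_after, Poly.alt_act, sign_threeCycle]
      simp [PBil.before_apply]
    rw [Finset.sum_congr rfl fun j _ => h j]
    simp

/-- Sort by the argument of `f(μ(x₀, x₁), x₂, …)` into which the second bracket goes. The first two
give nested brackets, killed by Jacobi; the others give brackets in two different arguments of `f`,
killed by exchanging them. -/
theorem IsLiePseudo.alt_before_alt_before [CharZero k] {μ : PBil k H L L L} (hμ : IsLiePseudo μ)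
    {m : ℕ} {f : Poly k H (m + 1) L M} (hf : f ∈ Cochain k H L M (m + 1)) :
    Poly.alt (PBil.before μ (Poly.alt (PBil.before μ f))) = 0 := by
  have hμ2 := PBil.toPoly_mem hμ.1
  rw [Poly.alt_alt_eq_swaps _ (PBil.alt_before_act μ)]
  refine smul_eq_zero_of_right _ (Finset.sum_eq_zero fun j _ => smul_eq_zero_of_right _ ?_)
  refine Fin.cases ?_ (fun j => Fin.cases ?_ (fun t => ?_) j) j
  · rw [Equiv.swap_self, ← Equiv.Perm.one_def, Poly.act_one]
    exact hμ.alt_subst_subst f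
  -- Insertion into the second argument of μ is minus insertion into the first, since μ is skew.
  · have h : Poly.act (Equiv.swap 0 (Fin.succ 0)) (PBil.before μ f) = -PBil.before μ f := by
      have h1 := Poly.subst_act_right (m := m) (n := 1) rfl f (PBil.toPoly μ) (Equiv.swap 0 1)
        (Equiv.swap 0 (Fin.succ 0)) (fun j => ?_) (fun t => ?_)
      · rw [hμ2, Equiv.Perm.sign_swap (by decide)] at h1
        refine h1.symm.trans ?_
        have h2 := map_zsmul (Poly.substₗ (m := m) (n := 1) rfl f) (((-1 : ℤˣ) : ℤ))
          (PBil.toPoly μ)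
        refine h2.trans ?_
        rw [Units.val_neg, Units.val_one, neg_smul, one_smul]
        rfl
      · ext
        simp only [headIdx, Fin.val_castLE, val_swap, Fin.val_succ, Fin.val_zero, Fin.val_one,
          zero_add]
      · ext
        simp only [tailIdx, val_swap, Fin.val_succ, Fin.val_zero]
        grind
    rw [h, map_neg, map_neg, neg_eq_zero]
    exact hμ.alt_subst_subst f
  · cases m with
    | zero => exact t.elim0
    | succ m =>
      -- All arguments from position `2` on are equivalent, because `f` is skew in them; it suffices
      -- to treat position `2` itself.
      have h1 : t.succ.succ = shiftPerm (shiftPerm (Equiv.swap 0 t)) 2 := by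
        have : (2 : Fin (m + 3)) = Fin.succ (Fin.succ 0) := rfl
        rw [this, shiftPerm_succ, shiftPerm_succ, Equiv.swap_apply_left]
      rw [h1, Poly.alt_act_swap_conj _ (PBil.alt_before_act μ)]
      · exact Poly.alt_subst_act_swap_subst hf hμ2
      · rw [shiftPerm_inv, ← PBil.before_act, Cochain.act_shiftPerm hf, map_zsmul,
          Equiv.Perm.sign_inv, sign_shiftPerm]

/-- The Chevalley-Eilenberg coboundary as a combination of alternations. -/
theorem ceD_eq_alt [CharZero k] {μ : PBil k H L L L} (ζ : PBil k H L M M)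
    (hμ : ∀ x y, μ.1 x y = -PT.perm (Equiv.swap 0 1) (μ.1 y x)) {m : ℕ}
    {f : Poly k H (m + 1) L M} (hf : f ∈ Cochain k H L M (m + 1)) :
    ceD μ ζ (m + 1) f = ((m + 1).factorial : k)⁻¹ • Poly.alt (PBil.after ζ f) -
      (2 * (m.factorial : k))⁻¹ • Poly.alt (PBil.before μ f) := by
  have h1 := Poly.alt_eq_cycles (f := PBil.after ζ f) fun τ => by
    rw [← PBil.after_act, hf τ, map_zsmul]
  have h2 := Poly.alt_eq_shuffles 2 (Nat.le_add_left 2 m) (f := PBil.before μ f) fun κ hκ =>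
    Poly.act_subst_of_skew (m := m) (n := 1) rfl (Cochain.act_shiftPerm hf) (PBil.toPoly_mem hμ) hκ
  have h3 : ∑ σ ∈ shuffles 2 (m + 2), (Equiv.Perm.sign σ : ℤ) • Poly.act σ (PBil.before μ f) =
      -∑ σ ∈ shuffles 2 (m + 2), (-1 : ℤ) ^ ((σ 0 : ℕ) + (σ 1 : ℕ)) •
        Poly.act σ (PBil.before μ f) := by
    rw [← Finset.sum_neg_distrib]
    refine Finset.sum_congr rfl fun σ hσ => ?_
    rw [sign_two_shuffle hσ, neg_smul]
  have hm : (m.factorial : k) ≠ 0 := Nat.cast_ne_zero.2 m.factorial_ne_zero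
  have hm' : ((m + 1).factorial : k) ≠ 0 := Nat.cast_ne_zero.2 (m + 1).factorial_ne_zero
  rw [h3, Nat.add_sub_cancel, ← Nat.cast_smul_eq_nsmul k, Nat.cast_mul, Nat.factorial_two] at h2
  rw [← Nat.cast_smul_eq_nsmul k] at h1
  rw [h1, h2, inv_smul_smul₀ hm', Nat.cast_two,
    inv_smul_smul₀ (mul_ne_zero two_ne_zero hm), sub_neg_eq_add]
  simp only [ceD, LinearMap.add_apply, LinearMap.sum_apply, LinearMap.smul_apply,
    LinearMap.comp_apply]
  rfl

theorem ceD_mem [CharZero k] {μ : PBil k H L L L} (ζ : PBil k H L M M)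
    (hμ : ∀ x y, μ.1 x y = -PT.perm (Equiv.swap 0 1) (μ.1 y x)) (p : ℕ)
    {f : Poly k H p L M} (hf : f ∈ Cochain k H L M p) : ceD μ ζ p f ∈ Cochain k H L M (p + 1) := by
  cases p with
  | zero =>
    intro σ
    have : σ = 1 := Equiv.ext fun i => Subsingleton.elim (α := Fin 1) _ _
    rw [this, Poly.act_one]
    simp
  | succ m =>
    rw [ceD_eq_alt ζ hμ hf]
    exact sub_mem (Submodule.smul_mem _ _ (Poly.alt_mem _)) (Submodule.smul_mem _ _ (Poly.alt_mem _))

/-- The commutator of two actions is a difference of terms related by an odd transposition, so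
alternation doubles one of them. -/
theorem IsRep.alt_before_after {μ : PBil k H L L L} {ζ : PBil k H L M M} (h : IsRep μ ζ) {p : ℕ}
    (f : Poly k H p L M) : Poly.alt (PBil.before μ (PBil.after ζ f)) =
      (2 : k) • Poly.alt (PBil.after ζ (PBil.after ζ f)) := by
  rw [PBil.before_apply, h.subst_after, map_sub, Poly.alt_act,
    Equiv.Perm.sign_swap (Fin.ne_of_val_ne (by simp))]
  simp [two_smul]

/-- With both differentials written as alternations, only Alt ZZf and Alt ZBf survive, for Z and B
the action and the bracket substitution. Each occurs twice with opposite coefficients, 1/(m+1)! and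
1/(2·m!) respectively. -/
theorem ceD_ceD [CharZero k] {μ : PBil k H L L L} {ζ : PBil k H L M M} (hμ : IsLiePseudo μ)
    (hζ : IsRep μ ζ) (p : ℕ) {f : Poly k H p L M} (hf : f ∈ Cochain k H L M p) :
    ceD μ ζ (p + 1) (ceD μ ζ p f) = 0 := by
  rw [ceD_eq_alt ζ hμ.1 (ceD_mem ζ hμ.1 p hf)]
  cases p with
  | zero =>
    -- In degree zero the inner differential is the action alone, with no alternation, so the factor
    -- 2 of the representation identity already cancels the coefficient 1/2.
    change _ • Poly.alt (PBil.after ζ (PBil.after ζ f)) -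
      _ • Poly.alt (PBil.before μ (PBil.after ζ f)) = 0
    rw [hζ.alt_before_after, smul_smul, ← sub_smul]
    simp
  | succ m =>
    rw [ceD_eq_alt ζ hμ.1 hf]
    simp only [map_sub, map_smul]
    rw [PBil.alt_after_alt, PBil.alt_after_alt, PBil.alt_before_alt_after μ ζ hf,
      hμ.alt_before_alt_before hf, hζ.alt_before_after]
    have hm : (m.factorial : k) ≠ 0 := Nat.cast_ne_zero.2 m.factorial_ne_zero
    have hm1 : ((m : k) + 1) ≠ 0 := Nat.cast_add_one_ne_zero m
    have hm2 : ((m : k) + 1 + 1) ≠ 0 := by exact_mod_cast Nat.succ_ne_zero (m + 1)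
    simp only [← Nat.cast_smul_eq_nsmul k, Nat.factorial_succ, Nat.cast_mul, Nat.cast_add,
      Nat.cast_one]
    match_scalars <;> field_simp <;> ring

end ChevalleyEilenberg

/-! ### Change of modules and transport of structure. -/

section Transport

variable {k H : Type*} [Field k] [Ring H] [HopfAlgebra k H] [Coalgebra.IsCocomm k H]
variable {L L' M M' N N' : Type*}
  [AddCommGroup L] [Module k L] [Module H L] [IsScalarTower k H L]
  [AddCommGroup L'] [Module k L'] [Module H L'] [IsScalarTower k H L']
  [AddCommGroup M] [Module k M] [Module H M] [IsScalarTower k H M]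
  [AddCommGroup M'] [Module k M'] [Module H M'] [IsScalarTower k H M']
  [AddCommGroup N] [Module k N] [Module H N] [IsScalarTower k H N]
  [AddCommGroup N'] [Module k N'] [Module H N'] [IsScalarTower k H N']

theorem PBil.ext {B B' : PBil k H L M N} (h : ∀ x y, B.1 x y = B'.1 x y) : B = B' :=
  Subtype.ext (LinearMap.ext fun x => LinearMap.ext fun y => h x y)

theorem PBil.comp_apply (B : PBil k H L M N) (S : L' →ₗ[H] L) (T : M' →ₗ[H] M) (x : L') (y : M') :
    (PBil.comp B S T).1 x y = B.1 (S x) (T y) := rfl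

theorem PBil.map_apply (T : N →ₗ[H] N') (B : PBil k H L M N) (x : L) (y : M) :
    (PBil.map T B).1 x y = PT.map T (B.1 x y) := rfl

theorem PBil.swap_apply (B : PBil k H L M N) (x : L) (y : M) :
    (PBil.swap B).1 y x = PT.perm (Equiv.swap 0 1) (B.1 x y) := rfl

theorem PBil.add_apply (B B' : PBil k H L M N) (x : L) (y : M) :
    (B + B').1 x y = B.1 x y + B'.1 x y := rfl

theorem PBil.sub_apply (B B' : PBil k H L M N) (x : L) (y : M) :
    (B - B').1 x y = B.1 x y - B'.1 x y := rfl

theorem PBil.neg_apply (B : PBil k H L M N) (x : L) (y : M) : (-B).1 x y = -B.1 x y := rfl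

theorem PBil.insR_comp (B : PBil k H L M N) (S : L' →ₗ[H] L) (T : M' →ₗ[H] M) (q : ℕ) (x : L')
    (w : PT k H q M') : PBil.insR B q (S x) (PT.map T w) = PBil.insR (PBil.comp B S T) q x w :=
  PT.graft_map T (fun _ => rfl) w

theorem PBil.insL_comp (B : PBil k H L M N) (S : L' →ₗ[H] L) (T : M' →ₗ[H] M) (q : ℕ) (y : M')
    (w : PT k H q L') : PBil.insL B q (T y) (PT.map S w) = PBil.insL (PBil.comp B S T) q y w :=
  PT.graft_map S (fun _ => rfl) w

theorem PBil.map_insR (T : N →ₗ[H] N') (B : PBil k H L M N) (q : ℕ) (x : L)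
    (w : PT k H q M) : PT.map T (PBil.insR B q x w) = PBil.insR (PBil.map T B) q x w :=
  PT.map_graft T (fun _ => rfl) w

theorem PBil.map_insL (T : N →ₗ[H] N') (B : PBil k H L M N) (q : ℕ) (y : M)
    (w : PT k H q L) : PT.map T (PBil.insL B q y w) = PBil.insL (PBil.map T B) q y w :=
  PT.map_graft T (fun _ => rfl) w

theorem PBil.insR_zero (q : ℕ) (x : L) (w : PT k H q M) :
    PBil.insR (0 : PBil k H L M N) q x w = 0 := PT.graft_zero_hom w

theorem PT.map_sub_hom {n : ℕ} (S T : M →ₗ[H] N) (z : PT k H n M) :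
    PT.map (S - T) z = PT.map S z - PT.map T z := by
  rw [eq_sub_iff_add_eq, ← PT.map_add_hom, sub_add_cancel]

/-- Transport of a Lie pseudobracket along an isomorphism. -/
theorem IsLiePseudo.conj {μ : PBil k H L L L} (hμ : IsLiePseudo μ) (S : L' →ₗ[H] L)
    (R : L →ₗ[H] L') (hSR : S ∘ₗ R = LinearMap.id) :
    IsLiePseudo (PBil.map R (PBil.comp μ S S)) := by
  -- A value pushed out along `R` and reinserted through `S` is unchanged. This one-sided identity
  -- is all that the transport uses.
  have hS : ∀ {n : ℕ} (w : PT k H n L), PT.map S (PT.map R w) = w := fun w => by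
    rw [PT.map_map, hSR, PT.map_id]
  have h1 : ∀ x w, PBil.insR (PBil.map R (PBil.comp μ S S)) 2 x (PT.map R w) =
      PT.map R (PBil.insR μ 2 (S x) w) := fun x w => by
    rw [← PBil.map_insR, ← PBil.insR_comp, hS]
  have h2 : ∀ x w, PBil.insL (PBil.map R (PBil.comp μ S S)) 2 x (PT.map R w) =
      PT.map R (PBil.insL μ 2 (S x) w) := fun x w => by
    rw [← PBil.map_insL, ← PBil.insL_comp, hS]
  refine ⟨fun x y => ?_, fun x y z => ?_⟩
  · rw [PBil.map_apply, PBil.comp_apply, PBil.map_apply, PBil.comp_apply, hμ.1, map_neg,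
      PT.map_perm]
  · simp only [PBil.map_apply, PBil.comp_apply, h1, h2]
    rw [hμ.2, map_add, PT.map_perm]

end Transport

/-! ### The graph of T as a subalgebra. -/

section Subalgebra

variable {k H : Type*} [Field k] [Ring H] [HopfAlgebra k H] [Coalgebra.IsCocomm k H]
variable {𝔤 𝔥 : Type*}
  [AddCommGroup 𝔤] [Module k 𝔤] [Module H 𝔤] [IsScalarTower k H 𝔤]
  [AddCommGroup 𝔥] [Module k 𝔥] [Module H 𝔥] [IsScalarTower k H 𝔥]

theorem PT.inl_fst_add_inr_snd {n : ℕ} (w : PT k H n (𝔤 × 𝔥)) :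
    PT.map (LinearMap.inl H 𝔤 𝔥) (PT.map (LinearMap.fst H 𝔤 𝔥) w) +
      PT.map (LinearMap.inr H 𝔤 𝔥) (PT.map (LinearMap.snd H 𝔤 𝔥) w) = w := by
  rw [PT.map_map, PT.map_map, ← PT.map_add_hom]
  have : LinearMap.inl H 𝔤 𝔥 ∘ₗ LinearMap.fst H 𝔤 𝔥 + LinearMap.inr H 𝔤 𝔥 ∘ₗ LinearMap.snd H 𝔤 𝔥 =
      LinearMap.id := by
    ext x <;> simp
  rw [this, PT.map_id]

variable {Ω : PBil k H (𝔤 × 𝔥) (𝔤 × 𝔥) (𝔤 × 𝔥)}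

/-- The bracket of the second summand, if it is a subalgebra, and its action on the first. -/
theorem IsLiePseudo.subalgebra_and_quotient (hΩ : IsLiePseudo Ω)
    (h : ∀ u v : 𝔥, PT.map (LinearMap.fst H 𝔤 𝔥) (Ω.1 (0, u) (0, v)) = 0) :
    IsLiePseudo (cmpMu Ω) ∧ IsRep (cmpMu Ω) (PBil.map (LinearMap.fst H 𝔤 𝔥)
      (PBil.comp Ω (LinearMap.inr H 𝔤 𝔥) (LinearMap.inl H 𝔤 𝔥))) := by
  have h0 : PBil.map (LinearMap.fst H 𝔤 𝔥)
      (PBil.comp Ω (LinearMap.inr H 𝔤 𝔥) (LinearMap.inr H 𝔤 𝔥)) = 0 := PBil.ext h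
  have hμ : ∀ u v, Ω.1 (LinearMap.inr H 𝔤 𝔥 u) (LinearMap.inr H 𝔤 𝔥 v) =
      PT.map (LinearMap.inr H 𝔤 𝔥) ((cmpMu Ω).1 u v) := fun u v => by
    have := PT.inl_fst_add_inr_snd (Ω.1 (LinearMap.inr H 𝔤 𝔥 u) (LinearMap.inr H 𝔤 𝔥 v))
    have e : PT.map (LinearMap.fst H 𝔤 𝔥)
      (Ω.1 (LinearMap.inr H 𝔤 𝔥 u) (LinearMap.inr H 𝔤 𝔥 v)) = 0 := h u v
    rw [e, map_zero, zero_add] at this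
    exact this.symm
  -- Bracketing with 𝔥 keeps 𝔥 inside itself, so modulo 𝔥 the result depends only on the 𝔤-part of
  -- `w`: the action descends to the quotient.
  have hR : ∀ u w, PT.map (LinearMap.fst H 𝔤 𝔥) (PBil.insR Ω 2 (LinearMap.inr H 𝔤 𝔥 u) w) =
      PBil.insR (PBil.map (LinearMap.fst H 𝔤 𝔥)
        (PBil.comp Ω (LinearMap.inr H 𝔤 𝔥) (LinearMap.inl H 𝔤 𝔥))) 2 u
        (PT.map (LinearMap.fst H 𝔤 𝔥) w) := fun u w => by
    conv_lhs => rw [← PT.inl_fst_add_inr_snd w]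
    rw [map_add, map_add, PBil.insR_comp, PBil.insR_comp, PBil.map_insR, PBil.map_insR, h0,
      PBil.insR_zero, add_zero]
  refine ⟨⟨fun u v => ?_, fun u v w => ?_⟩, fun u v x => ?_⟩
  · rw [cmpMu, PBil.map_apply, PBil.map_apply, PBil.comp_apply, PBil.comp_apply, hΩ.1, map_neg,
      PT.map_perm]
  · have := congrArg (PT.map (LinearMap.snd H 𝔤 𝔥)) (hΩ.2 (LinearMap.inr H 𝔤 𝔥 u)
      (LinearMap.inr H 𝔤 𝔥 v) (LinearMap.inr H 𝔤 𝔥 w))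
    rw [hμ, hμ, hμ, map_add, PT.map_perm, PBil.insR_comp, PBil.insL_comp, PBil.insR_comp,
      PBil.map_insR, PBil.map_insL, PBil.map_insR] at this
    exact this
  -- The Jacobi identity for two elements of 𝔥 and one of 𝔤, read modulo 𝔥, is the representation
  -- axiom.
  · have := congrArg (PT.map (LinearMap.fst H 𝔤 𝔥)) (hΩ.2 (LinearMap.inr H 𝔤 𝔥 u)
      (LinearMap.inr H 𝔤 𝔥 v) (LinearMap.inl H 𝔤 𝔥 x))
    rw [hμ, map_add, PT.map_perm, hR, hR, PBil.insL_comp, PBil.map_insL] at this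
    exact eq_sub_of_add_eq this.symm

variable (Ω) in
/-- The bracket transported along `(x, u) ↦ (x + T u, u)`. -/
def twistBy (T : 𝔥 →ₗ[H] 𝔤) : PBil k H (𝔤 × 𝔥) (𝔤 × 𝔥) (𝔤 × 𝔥) :=
  PBil.map (LinearMap.id - LinearMap.inl H 𝔤 𝔥 ∘ₗ T ∘ₗ LinearMap.snd H 𝔤 𝔥)
    (PBil.comp Ω (LinearMap.id + LinearMap.inl H 𝔤 𝔥 ∘ₗ T ∘ₗ LinearMap.snd H 𝔤 𝔥)
      (LinearMap.id + LinearMap.inl H 𝔤 𝔥 ∘ₗ T ∘ₗ LinearMap.snd H 𝔤 𝔥))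

/-- The two maps in the transport, (x, u) ↦ (x + Tu, u) and (x, u) ↦ (x - Tu, u), are mutually
inverse. -/
theorem IsLiePseudo.twistBy (hΩ : IsLiePseudo Ω) (T : 𝔥 →ₗ[H] 𝔤) : IsLiePseudo (twistBy Ω T) :=
  hΩ.conj _ _ (by ext x <;> simp)

theorem twistBy_apply (T : 𝔥 →ₗ[H] 𝔤) (x y : 𝔤 × 𝔥) : (LiePseudo.twistBy Ω T).1 x y =
    PT.map (LinearMap.id - LinearMap.inl H 𝔤 𝔥 ∘ₗ T ∘ₗ LinearMap.snd H 𝔤 𝔥)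
      (Ω.1 (x.1 + T x.2, x.2) (y.1 + T y.2, y.2)) := by
  have h : ∀ x : 𝔤 × 𝔥, ((LinearMap.id : 𝔤 × 𝔥 →ₗ[H] 𝔤 × 𝔥) + LinearMap.inl H 𝔤 𝔥 ∘ₗ T ∘ₗ LinearMap.snd H 𝔤 𝔥) x = (x.1 + T x.2, x.2) := fun x => by ext <;> simp
  rw [LiePseudo.twistBy, PBil.map_apply, PBil.comp_apply, h, h]

theorem PT.fst_twist {n : ℕ} (T : 𝔥 →ₗ[H] 𝔤) (w : PT k H n (𝔤 × 𝔥)) :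
    PT.map (LinearMap.fst H 𝔤 𝔥)
      (PT.map (LinearMap.id - LinearMap.inl H 𝔤 𝔥 ∘ₗ T ∘ₗ LinearMap.snd H 𝔤 𝔥) w) =
      PT.map (LinearMap.fst H 𝔤 𝔥) w - PT.map T (PT.map (LinearMap.snd H 𝔤 𝔥) w) := by
  rw [PT.map_map, PT.map_map, ← PT.map_sub_hom]
  congr 1

theorem PT.snd_twist {n : ℕ} (T : 𝔥 →ₗ[H] 𝔤) (w : PT k H n (𝔤 × 𝔥)) :
    PT.map (LinearMap.snd H 𝔤 𝔥)
      (PT.map (LinearMap.id - LinearMap.inl H 𝔤 𝔥 ∘ₗ T ∘ₗ LinearMap.snd H 𝔤 𝔥) w) =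
      PT.map (LinearMap.snd H 𝔤 𝔥) w := by
  rw [PT.map_map]
  have : LinearMap.snd H 𝔤 𝔥 ∘ₗ
      (LinearMap.id - LinearMap.inl H 𝔤 𝔥 ∘ₗ T ∘ₗ LinearMap.snd H 𝔤 𝔥) = LinearMap.snd H 𝔤 𝔥 := by
    ext x <;> simp
  rw [this]

theorem IsLiePseudo.map_inr_inl {N : Type*} [AddCommGroup N] [Module k N] [Module H N]
    [IsScalarTower k H N] (hΩ : IsLiePseudo Ω) (S : 𝔤 × 𝔥 →ₗ[H] N) (u : 𝔥) (x : 𝔤) :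
    PT.map S (Ω.1 (0, u) (x, 0)) = -PT.perm (Equiv.swap 0 1) (PT.map S (Ω.1 (x, 0) (0, u))) := by
  rw [hΩ.1, map_neg, PT.map_perm]

/-- The value of the bracket on elements of the graph of `T`, after projection. -/
theorem IsLiePseudo.map_graph {N : Type*} [AddCommGroup N] [Module k N] [Module H N]
    [IsScalarTower k H N] (hΩ : IsLiePseudo Ω) (S : 𝔤 × 𝔥 →ₗ[H] N) (x y : 𝔤) (u v : 𝔥) :
    PT.map S (Ω.1 (x, u) (y, v)) = PT.map S (Ω.1 (x, 0) (y, 0)) + PT.map S (Ω.1 (x, 0) (0, v)) -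
      PT.perm (Equiv.swap 0 1) (PT.map S (Ω.1 (y, 0) (0, u))) + PT.map S (Ω.1 (0, u) (0, v)) := by
  have h : ∀ (x : 𝔤) (u : 𝔥), (x, u) = (x, 0) + (0, u) := fun x u => by simp
  rw [h x u, h y v]
  simp only [map_add, LinearMap.add_apply]
  rw [hΩ.map_inr_inl S u y]
  abel

variable {T : 𝔥 →ₗ[H] 𝔤}

/-- The change of coordinates does not affect 𝔥-components, so this is the 𝔥-component of Ω(Tu + u,
Tv + v), expanded bilinearly and with skew-symmetry. -/
theorem muT_eq_cmpMu_twistBy (hΩ : IsLiePseudo Ω) :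
    muT Ω T = cmpMu (LiePseudo.twistBy Ω T) := by
  refine PBil.ext fun u v => ?_
  have h : (cmpMu (LiePseudo.twistBy Ω T)).1 u v = PT.map (LinearMap.snd H 𝔤 𝔥)
      ((LiePseudo.twistBy Ω T).1 (0, u) (0, v)) := rfl
  rw [h, twistBy_apply, PT.snd_twist]
  simp only [zero_add]
  rw [hΩ.map_graph]
  simp only [muT, PBil.add_apply, PBil.sub_apply, PBil.swap_apply, PBil.comp_apply]
  simp only [cmpMu, cmpRho, cmpTheta, PBil.map_apply, PBil.comp_apply, LinearMap.inl_apply,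
    LinearMap.inr_apply, LinearMap.id_apply]
  abel

/-- This is the 𝔤-component of Ω(Tu + u, x) in the new coordinates, that is, its 𝔤-part minus T of
its 𝔥-part. It explains the shape of ζ, including the terms with T in front. -/
theorem zeta_eq_twistBy (hΩ : IsLiePseudo Ω) :
    zeta Ω T = PBil.map (LinearMap.fst H 𝔤 𝔥)
      (PBil.comp (LiePseudo.twistBy Ω T) (LinearMap.inr H 𝔤 𝔥) (LinearMap.inl H 𝔤 𝔥)) := by
  refine PBil.ext fun u x => ?_
  rw [PBil.map_apply, PBil.comp_apply, LinearMap.inr_apply, LinearMap.inl_apply, twistBy_apply,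
    PT.fst_twist]
  simp only [zero_add, map_zero, add_zero]
  rw [hΩ.map_graph (LinearMap.fst H 𝔤 𝔥), hΩ.map_graph (LinearMap.snd H 𝔤 𝔥)]
  have h0 : ((0 : 𝔤), (0 : 𝔥)) = 0 := rfl
  simp only [h0, map_zero, add_zero, map_sub, PT.map_perm]
  simp only [zeta, PBil.add_apply, PBil.sub_apply, PBil.swap_apply, PBil.comp_apply,
    PBil.neg_apply, PBil.map_apply, map_add, map_sub, map_neg, PT.map_perm, PT.perm_swap_swap]
  simp only [cmpEta, cmpPi, cmpRho, cmpTheta, PBil.map_apply, PBil.comp_apply, LinearMap.inl_apply,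
    LinearMap.inr_apply, LinearMap.id_apply]
  -- The π-term of ζ is written with `x` first, that of the transported bracket with `T u` first.
  rw [hΩ.1 (x, 0) (T u, 0)]
  simp only [map_neg, PT.map_perm, PT.perm_swap_swap]
  abel

/-- The deformation equation is the vanishing of the 𝔤-component of the transported bracket on 𝔥,
which is what makes 𝔥 a subalgebra for it. -/
theorem IsQuasiTwilled.isLiePseudo_muT_and_isRep_zeta (hΩ : IsQuasiTwilled Ω) (hT : IsDMap Ω T) :
    IsLiePseudo (muT Ω T) ∧ IsRep (muT Ω T) (zeta Ω T) := by
  rw [muT_eq_cmpMu_twistBy hΩ.1, zeta_eq_twistBy hΩ.1]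
  refine (hΩ.1.twistBy T).subalgebra_and_quotient fun u v => ?_
  rw [twistBy_apply, PT.fst_twist, sub_eq_zero]
  simp only [zero_add]
  rw [hΩ.1.map_graph (LinearMap.fst H 𝔤 𝔥), hΩ.1.map_graph (LinearMap.snd H 𝔤 𝔥), hΩ.2, add_zero]
  refine (hT u v).trans (congrArg _ ?_)
  simp only [cmpMu, cmpRho, cmpTheta, PBil.map_apply, PBil.comp_apply, LinearMap.inl_apply,
    LinearMap.inr_apply]
  abel

end Subalgebra

/-! ### The Nijenhuis-Richardson bracket with an H-linear map. -/

section Bracket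

variable {k H : Type*} [Field k] [Ring H] [HopfAlgebra k H] [Coalgebra.IsCocomm k H]
variable {L L' M M' : Type*}
  [AddCommGroup L] [Module k L] [Module H L] [IsScalarTower k H L]
  [AddCommGroup L'] [Module k L'] [Module H L'] [IsScalarTower k H L']
  [AddCommGroup M] [Module k M] [Module H M] [IsScalarTower k H M]
  [AddCommGroup M'] [Module k M'] [Module H M'] [IsScalarTower k H M']

theorem Poly.circ_apply {m n r : ℕ} (hr : r = m + n) (f : Poly k H (m + 1) L M)
    (g : Poly k H (n + 1) L L) : Poly.circ hr f g = ∑ σ ∈ shuffles (n + 1) (r + 1),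
      (Equiv.Perm.sign σ : ℤ) • Poly.act σ (Poly.subst hr f g) := by
  simp only [Poly.circ, LinearMap.sum_apply, LinearMap.smul_apply, LinearMap.compr₂_apply]
  rfl

theorem Poly.nr_apply {m n r : ℕ} (hr : r = m + n) (f : Poly k H (m + 1) L L)
    (g : Poly k H (n + 1) L L) : Poly.nr hr f g = Poly.circ hr f g -
      (-1 : ℤ) ^ (m * n) • Poly.circ (hr.trans (Nat.add_comm m n)) g f := rfl

theorem Poly.conj_apply {p : ℕ} (S : L' →ₗ[H] L) (R : M →ₗ[H] M') (f : Poly k H p L M)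
    (x : Fin p → L') : (Poly.conj S R f).1 x = PT.map R (f.1 fun t => S (x t)) := rfl

theorem Poly.conj_act {p : ℕ} (S : L' →ₗ[H] L) (R : M →ₗ[H] M') (σ : Equiv.Perm (Fin p))
    (f : Poly k H p L M) : Poly.conj S R (Poly.act σ f) = Poly.act σ (Poly.conj S R f) :=
  Poly.ext fun _ => PT.map_perm R σ _

theorem Poly.conj_alt {p : ℕ} (S : L' →ₗ[H] L) (R : M →ₗ[H] M') (f : Poly k H p L M) :
    Poly.conj S R (Poly.alt f) = Poly.alt (Poly.conj S R f) := by
  rw [Poly.alt_apply, Poly.alt_apply, map_sum]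
  refine Finset.sum_congr rfl fun σ _ => ?_
  rw [map_zsmul, Poly.conj_act]

theorem Poly.conj_mem {p : ℕ} (S : L' →ₗ[H] L) (R : M →ₗ[H] M') {f : Poly k H p L M}
    (hf : f ∈ Cochain k H L M p) : Poly.conj S R f ∈ Cochain k H L' M' p := fun σ => by
  rw [← Poly.conj_act, hf σ, map_zsmul]

theorem Poly.ofHom_apply (S : L →ₗ[H] M) (x : Fin 1 → L) :
    (Poly.ofHom (k := k) S).1 x = PT.mk 1 (S (x 0)) := rfl

theorem Poly.subst_toPoly_ofHom (b : PBil k H L L M) (S : L →ₗ[H] L) (hr : 1 = 1 + 0) :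
    Poly.subst hr (PBil.toPoly b) (Poly.ofHom S) = PBil.toPoly (PBil.comp b S LinearMap.id) := by
  refine Poly.ext fun x => ?_
  rw [Poly.subst_apply, Poly.ofHom_apply]
  refine (PT.graft_mk _ _ _ _ _ _ _ _).trans ?_
  rw [map_one, one_smul]
  have h : (collapse hr : Fin 2 → Fin 2) = fun t => t := rfl
  rw [h, PT.pull_id]
  rfl

theorem Poly.subst_ofHom {n : ℕ} (S : L →ₗ[H] M) (hr : n = 0 + n) (g : Poly k H (n + 1) L L) :
    Poly.subst hr (Poly.ofHom S) g = Poly.conj LinearMap.id S g := by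
  refine Poly.ext fun x => ?_
  rw [Poly.subst_apply, Poly.conj_apply]
  change _ = PT.map S (g.1 x)
  have h0 : (fun j => x (headIdx hr j)) = x := rfl
  rw [h0]
  generalize g.1 x = z
  induction z using PT.induction with
  | h0 => simp
  | hmk a v =>
    refine (PT.graft_mk _ _ _ _ _ _ _ _).trans ?_
    have h1 : (Poly.first (Poly.ofHom (k := k) S) fun t => x (tailIdx hr t)).1 v =
      PT.mk 1 (S v) := rfl
    rw [h1, PT.pull_mk, map_one, PT.smul_mk, mul_one, PT.map_mk]
    congr 1
    exact emb_id a
  | hadd z w hz hw => simp only [map_add, hz, hw]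

theorem PBil.act_swap_toPoly (b : PBil k H L L M) :
    Poly.act (Equiv.swap 0 1) (PBil.toPoly b) = PBil.toPoly (PBil.swap b) :=
  Poly.ext fun _ => rfl

/-- The bracket of a binary operation with an `H`-linear map. -/
def PBil.der (b : PBil k H L L L) (S : L →ₗ[H] L) : PBil k H L L L :=
  PBil.comp b S LinearMap.id - PBil.swap (PBil.comp b S LinearMap.id) - PBil.map S b

theorem shuffles_one_two : shuffles 1 2 = {1, Equiv.swap 0 1} := by decide

theorem shuffles_two_two : shuffles 2 2 = {1} := by decide

/-- There are two shuffles when `S` is put into an argument of `b` and one when `b` is put into `S`;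
the sign exponent is zero. Bracketing with `T` thus stays inside binary operations, so iterated
brackets can be computed there. -/
theorem Poly.nr_toPoly_ofHom (b : PBil k H L L L) (S : L →ₗ[H] L) (hr : 1 = 1 + 0) :
    Poly.nr hr (PBil.toPoly b) (Poly.ofHom S) = PBil.toPoly (PBil.der b S) := by
  rw [Poly.nr_apply, Poly.circ_apply, Poly.circ_apply, Poly.subst_toPoly_ofHom, Poly.subst_ofHom]
  have h1 : shuffles (0 + 1) (1 + 1) = {1, Equiv.swap 0 1} := shuffles_one_two
  have h2 : shuffles (1 + 1) (1 + 1) = {1} := shuffles_two_two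
  rw [h1, h2, Finset.sum_pair (by decide), Finset.sum_singleton, Poly.act_one, Poly.act_one,
    Equiv.Perm.sign_one, Equiv.Perm.sign_swap (by decide)]
  have h3 : Poly.act (Equiv.swap (0 : Fin (1 + 1)) 1)
      (PBil.toPoly (PBil.comp b S LinearMap.id)) =
      PBil.toPoly (PBil.swap (PBil.comp b S LinearMap.id)) := PBil.act_swap_toPoly _
  rw [h3]
  simp only [mul_zero, pow_zero, one_smul, Units.val_one, Units.val_neg, neg_smul]
  rw [← sub_eq_add_neg]
  rfl

end Bracket

/-! ### The twisted operation as a bracket with a semidirect product. -/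

section TwistedOperation

variable {k H : Type*} [Field k] [Ring H] [HopfAlgebra k H] [Coalgebra.IsCocomm k H]
variable {𝔤 𝔥 : Type*}
  [AddCommGroup 𝔤] [Module k 𝔤] [Module H 𝔤] [IsScalarTower k H 𝔤]
  [AddCommGroup 𝔥] [Module k 𝔥] [Module H 𝔥] [IsScalarTower k H 𝔥]

/-- The semidirect product bracket
`((x, u), (y, v)) ↦ (ζ (u, y) - (12) ζ (v, x), μ (u, v))` on `𝔤 × 𝔥`. -/
def semidirect (μ : PBil k H 𝔥 𝔥 𝔥) (ζ : PBil k H 𝔥 𝔤 𝔤) :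
    PBil k H (𝔤 × 𝔥) (𝔤 × 𝔥) (𝔤 × 𝔥) :=
  PBil.map (LinearMap.inl H 𝔤 𝔥)
      (PBil.comp ζ (LinearMap.snd H 𝔤 𝔥) (LinearMap.fst H 𝔤 𝔥) -
        PBil.swap (PBil.comp ζ (LinearMap.snd H 𝔤 𝔥) (LinearMap.fst H 𝔤 𝔥))) +
    PBil.map (LinearMap.inr H 𝔤 𝔥)
      (PBil.comp μ (LinearMap.snd H 𝔤 𝔥) (LinearMap.snd H 𝔤 𝔥))

/-- `(z, y) ↦ b (z, y)` with `z` in the abelian ideal of a semidirect product. -/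
theorem semidirect_ins_inl (μ : PBil k H 𝔥 𝔥 𝔥) (ζ : PBil k H 𝔥 𝔤 𝔤) {n r : ℕ} (hr : r = 1 + n)
    (y : Fin 1 → 𝔤 × 𝔥) (w : PT k H (n + 1) 𝔤) :
    Poly.ins hr (PBil.toPoly (semidirect μ ζ)) y (PT.map (LinearMap.inl H 𝔤 𝔥) w) =
      -PT.map (LinearMap.inl H 𝔤 𝔥) (PT.graft (collapse hr) 0 (Fin.castLE (by omega))
        (Fin.castLE_injective _) (collapse_eq_zero hr) (PBil.left (PBil.swap ζ) (y 0).2) w) := by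
  set B : SlotHom k H 2 0 𝔤 (𝔤 × 𝔥) :=
    PBil.left (PBil.map (LinearMap.inl H 𝔤 𝔥) (PBil.swap ζ)) (y 0).2 with hB
  have h1 := PT.map_graft (he := Fin.castLE_injective (by omega : n + 1 ≤ r + 1))
    (hφ := collapse_eq_zero hr) (B := PBil.left (PBil.swap ζ) (y 0).2) (B' := B)
    (LinearMap.inl H 𝔤 𝔥) (fun _ => rfl) w
  have h2 := PT.graft_map (he := Fin.castLE_injective (by omega : n + 1 ≤ r + 1))
    (hφ := collapse_eq_zero hr) (B := Poly.first (PBil.toPoly (semidirect μ ζ)) y) (B' := -B)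
    (LinearMap.inl H 𝔤 𝔥) (fun z => ?_) w
  · refine h2.trans ?_
    rw [h1]
    exact PT.graft_neg_hom (fun _ => rfl) w
  · change -PT.map (LinearMap.inl H 𝔤 𝔥) (PT.perm (Equiv.swap 0 1) (ζ.1 (y 0).2 z)) =
      (semidirect μ ζ).1 (z, 0) (y 0)
    simp only [semidirect, PBil.add_apply, PBil.map_apply, PBil.sub_apply, PBil.comp_apply,
      PBil.swap_apply, LinearMap.fst_apply, LinearMap.snd_apply, map_zero, LinearMap.zero_apply,
      zero_sub, map_neg, add_zero]

/-- Insertion into the first argument of `(12) ζ` in terms of insertion into the second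
argument of `ζ`. -/
theorem PBil.graft_left_swap (ζ : PBil k H 𝔥 𝔤 𝔤) {n : ℕ} (hr : n + 1 = 1 + n) (v : 𝔥)
    (w : PT k H (n + 1) 𝔤) :
    PT.graft (collapse hr) 0 (Fin.castLE (by omega)) (Fin.castLE_injective _)
        (collapse_eq_zero hr) (PBil.left (PBil.swap ζ) v) w =
      PT.perm (Fin.last (n + 1)).cycleRange.symm (PBil.insR ζ (n + 1) v w) := by
  have key := PT.graft_rel (φ := fun t : Fin (n + 2) => Fin.cases 0 (fun _ => 1) t) (i := 1)
    (e := Fin.succ) (he := Fin.succ_injective (n + 1))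
    (hφ := (fun j => by refine Fin.cases ?_ (fun j => ?_) j <;> simp))
    (φ' := collapse hr) (i' := 0) (e' := Fin.castLE (by omega)) (he' := Fin.castLE_injective _)
    (hφ' := collapse_eq_zero hr) (B := PBil.right ζ v) (B' := PBil.left (PBil.swap ζ) v)
    (Equiv.swap (0 : Fin 2) 1)⁻¹.toFun ((Fin.last (n + 1)).cycleRange.symm)⁻¹.toFun
    (fun _ => rfl)
  refine key (fun t => ?_) (fun s => ?_) (fun s hs => ?_) w
  · rw [Equiv.swap_inv]
    change Equiv.swap (0 : Fin 2) 1 (collapse hr t) =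
      Fin.cases 0 (fun _ => 1) ((Fin.last (n + 1)).cycleRange t)
    refine Fin.lastCases ?_ (fun t => ?_) t
    · rw [Fin.cycleRange_self]
      ext
      rw [val_swap]
      simp [collapse]
    · rw [Fin.cycleRange_of_lt (Fin.castSucc_lt_last t), Fin.coeSucc_eq_succ]
      ext
      rw [val_swap]
      simp only [collapse, Fin.val_castSucc, Fin.val_zero, Fin.val_one, Fin.cases_succ]
      grind
  · change (Fin.last (n + 1)).cycleRange s.castSucc = s.succ
    rw [Fin.cycleRange_of_lt (Fin.castSucc_lt_last s), Fin.coeSucc_eq_succ]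
  · rw [Equiv.swap_inv] at hs
    change Equiv.swap 0 1 s = 1 at hs
    revert hs
    revert s
    decide

/-- The values of `f` lie in the abelian ideal 𝔤, so only the term with ζ and its minus sign
survives. Here the acting argument comes last, whereas `PBil.after` has it first; the cycle accounts
for the difference. -/
theorem subst_semidirect_liftHG (μ : PBil k H 𝔥 𝔥 𝔥) (ζ : PBil k H 𝔥 𝔤 𝔤) {n : ℕ}
    (hr : n + 1 = 1 + n) (f : Poly k H (n + 1) 𝔥 𝔤) :
    Poly.subst hr (PBil.toPoly (semidirect μ ζ)) (liftHG k H 𝔤 𝔥 (n + 1) f) =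
      -liftHG k H 𝔤 𝔥 (n + 2)
        (Poly.act (Fin.last (n + 1)).cycleRange.symm (PBil.after ζ f)) := by
  refine Poly.ext fun x => ?_
  rw [Poly.subst_apply, Poly.neg_apply, liftHG, liftHG, Poly.conj_apply, Poly.conj_apply,
    semidirect_ins_inl, PBil.graft_left_swap, Poly.act_apply, PBil.after_apply]
  have e1 : tailIdx hr 0 = (Fin.last (n + 1)).cycleRange.symm 0 := by
    rw [Fin.cycleRange_symm_zero]
    ext
    simp [tailIdx]
  have e2 : ∀ t : Fin (n + 1), headIdx hr t = (Fin.last (n + 1)).cycleRange.symm t.succ := by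
    intro t
    rw [Equiv.eq_symm_apply]
    change (Fin.last (n + 1)).cycleRange t.castSucc = t.succ
    rw [Fin.cycleRange_of_lt (Fin.castSucc_lt_last t), Fin.coeSucc_eq_succ]
  simp only [e1, e2]
  rfl

/-- The lifted cochain sees only 𝔥-components of its arguments, and the 𝔥-component of the
semidirect bracket is μ. -/
theorem subst_liftHG_semidirect (μ : PBil k H 𝔥 𝔥 𝔥) (ζ : PBil k H 𝔥 𝔤 𝔤) {n : ℕ}
    (f : Poly k H (n + 1) 𝔥 𝔤) :
    Poly.subst (m := n) (n := 1) rfl (liftHG k H 𝔤 𝔥 (n + 1) f) (PBil.toPoly (semidirect μ ζ)) =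
      liftHG k H 𝔤 𝔥 (n + 2) (PBil.before μ f) := by
  refine Poly.ext fun x => ?_
  rw [Poly.subst_apply, liftHG, liftHG, Poly.conj_apply, PBil.before_apply, Poly.subst_apply]
  set y : Fin n → 𝔤 × 𝔥 := fun t => x (tailIdx (m := n) (n := 1) rfl t) with hy
  set w := (PBil.toPoly (semidirect μ ζ)).1 fun j => x (headIdx (m := n) (n := 1) rfl j) with hw
  have hw' : (PBil.toPoly μ).1 (fun j => (x (headIdx (m := n) (n := 1) rfl j)).2) =
      PT.map (LinearMap.snd H 𝔤 𝔥) w := by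
    rw [hw, PBil.toPoly_apply, PBil.toPoly_apply]
    simp only [semidirect, PBil.add_apply, PBil.map_apply, PBil.comp_apply, map_add, PT.map_map,
      LinearMap.snd_comp_inl, LinearMap.snd_comp_inr, PT.map_zero_hom, PT.map_id, zero_add,
      LinearMap.snd_apply]
  simp only [LinearMap.snd_apply]
  rw [hw']
  set B : SlotHom k H (n + 1) 0 (𝔤 × 𝔥) 𝔤 :=
    { val := (Poly.first f fun t => (y t).2).1 ∘ₗ (LinearMap.snd H 𝔤 𝔥).restrictScalars k
      property := fun h v => (Poly.first f fun t => (y t).2).2 h v.2 } with hB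
  have h1 := PT.graft_map (he := Fin.castLE_injective (by omega : 1 + 1 ≤ n + 1 + 1))
    (hφ := collapse_eq_zero (m := n) (n := 1) rfl) (B := Poly.first f fun t => (y t).2) (B' := B)
    (LinearMap.snd H 𝔤 𝔥) (fun _ => rfl) w
  have h2 := PT.map_graft (he := Fin.castLE_injective (by omega : 1 + 1 ≤ n + 1 + 1))
    (hφ := collapse_eq_zero (m := n) (n := 1) rfl) (B := B)
    (B' := Poly.first (liftHG k H 𝔤 𝔥 (n + 1) f) y) (LinearMap.inl H 𝔤 𝔥) (fun v => ?_) w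
  · refine Eq.trans h2.symm ?_
    rw [← h1]
    rfl
  · change PT.map (LinearMap.inl H 𝔤 𝔥) (f.1 _) = PT.map (LinearMap.inl H 𝔤 𝔥) (f.1 _)
    congr 2
    funext t
    refine Fin.cases ?_ (fun t => ?_) t <;> simp

/-- The bracket with the semidirect product bracket is the Chevalley-Eilenberg coboundary up to
sign. -/
theorem nr_semidirect_liftHG [CharZero k] {μ : PBil k H 𝔥 𝔥 𝔥} (ζ : PBil k H 𝔥 𝔤 𝔤)
    (hμ : ∀ x y, μ.1 x y = -PT.perm (Equiv.swap 0 1) (μ.1 y x)) {n : ℕ} (hr : n + 1 = 1 + n)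
    {f : Poly k H (n + 1) 𝔥 𝔤} (hf : f ∈ Cochain k H 𝔥 𝔤 (n + 1)) :
    Poly.nr hr (PBil.toPoly (semidirect μ ζ)) (liftHG k H 𝔤 𝔥 (n + 1) f) =
      liftHG k H 𝔤 𝔥 (n + 2) ((-1 : ℤ) ^ n • ceD μ ζ (n + 1) f) := by
  have hn : (n.factorial : k) ≠ 0 := Nat.cast_ne_zero.2 n.factorial_ne_zero
  have hn' : ((n + 1).factorial : k) ≠ 0 := Nat.cast_ne_zero.2 (n + 1).factorial_ne_zero
  have h1 : Poly.circ hr (PBil.toPoly (semidirect μ ζ)) (liftHG k H 𝔤 𝔥 (n + 1) f) =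
      (-1 : ℤ) ^ n • liftHG k H 𝔤 𝔥 (n + 2)
        (((n + 1).factorial : k)⁻¹ • Poly.alt (PBil.after ζ f)) := by
    have h := Poly.alt_eq_shuffles (n + 1) (Nat.le_succ (n + 1))
      (f := Poly.subst hr (PBil.toPoly (semidirect μ ζ)) (liftHG k H 𝔤 𝔥 (n + 1) f))
      fun κ hκ => Poly.act_subst_of_skew hr (fun τ => ?_) (Poly.conj_mem _ _ hf) hκ
    -- The cycle has sign (-1)^(n+1), and with the minus sign of the semidirect bracket this gives
    -- (-1)^n. The blocks have sizes `n + 1` and `1`, so only (n+1)! has to be divided out.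
    · rw [← Poly.circ_apply, subst_semidirect_liftHG, map_neg, liftHG, ← Poly.conj_alt,
        Poly.alt_act, Equiv.Perm.sign_symm, Fin.sign_cycleRange,
        show n + 1 + 1 - (n + 1) = 1 by omega, Nat.factorial_one, mul_one,
        ← Nat.cast_smul_eq_nsmul k] at h
      have h' := (inv_smul_smul₀ hn' _).symm.trans (congrArg (((n + 1).factorial : k)⁻¹ • ·) h.symm)
      rw [h', map_zsmul, map_smul]
      simp only [Fin.val_last, Units.val_pow_eq_pow_val, Units.val_neg, Units.val_one,
        pow_succ, mul_neg, mul_one, neg_smul, neg_neg]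
      rw [smul_comm]
      rfl
    · have : τ = 1 := Subsingleton.elim _ _
      have h1 : shiftPerm (1 : Equiv.Perm (Fin 1)) = 1 := by decide
      rw [this, h1, Poly.act_one]
      simp
  have h2 : Poly.circ (hr.trans (Nat.add_comm 1 n)) (liftHG k H 𝔤 𝔥 (n + 1) f)
      (PBil.toPoly (semidirect μ ζ)) = liftHG k H 𝔤 𝔥 (n + 2)
        ((2 * (n.factorial : k))⁻¹ • Poly.alt (PBil.before μ f)) := by
    have h := Poly.alt_eq_shuffles 2 (Nat.le_add_left 2 n) (f := PBil.before μ f) fun κ hκ =>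
      Poly.act_subst_of_skew (m := n) (n := 1) rfl (Cochain.act_shiftPerm hf)
        (PBil.toPoly_mem hμ) hκ
    rw [Nat.add_sub_cancel, ← Nat.cast_smul_eq_nsmul k, Nat.cast_mul, Nat.factorial_two,
      Nat.cast_two] at h
    rw [h, inv_smul_smul₀ (mul_ne_zero two_ne_zero hn), Poly.circ_apply, map_sum]
    refine Finset.sum_congr rfl fun σ _ => ?_
    rw [subst_liftHG_semidirect, map_zsmul]
    exact congrArg _ (Poly.conj_act _ _ σ _).symm
  rw [Poly.nr_apply, h1, h2, ceD_eq_alt ζ hμ hf, one_mul, map_zsmul, map_sub, smul_sub]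

theorem liftHG_ofHom (T : 𝔥 →ₗ[H] 𝔤) : liftHG k H 𝔤 𝔥 1 (Poly.ofHom T) =
    Poly.ofHom (LinearMap.inl H 𝔤 𝔥 ∘ₗ T ∘ₗ LinearMap.snd H 𝔤 𝔥) :=
  Poly.ext fun _ => PT.map_mk _ _ _

variable (Ω : PBil k H (𝔤 × 𝔥) (𝔤 × 𝔥) (𝔤 × 𝔥))

/-- `μ + η` on `𝔤 × 𝔥`. -/
def muEta : PBil k H (𝔤 × 𝔥) (𝔤 × 𝔥) (𝔤 × 𝔥) :=
  let E := PBil.map (LinearMap.inl H 𝔤 𝔥)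
    (PBil.comp (cmpEta Ω) (LinearMap.fst H 𝔤 𝔥) (LinearMap.snd H 𝔤 𝔥))
  PBil.map (LinearMap.inr H 𝔤 𝔥)
    (PBil.comp (cmpMu Ω) (LinearMap.snd H 𝔤 𝔥) (LinearMap.snd H 𝔤 𝔥)) + (E - PBil.swap E)

/-- `π + ρ` on `𝔤 × 𝔥`. -/
def piRho : PBil k H (𝔤 × 𝔥) (𝔤 × 𝔥) (𝔤 × 𝔥) :=
  let R := PBil.map (LinearMap.inr H 𝔤 𝔥)
    (PBil.comp (cmpRho Ω) (LinearMap.fst H 𝔤 𝔥) (LinearMap.snd H 𝔤 𝔥))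
  PBil.map (LinearMap.inl H 𝔤 𝔥)
    (PBil.comp (cmpPi Ω) (LinearMap.fst H 𝔤 𝔥) (LinearMap.fst H 𝔤 𝔥)) + (R - PBil.swap R)

/-- `θ` on `𝔤 × 𝔥`. -/
def thetaExt : PBil k H (𝔤 × 𝔥) (𝔤 × 𝔥) (𝔤 × 𝔥) :=
  PBil.map (LinearMap.inr H 𝔤 𝔥)
    (PBil.comp (cmpTheta Ω) (LinearMap.fst H 𝔤 𝔥) (LinearMap.fst H 𝔤 𝔥))

theorem l2_ofHom (T : 𝔥 →ₗ[H] 𝔤) {n : ℕ} (hr : n + 1 = 1 + n) (f : Poly k H (n + 1) 𝔥 𝔤) :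
    l2 Ω (a := 0) hr (Poly.ofHom T) f = Poly.nr hr (PBil.toPoly (PBil.der (piRho Ω)
      (LinearMap.inl H 𝔤 𝔥 ∘ₗ T ∘ₗ LinearMap.snd H 𝔤 𝔥))) (liftHG k H 𝔤 𝔥 (n + 1) f) := by
  rw [← Poly.nr_toPoly_ofHom _ _ rfl, ← liftHG_ofHom]
  rfl

theorem l3_ofHom_ofHom (T : 𝔥 →ₗ[H] 𝔤) {n : ℕ} (hr : n + 1 = 1 + n) (f : Poly k H (n + 1) 𝔥 𝔤) :
    l3 Ω (a := 0) (b := 0) hr (Poly.ofHom T) (Poly.ofHom T) f =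
      Poly.nr hr (PBil.toPoly (PBil.der (PBil.der (thetaExt Ω)
        (LinearMap.inl H 𝔤 𝔥 ∘ₗ T ∘ₗ LinearMap.snd H 𝔤 𝔥))
        (LinearMap.inl H 𝔤 𝔥 ∘ₗ T ∘ₗ LinearMap.snd H 𝔤 𝔥))) (liftHG k H 𝔤 𝔥 (n + 1) f) := by
  rw [← Poly.nr_toPoly_ofHom _ _ rfl, ← Poly.nr_toPoly_ofHom _ _ rfl, ← liftHG_ofHom]
  rfl

/-- All three terms of l₁^T are brackets of the lifted cochain with a binary operation, and the
bracket is linear in that operation. -/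
theorem l1T_eq_nr (T : 𝔥 →ₗ[H] 𝔤) {n : ℕ} (hr : n + 1 = 1 + n) (f : Poly k H (n + 1) 𝔥 𝔤) :
    l1T Ω T n f = Poly.nr hr (PBil.toPoly (muEta Ω +
      PBil.der (piRho Ω) (LinearMap.inl H 𝔤 𝔥 ∘ₗ T ∘ₗ LinearMap.snd H 𝔤 𝔥) +
      (1 / 2 : k) • PBil.der (PBil.der (thetaExt Ω)
        (LinearMap.inl H 𝔤 𝔥 ∘ₗ T ∘ₗ LinearMap.snd H 𝔤 𝔥))
        (LinearMap.inl H 𝔤 𝔥 ∘ₗ T ∘ₗ LinearMap.snd H 𝔤 𝔥))) (liftHG k H 𝔤 𝔥 (n + 1) f) := by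
  have h : ∀ (b b' b'' : PBil k H (𝔤 × 𝔥) (𝔤 × 𝔥) (𝔤 × 𝔥)) (c : k),
      PBil.toPoly (b + b' + c • b'') =
        PBil.toPoly b + PBil.toPoly b' + c • PBil.toPoly b'' := fun _ _ _ _ => rfl
  rw [h, map_add, map_add, map_smul]
  simp only [LinearMap.add_apply, LinearMap.smul_apply]
  rw [← l2_ofHom, ← l3_ofHom_ofHom]
  rfl

variable {Ω}

theorem IsLiePseudo.cmpPi_skew (hΩ : IsLiePseudo Ω) (x y : 𝔤) :
    (cmpPi Ω).1 x y = -PT.perm (Equiv.swap 0 1) ((cmpPi Ω).1 y x) := by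
  rw [cmpPi, PBil.map_apply, PBil.comp_apply, hΩ.1, map_neg, PT.map_perm]
  rfl

theorem IsLiePseudo.cmpTheta_skew (hΩ : IsLiePseudo Ω) (x y : 𝔤) :
    (cmpTheta Ω).1 x y = -PT.perm (Equiv.swap 0 1) ((cmpTheta Ω).1 y x) := by
  rw [cmpTheta, PBil.map_apply, PBil.comp_apply, hΩ.1, map_neg, PT.map_perm]
  rfl

theorem PBil.smul_apply (c : k) (B : PBil k H (𝔤 × 𝔥) (𝔤 × 𝔥) (𝔤 × 𝔥)) (x y : 𝔤 × 𝔥) :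
    (c • B).1 x y = c • B.1 x y := rfl

/-- With S = T regarded as an endomorphism of 𝔤 × 𝔥 one has S² = 0, so in the double bracket with θ
the surviving terms θ(S·, S·), Sθ(S·, ·) and Sθ(·, S·) each occur twice, which the factor ½
corrects. The other terms match those of μ^T and ζ. Only the skew-symmetry of Ω is needed, not the
deformation equation. -/
theorem twisted_bracket_eq_semidirect [CharZero k] (hΩ : IsLiePseudo Ω) (T : 𝔥 →ₗ[H] 𝔤) :
    muEta Ω + PBil.der (piRho Ω) (LinearMap.inl H 𝔤 𝔥 ∘ₗ T ∘ₗ LinearMap.snd H 𝔤 𝔥) +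
      (1 / 2 : k) • PBil.der (PBil.der (thetaExt Ω)
        (LinearMap.inl H 𝔤 𝔥 ∘ₗ T ∘ₗ LinearMap.snd H 𝔤 𝔥))
        (LinearMap.inl H 𝔤 𝔥 ∘ₗ T ∘ₗ LinearMap.snd H 𝔤 𝔥) = semidirect (muT Ω T) (zeta Ω T) := by
  have hl : ∀ z : PT k H 2 𝔤, PT.map (LinearMap.inl H 𝔤 𝔥 ∘ₗ T ∘ₗ LinearMap.snd H 𝔤 𝔥)
      (PT.map (LinearMap.inl H 𝔤 𝔥) z) = 0 := fun z => by
    rw [PT.map_map, LinearMap.comp_assoc, LinearMap.comp_assoc, LinearMap.snd_comp_inl,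
      LinearMap.comp_zero, LinearMap.comp_zero, PT.map_zero_hom]
  have hr : ∀ z : PT k H 2 𝔥, PT.map (LinearMap.inl H 𝔤 𝔥 ∘ₗ T ∘ₗ LinearMap.snd H 𝔤 𝔥)
      (PT.map (LinearMap.inr H 𝔤 𝔥) z) = PT.map (LinearMap.inl H 𝔤 𝔥) (PT.map T z) := fun z => by
    rw [PT.map_map, PT.map_map, LinearMap.comp_assoc, LinearMap.comp_assoc,
      LinearMap.snd_comp_inr, LinearMap.comp_id]
  refine PBil.ext fun p q => ?_
  obtain ⟨x, u⟩ := p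
  obtain ⟨y, v⟩ := q
  simp only [muEta, piRho, thetaExt, semidirect, muT, zeta, PBil.der, PBil.add_apply,
    PBil.sub_apply, PBil.neg_apply, PBil.smul_apply, PBil.map_apply, PBil.comp_apply,
    PBil.swap_apply, LinearMap.id_apply, LinearMap.comp_apply, LinearMap.fst_apply,
    LinearMap.snd_apply, LinearMap.inl_apply, map_zero, LinearMap.zero_apply, map_add, map_sub,
    map_neg, PT.map_perm, PT.perm_swap_swap, hl, hr]
  -- Skew-symmetry of π and θ brings equal terms to the same order of arguments, after which only
  -- scalars remain to be compared.
  rw [hΩ.cmpPi_skew y (T u), hΩ.cmpPi_skew x (T v), hΩ.cmpTheta_skew (T v) (T u)]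
  simp only [map_neg, PT.map_perm, PT.perm_swap_swap]
  match_scalars <;> norm_num

theorem l1T_eq_ceD [CharZero k] (hΩ : IsQuasiTwilled Ω) {T : 𝔥 →ₗ[H] 𝔤} (hT : IsDMap Ω T) (n : ℕ)
    {f : Poly k H (n + 1) 𝔥 𝔤} (hf : f ∈ Cochain k H 𝔥 𝔤 (n + 1)) :
    l1T Ω T n f = liftHG k H 𝔤 𝔥 (n + 2)
      ((-1 : ℤ) ^ n • ceD (muT Ω T) (zeta Ω T) (n + 1) f) := by
  rw [l1T_eq_nr Ω T (Nat.add_comm n 1), twisted_bracket_eq_semidirect hΩ.1]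
  exact nr_semidirect_liftHG _ (hΩ.isLiePseudo_muT_and_isRep_zeta hT).1.1 _ hf

end TwistedOperation

/-! ### Comparison of the two complexes. -/

section Cohomology

variable {k H : Type*} [Field k] [Ring H] [HopfAlgebra k H] [Coalgebra.IsCocomm k H]
variable {𝔤 𝔥 : Type*}
  [AddCommGroup 𝔤] [Module k 𝔤] [Module H 𝔤] [IsScalarTower k H 𝔤]
  [AddCommGroup 𝔥] [Module k 𝔥] [Module H 𝔥] [IsScalarTower k H 𝔥]

variable (k H 𝔤 𝔥) in
-- A cochain is recovered from its lift by restricting the arguments to 𝔥 and projecting the values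
-- to 𝔤.
theorem liftHG_injective (p : ℕ) : Function.Injective (liftHG k H 𝔤 𝔥 p) := by
  intro f g h
  refine Poly.ext fun x => ?_
  have h1 := congrArg (fun F : Poly k H p (𝔤 × 𝔥) (𝔤 × 𝔥) =>
    PT.map (LinearMap.fst H 𝔤 𝔥) (F.1 fun t => (0, x t))) h
  simpa only [liftHG, Poly.conj_apply, PT.map_map, LinearMap.fst_comp_inl, PT.map_id,
    LinearMap.snd_apply] using h1

theorem neg_one_pow_zsmul_eq {V : Type*} [AddCommGroup V] (n : ℕ) {v w : V}
    (h : (-1 : ℤ) ^ n • v = w) : v = (-1 : ℤ) ^ n • w := by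
  rw [← h, smul_smul, ← pow_add, Even.neg_one_pow ⟨n, rfl⟩, one_smul]

variable {Ω : PBil k H (𝔤 × 𝔥) (𝔤 × 𝔥) (𝔤 × 𝔥)} {T : 𝔥 →ₗ[H] 𝔤}

theorem twCocycles_eq_ceCocycles [CharZero k] (hΩ : IsQuasiTwilled Ω) (hT : IsDMap Ω T) (n : ℕ) :
    twCocycles Ω T n = ceCocycles (muT Ω T) (zeta Ω T) (n + 1) := by
  ext f
  refine and_congr_right fun hf => ?_
  change l1T Ω T n f = 0 ↔ ceD (muT Ω T) (zeta Ω T) (n + 1) f = 0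
  rw [l1T_eq_ceD hΩ hT n hf, map_eq_zero_iff _ (liftHG_injective k H 𝔤 𝔥 (n + 2))]
  exact ⟨fun h => by rw [neg_one_pow_zsmul_eq n h, smul_zero], fun h => by rw [h, smul_zero]⟩

/-- The sign is its own inverse and can be moved onto the cochain whose coboundary is taken, so both
operators have the same image once lifts are identified with cochains. -/
theorem twCoboundaries_eq_ceCoboundaries [CharZero k] (hΩ : IsQuasiTwilled Ω) (hT : IsDMap Ω T)
    (n : ℕ) :
    twCoboundaries Ω T (n + 1) = ceCoboundaries (muT Ω T) (zeta Ω T) (n + 2) := by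
  ext g
  constructor
  · rintro ⟨f, hf, h⟩
    rw [l1T_eq_ceD hΩ hT n hf] at h
    have h' := liftHG_injective k H 𝔤 𝔥 (n + 2) h
    exact ⟨(-1 : ℤ) ^ n • f, zsmul_mem hf _, (map_zsmul _ _ _).trans h'⟩
  · rintro ⟨f, hf, rfl⟩
    refine ⟨(-1 : ℤ) ^ n • f, zsmul_mem hf _, ?_⟩
    rw [l1T_eq_ceD hΩ hT n (zsmul_mem hf _)]
    congr 1
    exact (neg_one_pow_zsmul_eq n (map_zsmul _ _ _).symm).symm

/-- Equal subspaces of cocycles and of coboundaries give the same cohomology. -/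
theorem exists_quotient_equiv {V : Type*} [AddCommGroup V] [Module k V] {Z Z' B B' : Submodule k V}
    (hZ : Z = Z') (hB : B = B') : ∃ Φ : (Z ⧸ B.submoduleOf Z) ≃ₗ[k] (Z' ⧸ B'.submoduleOf Z'),
      ∀ (f : Z) (f' : Z'), f.1 = f'.1 → Φ (Submodule.Quotient.mk f) = Submodule.Quotient.mk f' := by
  subst hZ hB
  refine ⟨LinearEquiv.refl k _, fun f f' h => ?_⟩
  rw [Subtype.ext h]
  rfl

end Cohomology

end

end LiePseudo

theorem proposition4p21 {k H : Type*} [Field k] [CharZero k] [Ring H] [HopfAlgebra k H]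
    [Coalgebra.IsCocomm k H] {𝔤 𝔥 : Type*}
    [AddCommGroup 𝔤] [Module k 𝔤] [Module H 𝔤] [IsScalarTower k H 𝔤]
    [AddCommGroup 𝔥] [Module k 𝔥] [Module H 𝔥] [IsScalarTower k H 𝔥]
    (Ω : LiePseudo.PBil k H (𝔤 × 𝔥) (𝔤 × 𝔥) (𝔤 × 𝔥)) (hΩ : LiePseudo.IsQuasiTwilled Ω)
    (T : 𝔥 →ₗ[H] 𝔤) (hT : LiePseudo.IsDMap Ω T) :
    -- `(𝔥, μ^T)` is a Lie pseudoalgebra and `ζ` is a representation of it on `𝔤`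
    LiePseudo.IsLiePseudo (LiePseudo.muT Ω T) ∧
    LiePseudo.IsRep (LiePseudo.muT Ω T) (LiePseudo.zeta Ω T) ∧
    -- the Chevalley-Eilenberg operators form a complex `C^0(𝔥, 𝔤) → C^1(𝔥, 𝔤) → ⋯`
    (∀ (p : ℕ), ∀ f ∈ LiePseudo.Cochain k H 𝔥 𝔤 p,
      LiePseudo.ceD (LiePseudo.muT Ω T) (LiePseudo.zeta Ω T) p f ∈
        LiePseudo.Cochain k H 𝔥 𝔤 (p + 1)) ∧
    (∀ (p : ℕ), ∀ f ∈ LiePseudo.Cochain k H 𝔥 𝔤 p,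
      LiePseudo.ceD (LiePseudo.muT Ω T) (LiePseudo.zeta Ω T) (p + 1)
        (LiePseudo.ceD (LiePseudo.muT Ω T) (LiePseudo.zeta Ω T) p f) = 0) ∧
    -- `l₁^T f = (-1)^{p-1} d f` for `f ∈ C^p(𝔥, 𝔤)`, `p = n + 1`
    (∀ (n : ℕ), ∀ f ∈ LiePseudo.Cochain k H 𝔥 𝔤 (n + 1),
      LiePseudo.l1T Ω T n f = LiePseudo.liftHG k H 𝔤 𝔥 (n + 2)
        ((-1 : ℤ) ^ n • LiePseudo.ceD (LiePseudo.muT Ω T) (LiePseudo.zeta Ω T) (n + 1) f)) ∧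
    -- the two complexes have the same cocycles, coboundaries and cohomology
    (∀ (n : ℕ), LiePseudo.twCocycles Ω T n =
      LiePseudo.ceCocycles (LiePseudo.muT Ω T) (LiePseudo.zeta Ω T) (n + 1)) ∧
    (∀ (n : ℕ), LiePseudo.twCoboundaries Ω T (n + 1) =
      LiePseudo.ceCoboundaries (LiePseudo.muT Ω T) (LiePseudo.zeta Ω T) (n + 2)) ∧
    (∀ (n : ℕ), ∃ Φ : LiePseudo.TwCohomology Ω T (n + 1) ≃ₗ[k]
        LiePseudo.CECohomology (LiePseudo.muT Ω T) (LiePseudo.zeta Ω T) (n + 2),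
      ∀ (f : LiePseudo.twCocycles Ω T (n + 1))
        (f' : LiePseudo.ceCocycles (LiePseudo.muT Ω T) (LiePseudo.zeta Ω T) (n + 2)),
        f.1 = f'.1 → Φ (Submodule.Quotient.mk f) = Submodule.Quotient.mk f') := by
  have h := hΩ.isLiePseudo_muT_and_isRep_zeta hT
  exact ⟨h.1, h.2, fun p f hf => LiePseudo.ceD_mem _ h.1.1 p hf,
    fun p f hf => LiePseudo.ceD_ceD h.1 h.2 p hf,
    fun n f hf => LiePseudo.l1T_eq_ceD hΩ hT n hf,
    fun n => LiePseudo.twCocycles_eq_ceCocycles hΩ hT n,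
    fun n => LiePseudo.twCoboundaries_eq_ceCoboundaries hΩ hT n,
    fun n => LiePseudo.exists_quotient_equiv (LiePseudo.twCocycles_eq_ceCocycles hΩ hT (n + 1))
      (LiePseudo.twCoboundaries_eq_ceCoboundaries hΩ hT n)⟩
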